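/- Let $(X,\mathsf d)$ be a proper geodesic metric space and $\mathfrak m$ a Borel probability measure on $X$. Let $\mathrm{Geo}(X)$ be the set of $\gamma\in C([0,1],X)$ with $\mathsf d(\gamma_s,\gamma_t)=|s-t|\,\mathsf d(\gamma_0,\gamma_1)$, and $e_t(\gamma)=\gamma_t$. Assume that $X$ is non-branching: if $\gamma^1,\gamma^2\in\mathrm{Geo}(X)$ satisfy $\gamma^1_0=\gamma^2_0$ and $\gamma^1_t=\gamma^2_t$ for some $t\in(0,1)$, then $\gamma^1_1=\gamma^2_1$. For $\kappa\in\mathbb R$ put $\mathrm{s}_\kappa(\theta)=\sin(\sqrt\kappa\,\theta)$ if $\kappa>0$, $\mathrm{s}_0(\theta)=\theta$, and $\mathrm{s}_\kappa(\theta)=\sinh(\sqrt{-\kappa}\,\theta)$ if $\kappa<0$. Let $K\in\mathbb R$, $N>1$, $\kappa=K/(N-1)$, and assume that $(X,\mathsf d,\mathfrak m)$ satisfies $\mathsf{MCP}(K,N)$: for every $x\in X$ and every Borel set $A$ with $\mathfrak m(A)>0$ (and $A\subset B(x,\pi\sqrt{(N-1)/K})$ if $K>0$) there is a Borel probability measure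 $\Pi$ on $\mathrm{Geo}(X)$ with $(e_0)_\sharp\Pi=\delta_x$, $(e_1)_\sharp\Pi=\mathfrak m(A)^{-1}\mathfrak m\llcorner_A$ and, for all $t\in[0,1]$, $$(e_t)_\sharp\Big(\mathfrak m(A)\,t\,\Big(\tfrac{\mathrm s_\kappa(t\ell(\gamma))}{\mathrm s_\kappa(\ell(\gamma))}\Big)^{N-1}\,\Pi(d\gamma)\Big)\le\mathfrak m,\qquad \ell(\gamma)=\mathsf d(\gamma_0,\gamma_1),$$ where the quotient is read as $t$ if $\ell(\gamma)=0$. Let $\varphi:X\to\mathbb R$ be $1$-Lipschitz. Put $\Gamma=\{(x,y):\varphi(x)-\varphi(y)=\mathsf d(x,y)\}$, $R=\Gamma\cup\Gamma^{-1}$, $\mathcal T_e=\{x:\exists\,y\ne x,\ (x,y)\in R\}$, $A_+=\{x\in\mathcal T_e:\exists\,z,w,\ (x,z),(x,w)\in\Gamma,\ (z,w)\notin R\}$, $A_-=\{x\in\mathcal T_e:\exists\,z,w,\ (z,x),(w,x)\in\Gamma,\ (z,w)\notin R\}$, and $\mathcal T=\mathcal T_e\setminus(A_+\cup A_-)$,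 on which $R$ is an equivalence relation. A Borel quotient map is a Borel map $\mathfrak Q:\mathcal T\to\mathcal T$ with $(x,\mathfrak Q(x))\in R$ for all $x$ that is constant on the equivalence classes of $R$. Given one, put $Q=\mathfrak Q(\mathcal T)$ and $\mathfrak q=\mathfrak Q_\sharp(\mathfrak m\llcorner_{\mathcal T})$. A strongly consistent disintegration of $\mathfrak m\llcorner_{\mathcal T}$ is a family of probability measures $(\mathfrak m_q)_{q\in Q}$ such that $q\mapsto\mathfrak m_q(B)$ is $\mathfrak q$-measurable and $\mathfrak m(\mathcal T\cap B\cap\mathfrak Q^{-1}(C))=\int_C\mathfrak m_q(B)\,\mathfrak q(dq)$ for all Borel $B,C$, and $\mathfrak m_q(\mathfrak Q^{-1}(q))=1$ for $\mathfrak q$-a.e. $q$. For $q\in Q$ let $g(q,t)$ be the unique $x\in\mathcal T$ (if it exists) such that $t\ge0$, $(q,x)\in\Gamma$, $\mathsf d(q,x)=t$, or $t\le0$, $(x,q)\in\Gamma$, $\mathsf d(x,q)=-t$; let $\mathrm{Dom}(g)\subset Q\times\mathbb R$ and $\mathrm{Dom}(g(q,\cdot))\subset\mathbb R$ be the sets where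 it exists, on which the measures $\mathfrak q\otimes\mathcal L^1$ and $\mathcal L^1$ below are understood to be restricted. **Theorem.** A Borel quotient map together with a strongly consistent disintegration exists. Moreover, for every Borel quotient map $\mathfrak Q$ there is a non-negative Borel function $h$ with $$\mathfrak m\llcorner_{\mathcal T}=g_\sharp\big(h\,\mathfrak q\otimes\mathcal L^1\big)$$ such that the following holds. 1. For every strongly consistent disintegration $(\mathfrak m_q)$ and $\mathfrak q$-a.e. $q$, $\mathfrak m_q$ is absolutely continuous with respect to $g(q,\cdot)_\sharp\mathcal L^1$, and $\mathfrak m_q=g(q,\cdot)_\sharp(h(q,\cdot)\mathcal L^1)$. 2. For $\mathfrak q$-a.e. $q$, $$\left(\frac{\mathrm s_\kappa(\sigma_+-\tau)}{\mathrm s_\kappa(\sigma_+-s)}\right)^{N-1}\le\frac{h(q,\tau)}{h(q,s)}\le\left(\frac{\mathrm s_\kappa(\tau-\sigma_-)}{\mathrm s_\kappa(s-\sigma_-)}\right)^{N-1}$$ for all $\sigma_-<s\le\tau<\sigma_+$ in $\mathrm{Dom}(g(q,\cdot))$; moreover $h(q,t)>0$ for every $t\in\mathrm{Dom}(g(q,\cdot))$,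 the set $\mathrm{Dom}(g(q,\cdot))$ is convex, and $t\mapsto h(q,t)$ is locally Lipschitz on the interior of $\mathrm{Dom}(g(q,\cdot))$. -/

import Mathlib

open Set MeasureTheory
open scoped ENNReal

noncomputable section

namespace RayLocalization

/-! ### Geodesics -/

/-- Constant-speed minimizing geodesics `γ : [0,1] → X`, with the topology of uniform convergence. -/
def Geo (X : Type*) [MetricSpace X] : Type _ :=
  {γ : C(unitInterval, X) // ∀ s t : unitInterval,
    dist (γ s) (γ t) = |(s : ℝ) - (t : ℝ)| * dist (γ 0) (γ 1)}

instance (X : Type*) [MetricSpace X] : TopologicalSpace (Geo X) :=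
  inferInstanceAs (TopologicalSpace {γ : C(unitInterval, X) // ∀ s t : unitInterval,
    dist (γ s) (γ t) = |(s : ℝ) - (t : ℝ)| * dist (γ 0) (γ 1)})

instance (X : Type*) [MetricSpace X] : MeasurableSpace (Geo X) := borel (Geo X)

instance (X : Type*) [MetricSpace X] : BorelSpace (Geo X) := ⟨rfl⟩

/-- The evaluation map `e_t(γ) = γ_t`. -/
def Geo.eval {X : Type*} [MetricSpace X] (t : unitInterval) (γ : Geo X) : X := γ.1 t

/-- Any two points are joined by a geodesic. -/
def IsGeodesicSpace (X : Type*) [MetricSpace X] : Prop :=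
  ∀ x y : X, ∃ γ : Geo X, γ.eval 0 = x ∧ γ.eval 1 = y

/-- Two geodesics with the same starting point that meet at a common time `t ∈ (0,1)`
have the same final point. -/
def IsNonBranching (X : Type*) [MetricSpace X] : Prop :=
  ∀ γ₁ γ₂ : Geo X, γ₁.eval 0 = γ₂.eval 0 →
    ∀ t : unitInterval, 0 < t → t < 1 → γ₁.eval t = γ₂.eval t → γ₁.eval 1 = γ₂.eval 1

/-! ### The measure contraction property -/

/-- The comparison function of constant curvature `κ`, up to a positive constant factor:
`sin (√κ θ)`, `θ`, `sinh (√(-κ) θ)` for `κ > 0`, `κ = 0`, `κ < 0`. Only ratios are used. -/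
def sn (κ θ : ℝ) : ℝ :=
  if 0 < κ then Real.sin (θ * Real.sqrt κ)
  else if κ = 0 then θ
  else Real.sinh (θ * Real.sqrt (-κ))

/-- The distortion coefficient `σ_κ^{(t)}(θ) = sn_κ(tθ)/sn_κ(θ)`, equal to `t` at `θ = 0`. -/
def sigma (κ t θ : ℝ) : ℝ := if θ = 0 then t else sn κ (t * θ) / sn κ θ

/-- The measure contraction property `MCP(K,N)`, for `N > 1`: for every point `x` and every Borel
set `A` of positive measure (inside the open ball of radius `π √((N-1)/K)` around `x` if `K > 0`)
there is a probability measure `P` on the space of geodesics, transporting `δ_x` to the normalized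
restriction of `m` to `A`, such that for all `t ∈ [0,1]`
`(e_t)_♯ (t σ_{K/(N-1)}^{(t)}(d(γ₀,γ₁))^{N-1} m(A) P) ≤ m`. -/
def MCP {X : Type*} [MetricSpace X] [MeasurableSpace X] (m : Measure X) (K N : ℝ) : Prop :=
  ∀ (x : X) (A : Set X), MeasurableSet A → 0 < m A →
    (0 < K → A ⊆ Metric.ball x (Real.pi * Real.sqrt ((N - 1) / K))) →
    ∃ P : Measure (Geo X), IsProbabilityMeasure P ∧
      P.map (Geo.eval 0) = Measure.dirac x ∧
      P.map (Geo.eval 1) = (m A)⁻¹ • m.restrict A ∧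
      ∀ t : unitInterval,
        (P.withDensity fun γ => m A * ENNReal.ofReal
          ((t : ℝ) * sigma (K / (N - 1)) t (dist (γ.eval 0) (γ.eval 1)) ^ (N - 1))).map
            (Geo.eval t) ≤ m

/-! ### The transport set of a function -/

section Transport

variable {X : Type*} [MetricSpace X]

/-- `Γ`, the pairs moved by `φ` with maximal slope. -/
def Gam (φ : X → ℝ) : Set (X × X) := {p | φ p.1 - φ p.2 = dist p.1 p.2}

/-- `R = Γ ∪ Γ⁻¹`. -/
def Rays (φ : X → ℝ) : Set (X × X) := {p | p ∈ Gam φ ∨ p.swap ∈ Gam φ}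

/-- The transport set with end points. -/
def transportSetE (φ : X → ℝ) : Set X := {x | ∃ y, y ≠ x ∧ (x, y) ∈ Rays φ}

/-- Forward branching points. -/
def branchPlus (φ : X → ℝ) : Set X :=
  {x | x ∈ transportSetE φ ∧ ∃ z w, (x, z) ∈ Gam φ ∧ (x, w) ∈ Gam φ ∧ (z, w) ∉ Rays φ}

/-- Backward branching points. -/
def branchMinus (φ : X → ℝ) : Set X :=
  {x | x ∈ transportSetE φ ∧ ∃ z w, (z, x) ∈ Gam φ ∧ (w, x) ∈ Gam φ ∧ (z, w) ∉ Rays φ}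

/-- The transport set. -/
def transportSet (φ : X → ℝ) : Set X := transportSetE φ \ (branchPlus φ ∪ branchMinus φ)

/-- A Borel quotient map for the partition of the transport set into the equivalence classes of `R`:
it is Borel on the transport set, constant on each class, and picks a point of that class.
Its values outside the transport set are irrelevant. -/
structure IsRayQuotient [MeasurableSpace X] (φ : X → ℝ) (𝔔 : X → X) : Prop where
  measurable : Measurable fun x : transportSet φ => 𝔔 x
  mem : ∀ x ∈ transportSet φ, 𝔔 x ∈ transportSet φ ∧ (x, 𝔔 x) ∈ Rays φ
  const : ∀ x ∈ transportSet φ, ∀ y ∈ transportSet φ, (x, y) ∈ Rays φ → 𝔔 x = 𝔔 y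

/-- The quotient set `Q = 𝔔(𝒯)`. -/
def quotientSet (φ : X → ℝ) (𝔔 : X → X) : Set X := 𝔔 '' transportSet φ

/-- The quotient measure `𝔮 = 𝔔_♯ (m⌞𝒯)`. -/
def quotientMeasure [MeasurableSpace X] (m : Measure X) (φ : X → ℝ) (𝔔 : X → X) : Measure X :=
  (m.restrict (transportSet φ)).map 𝔔

/-- A disintegration `q ↦ m_q` of `m⌞𝒯` that is strongly consistent with `𝔔`. -/
structure IsDisintegration [MeasurableSpace X] (m : Measure X) (φ : X → ℝ) (𝔔 : X → X)
    (μ : X → Measure X) : Prop where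
  prob : ∀ q ∈ quotientSet φ 𝔔, IsProbabilityMeasure (μ q)
  measurable : ∀ B, MeasurableSet B → AEMeasurable (fun q => μ q B) (quotientMeasure m φ 𝔔)
  consistent : ∀ B C, MeasurableSet B → MeasurableSet C →
    m (transportSet φ ∩ B ∩ 𝔔 ⁻¹' C) = ∫⁻ q in C, μ q B ∂(quotientMeasure m φ 𝔔)
  strong : ∀ᵐ q ∂(quotientMeasure m φ 𝔔), μ q {x | x ∈ transportSet φ ∧ 𝔔 x = q} = 1

/-- `(q, t, x)` satisfies the relation that defines the graph of the ray map. -/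
def IsRayPoint (φ : X → ℝ) (q : X) (t : ℝ) (x : X) : Prop :=
  x ∈ transportSet φ ∧
    ((0 ≤ t ∧ (q, x) ∈ Gam φ ∧ dist q x = t) ∨ (t ≤ 0 ∧ (x, q) ∈ Gam φ ∧ dist x q = -t))

/-- The relation is functional in `x`, so that the choice in the definition of the ray map below
is no choice. -/
theorem IsRayPoint.unique {φ : X → ℝ} {q x y : X} {t : ℝ} (hq : q ∈ transportSet φ)
    (hx : IsRayPoint φ q t x) (hy : IsRayPoint φ q t y) : x = y := by
  obtain ⟨hqe, hqb⟩ := hq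
  simp only [mem_union, not_or] at hqb
  have key : (x, y) ∈ Rays φ → φ x = φ y → x = y := by
    intro h e
    simp only [Rays, Gam, mem_ofPred_eq, Prod.swap_prod_mk] at h
    rw [e] at h
    rcases h with h | h
    · exact dist_eq_zero.1 (by linarith)
    · exact (dist_eq_zero.1 (by linarith)).symm
  have zero : ∀ z, dist q z = 0 → z = q := fun z h => (dist_eq_zero.1 h).symm
  rcases hx.2 with ⟨h0, hx1, hx2⟩ | ⟨h0, hx1, hx2⟩ <;>
    rcases hy.2 with ⟨h0', hy1, hy2⟩ | ⟨h0', hy1, hy2⟩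
  · refine key ?_ ?_
    · by_contra hn
      exact hqb.1 ⟨hqe, x, y, hx1, hy1, hn⟩
    · simp only [Gam, mem_ofPred_eq] at hx1 hy1
      linarith
  · have ht : t = 0 := le_antisymm h0' h0
    rw [zero x (by linarith), zero y (by rw [dist_comm]; linarith)]
  · have ht : t = 0 := le_antisymm h0 h0'
    rw [zero x (by rw [dist_comm]; linarith), zero y (by linarith)]
  · refine key ?_ ?_
    · by_contra hn
      exact hqb.2 ⟨hqe, x, y, hx1, hy1, hn⟩
    · simp only [Gam, mem_ofPred_eq] at hx1 hy1
      linarith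

/-- `Dom (g(q,·))`; empty if `q ∉ Q`. -/
def rayDom (φ : X → ℝ) (𝔔 : X → X) (q : X) : Set ℝ :=
  {t | q ∈ quotientSet φ 𝔔 ∧ ∃ x, IsRayPoint φ q t x}

open Classical in
/-- The ray map `g(q,t)`, with value `q` outside its domain. -/
def rayMap (φ : X → ℝ) (𝔔 : X → X) (q : X) (t : ℝ) : X :=
  if h : q ∈ quotientSet φ 𝔔 ∧ ∃ x, IsRayPoint φ q t x then h.2.choose else q

/-- The measure `g(q,·)_♯ (f 𝓛¹)` on the ray of `q`, with `𝓛¹` restricted to `Dom (g(q,·))`. -/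
def rayMeasure [MeasurableSpace X] (φ : X → ℝ) (𝔔 : X → X) (q : X) (f : ℝ → ℝ) : Measure X :=
  ((volume.restrict (rayDom φ 𝔔 q)).withDensity fun t => ENNReal.ofReal (f t)).map (rayMap φ 𝔔 q)

/-- The measure `g_♯ (h 𝔮 ⊗ 𝓛¹)`, with `𝔮 ⊗ 𝓛¹` restricted to `Dom g`. -/
def totalRayMeasure [MeasurableSpace X] (m : Measure X) (φ : X → ℝ) (𝔔 : X → X) (h : X → ℝ → ℝ) :
    Measure X :=
  ((((quotientMeasure m φ 𝔔).prod volume).restrict {p | p.2 ∈ rayDom φ 𝔔 p.1}).withDensity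
    fun p => ENNReal.ofReal (h p.1 p.2)).map fun p => rayMap φ 𝔔 p.1 p.2

end Transport

end RayLocalization

end

open RayLocalization

namespace RayLocalization

open Filter Topology

/-! ### Gluing geodesics, and non-branching in terms of distances. -/

section Geodesics

variable {X : Type*} [MetricSpace X]

/-! The coordinates `x ↦ (𝔔 x, φ x)` are injective on the transport set, since two points of one ray
at the same level of `φ` coincide. Non-branching keeps the interior points of a ray that meets the
transport set inside it, so the levels along each ray form a nondegenerate interval. Every ray
therefore has a point at some rational level; taking the first such level in an enumeration of `ℚ`
gives a Borel quotient map.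

`MCP` contracts sets to points, whereas the rays call for contraction to a level `{φ = c}`. Replace
the level by a finite `δ`-net, cut a compact set into the cells of points with a common nearest net
point, and contract each cell to its net point. By non-branching the images of different cells are
disjoint (`disjoint_dividing`), so the lower bounds for their measures add up. As `δ → 0`,
compactness leaves only points on segments of `Γ` that join the set to the level
(`MCP.le_measure_contract`). For subsets of the transport set this is contraction along the rays
(`MCP.le_rayLaw`).

This inequality is used twice. First, a set that is null for `𝔮 ⊗ 𝓛¹` has, by Fubini, null images
under almost all contraction ratios `t`, while the measure of an image is at least a positive
multiple of that of the set; hence the law of the coordinates is absolutely continuous. Second,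
disintegrating the law over `𝔮` passes the inequality to almost every conditional law, for countably
many rational parameters at once (`MCP.ae_contractsRat`).

The rest is one-dimensional. Contracting short intervals gives the comparison of densities `h(τ) ≥
(sn|τ-c| / sn|s-c|)^(N-1) h(s)` at every point of the open interval, with `h` an upper right
density. Comparability of nearby values and connectedness exclude the values `0` and `∞`.
Contraction across length `π/√κ`, where `sn` vanishes, would force a zero, which bounds the length
of the interval. The comparisons towards the two sides give local Lipschitz continuity, so the upper
density is a limit and has a version that is jointly Borel in ray and level. Reflecting levels by `t
= φ q - a` gives the stated density. -/

theorem Geo.dist_eval (γ : Geo X) (s t : unitInterval) :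
    dist (γ.eval s) (γ.eval t) = |(s : ℝ) - t| * dist (γ.eval 0) (γ.eval 1) := γ.2 s t

theorem Geo.continuous_eval (t : unitInterval) : Continuous (Geo.eval (X := X) t) :=
  (continuous_eval_const t).comp continuous_subtype_val

theorem Geo.measurable_eval [MeasurableSpace X] [BorelSpace X] (t : unitInterval) :
    Measurable (Geo.eval (X := X) t) := (Geo.continuous_eval t).measurable

theorem Geo.dist_zero_eval (γ : Geo X) (t : unitInterval) :
    dist (γ.eval 0) (γ.eval t) = t * dist (γ.eval 0) (γ.eval 1) := by
  rw [γ.dist_eval 0 t]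
  simp [abs_of_nonneg t.2.1]

theorem Geo.dist_eval_one (γ : Geo X) (t : unitInterval) :
    dist (γ.eval t) (γ.eval 1) = (1 - t) * dist (γ.eval 0) (γ.eval 1) := by
  rw [γ.dist_eval t 1, abs_sub_comm]
  simp [abs_of_nonneg (sub_nonneg.2 t.2.2)]

/-- A curve that is Lipschitz with constant the distance of its end points is a geodesic. -/
theorem exists_geo_of_dist_le (f : unitInterval → X)
    (hf : ∀ s t : unitInterval, s ≤ t → dist (f s) (f t) ≤ (t - s : ℝ) * dist (f 0) (f 1)) :
    ∃ γ : Geo X, ∀ t, γ.eval t = f t := by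
  have key : ∀ s t : unitInterval, s ≤ t → dist (f s) (f t) = (t - s : ℝ) * dist (f 0) (f 1) := by
    intro s t hst
    refine le_antisymm (hf s t hst) ?_
    have h1 := hf 0 s s.2.1
    have h2 := hf t 1 t.2.2
    have h3 := dist_triangle4 (f 0) (f s) (f t) (f 1)
    simp only [Icc.coe_zero, Icc.coe_one] at h1 h2
    linarith
  have key' : ∀ s t : unitInterval,
      dist (f s) (f t) = |(s : ℝ) - t| * dist (f 0) (f 1) := by
    intro s t
    rcases le_total s t with h | h
    · rw [key s t h, abs_sub_comm, abs_of_nonneg (sub_nonneg.2 (Subtype.coe_le_coe.2 h))]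
    · rw [dist_comm, key t s h, abs_of_nonneg (sub_nonneg.2 (Subtype.coe_le_coe.2 h))]
  have hc : Continuous f := by
    refine (LipschitzWith.of_dist_le_mul (K := ⟨dist (f 0) (f 1), dist_nonneg⟩) ?_).continuous
    intro s t
    rw [key' s t, mul_comm, Subtype.dist_eq, Real.dist_eq]
    rfl
  exact ⟨⟨⟨f, hc⟩, key'⟩, fun t => rfl⟩

/-- Any point at the right distances is the value of a geodesic. -/
theorem IsGeodesicSpace.exists_through (hgeo : IsGeodesicSpace X) {a z b : X} {t₀ : unitInterval}
    (h0 : 0 < t₀) (h1 : t₀ < 1) (haz : dist a z = t₀ * dist a b)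
    (hzb : dist z b = (1 - t₀) * dist a b) :
    ∃ γ : Geo X, γ.eval 0 = a ∧ γ.eval 1 = b ∧ γ.eval t₀ = z := by
  obtain ⟨γ₁, ha, hz⟩ := hgeo a z
  obtain ⟨γ₂, hz', hb⟩ := hgeo z b
  have p0 : (0 : ℝ) < t₀ := h0
  have p1 : (0 : ℝ) < 1 - t₀ := sub_pos.2 h1
  let u : unitInterval → unitInterval := fun s => projIcc 0 1 zero_le_one ((s : ℝ) / t₀)
  let v : unitInterval → unitInterval := fun s => projIcc 0 1 zero_le_one (((s : ℝ) - t₀) / (1 - t₀))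
  have hu : ∀ s, s ≤ t₀ → (u s : ℝ) = s / t₀ := fun s hs => by
    have : (s : ℝ) / t₀ ∈ Icc (0 : ℝ) 1 := ⟨by have := s.2.1; positivity, (div_le_one p0).2 hs⟩
    simp [u, projIcc_of_mem zero_le_one this]
  have hv : ∀ s, t₀ ≤ s → (v s : ℝ) = (s - t₀) / (1 - t₀) := fun s hs => by
    have : ((s : ℝ) - t₀) / (1 - t₀) ∈ Icc (0 : ℝ) 1 :=
      ⟨div_nonneg (sub_nonneg.2 hs) p1.le, (div_le_one p1).2 (by linarith [s.2.2])⟩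
    simp [v, projIcc_of_mem zero_le_one this]
  let f : unitInterval → X := fun s => if s ≤ t₀ then γ₁.eval (u s) else γ₂.eval (v s)
  have f0 : f 0 = a := by
    have : u 0 = 0 := Subtype.ext (by rw [hu 0 h0.le]; simp)
    simp [f, h0.le, this, ha]
  have f1 : f 1 = b := by
    have : v 1 = 1 := Subtype.ext (by rw [hv 1 h1.le]; simp [p1.ne'])
    simp [f, h1, this, hb]
  have ft : f t₀ = z := by
    have : u t₀ = 1 := Subtype.ext (by rw [hu t₀ le_rfl]; simp [p0.ne'])
    simp [f, this, hz]
  have l1 : ∀ s t : unitInterval, s ≤ t → t ≤ t₀ →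
      dist (f s) (f t) ≤ (t - s : ℝ) * dist a b := by
    intro s t hst ht
    have hs := hst.trans ht
    simp only [f, if_pos hs, if_pos ht]
    rw [γ₁.dist_eval, hu s hs, hu t ht, ha, hz, haz, abs_sub_comm, ← sub_div,
      abs_of_nonneg (div_nonneg (sub_nonneg.2 (Subtype.coe_le_coe.2 hst)) p0.le)]
    apply le_of_eq
    field_simp
  have l2' : ∀ s : unitInterval, t₀ ≤ s → f s = γ₂.eval (v s) := by
    intro s hs
    rcases hs.eq_or_lt with rfl | hs
    · have : v t₀ = 0 := Subtype.ext (by rw [hv t₀ le_rfl]; simp)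
      rw [ft, this, hz']
    · simp [f, not_le.2 hs]
  have l2 : ∀ s t : unitInterval, s ≤ t → t₀ ≤ s →
      dist (f s) (f t) ≤ (t - s : ℝ) * dist a b := by
    intro s t hst hs
    have ht := hs.trans hst
    have e : (t - s : ℝ) / (1 - t₀) = (t - t₀) / (1 - t₀) - (s - t₀) / (1 - t₀) := by ring
    rw [l2' s hs, l2' t ht, γ₂.dist_eval, hv s hs, hv t ht, hz', hb, hzb, abs_sub_comm, ← e,
      abs_of_nonneg (div_nonneg (sub_nonneg.2 (Subtype.coe_le_coe.2 hst)) p1.le)]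
    apply le_of_eq
    field_simp
  obtain ⟨γ, hγ⟩ := exists_geo_of_dist_le f (by
    intro s t hst
    rw [f0, f1]
    rcases le_total t t₀ with h | h
    · exact l1 s t hst h
    · rcases le_total t₀ s with h' | h'
      · exact l2 s t hst h'
      · have a1 := l1 s t₀ h' le_rfl
        have a2 := l2 t₀ t h le_rfl
        have := dist_triangle (f s) (f t₀) (f t)
        linarith)
  exact ⟨γ, by rw [hγ, f0], by rw [hγ, f1], by rw [hγ, ft]⟩

/-- In a non-branching space a geodesic from `a` to `z ≠ a` extends in at most one way to a
geodesic of given length. -/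
theorem IsNonBranching.eq_of_dist_add (hgeo : IsGeodesicSpace X) (hnb : IsNonBranching X)
    {a z b₁ b₂ : X} (haz : a ≠ z) (h₁ : dist a b₁ = dist a z + dist z b₁)
    (h₂ : dist a b₂ = dist a z + dist z b₂) (h : dist z b₁ = dist z b₂) : b₁ = b₂ := by
  rcases eq_or_ne z b₁ with rfl | hz
  · rw [dist_self] at h
    exact dist_eq_zero.1 h.symm
  have pz := dist_pos.2 hz
  have pa := dist_pos.2 haz
  have hd : 0 < dist a b₁ := by linarith
  let t₀ : unitInterval := ⟨dist a z / dist a b₁, by positivity, (div_le_one hd).2 (by linarith)⟩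
  have e : dist a b₂ = dist a b₁ := by linarith
  have q1 : dist a z = t₀ * dist a b₁ := by simp only [t₀]; field_simp
  have h0 : 0 < t₀ := by
    rw [← Subtype.coe_lt_coe]; simp only [t₀, Icc.coe_zero]; positivity
  have h1 : t₀ < 1 := by
    rw [← Subtype.coe_lt_coe]; simp only [t₀, Icc.coe_one]
    exact (div_lt_one hd).2 (by linarith)
  obtain ⟨γ₁, a1, a2, a3⟩ := hgeo.exists_through h0 h1 q1 (by linarith)
  obtain ⟨γ₂, c1, c2, c3⟩ := hgeo.exists_through (a := a) (b := b₂) (z := z) h0 h1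
    (by rw [e]; exact q1) (by rw [e]; linarith)
  rw [← a2, ← c2]
  exact hnb γ₁ γ₂ (a1.trans c1.symm) t₀ h0 h1 (a3.trans c3.symm)

theorem IsGeodesicSpace.exists_between (hgeo : IsGeodesicSpace X) (a b : X) {r : ℝ} (h0 : 0 ≤ r)
    (hr : r ≤ dist a b) : ∃ z, dist a z = r ∧ dist z b = dist a b - r := by
  obtain ⟨γ, rfl, rfl⟩ := hgeo a b
  rcases (dist_nonneg (x := γ.eval 0) (y := γ.eval 1)).eq_or_lt with h | h
  · exact ⟨γ.eval 0, by rw [dist_self]; linarith, by linarith⟩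
  · refine ⟨γ.eval ⟨r / dist (γ.eval 0) (γ.eval 1), by positivity, (div_le_one h).2 hr⟩, ?_, ?_⟩
    · rw [γ.dist_zero_eval]; field_simp
    · rw [γ.dist_eval_one]; field_simp

end Geodesics

/-! ### The comparison function -/

theorem continuous_sn (κ : ℝ) : Continuous (sn κ) := by
  unfold sn
  split_ifs <;> fun_prop

theorem contDiff_sn (κ : ℝ) : ContDiff ℝ 1 (sn κ) := by
  unfold sn
  split_ifs
  · exact Real.contDiff_sin.comp (contDiff_id.mul contDiff_const)
  · exact contDiff_id
  · exact Real.contDiff_sinh.comp (contDiff_id.mul contDiff_const)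

theorem sn_pos {κ θ : ℝ} (h0 : 0 < θ) (h : 0 < κ → θ < Real.pi / Real.sqrt κ) : 0 < sn κ θ := by
  unfold sn
  split_ifs with h1 h2
  · have := Real.sqrt_pos.2 h1
    exact Real.sin_pos_of_pos_of_lt_pi (by positivity) ((lt_div_iff₀ this).1 (h h1))
  · exact h0
  · have : 0 < Real.sqrt (-κ) := Real.sqrt_pos.2 (by
      rcases lt_trichotomy κ 0 with h | h | h
      · linarith
      · exact absurd h h2
      · exact absurd h h1)
    exact Real.sinh_pos_iff.2 (by positivity)

theorem sn_pi_div_sqrt {κ : ℝ} (h : 0 < κ) : sn κ (Real.pi / Real.sqrt κ) = 0 := by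
  have := (Real.sqrt_pos.2 h).ne'
  rw [sn, if_pos h, div_mul_cancel₀ _ this, Real.sin_pi]

theorem sigma_of_ne {κ t θ : ℝ} (h : θ ≠ 0) : sigma κ t θ = sn κ (t * θ) / sn κ θ := if_neg h

/-! ### Transport rays -/

section RayStructure

variable {X : Type*} [MetricSpace X] {φ : X → ℝ}

theorem mem_gam {x y : X} : (x, y) ∈ Gam φ ↔ φ x - φ y = dist x y := Iff.rfl

theorem mem_rays {x y : X} : (x, y) ∈ Rays φ ↔ (x, y) ∈ Gam φ ∨ (y, x) ∈ Gam φ := Iff.rfl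

theorem rays_symm {x y : X} (h : (x, y) ∈ Rays φ) : (y, x) ∈ Rays φ := Or.symm h

theorem gam_refl (x : X) : (x, x) ∈ Gam φ := by simp [mem_gam]

theorem sub_le_dist (hφ : LipschitzWith 1 φ) (x y : X) : φ x - φ y ≤ dist x y := by
  have := hφ.dist_le_mul x y
  rw [Real.dist_eq, NNReal.coe_one, one_mul] at this
  exact (le_abs_self _).trans this

theorem gam_trans (hφ : LipschitzWith 1 φ) {x y z : X} (h : (x, y) ∈ Gam φ)
    (h' : (y, z) ∈ Gam φ) : (x, z) ∈ Gam φ := by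
  rw [mem_gam] at *
  have := sub_le_dist hφ x z
  have := dist_triangle x y z
  linarith

theorem gam_between (hφ : LipschitzWith 1 φ) {x y z : X} (h : (x, y) ∈ Gam φ)
    (hz : dist x z + dist z y = dist x y) : (x, z) ∈ Gam φ ∧ (z, y) ∈ Gam φ := by
  simp only [mem_gam] at *
  have := sub_le_dist hφ x z
  have := sub_le_dist hφ z y
  constructor <;> linarith

theorem gam_of_rays {x y : X} (h : (x, y) ∈ Rays φ) (hxy : φ y ≤ φ x) : (x, y) ∈ Gam φ := by
  rcases h with h | h
  · exact h
  · have h := mem_gam.1 h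
    have : dist y x = 0 := le_antisymm (by linarith) dist_nonneg
    rw [dist_eq_zero.1 this]
    exact gam_refl _

theorem eq_of_rays {x y : X} (h : (x, y) ∈ Rays φ) (hxy : φ x = φ y) : x = y := by
  have := mem_gam.1 (gam_of_rays h hxy.ge)
  exact dist_eq_zero.1 (by linarith)

theorem gam_neg {x y : X} : (x, y) ∈ Gam (fun z => -φ z) ↔ (y, x) ∈ Gam φ := by
  rw [mem_gam, mem_gam, dist_comm y x]
  constructor <;> intro h <;> linarith

theorem rays_neg : Rays (fun z => -φ z) = Rays φ := by
  ext ⟨x, y⟩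
  rw [mem_rays, mem_rays, gam_neg, gam_neg, or_comm]

theorem transportSet_neg : transportSet (fun z => -φ z) = transportSet φ := by
  unfold transportSet branchPlus branchMinus transportSetE
  simp only [rays_neg, gam_neg]
  rw [union_comm]

theorem rays_of_gam_left {x z w : X} (hx : x ∈ transportSet φ) (hz : (x, z) ∈ Gam φ)
    (hw : (x, w) ∈ Gam φ) : (z, w) ∈ Rays φ := by
  by_contra h
  exact hx.2 (Or.inl ⟨hx.1, z, w, hz, hw, h⟩)

theorem rays_of_gam_right {x z w : X} (hx : x ∈ transportSet φ) (hz : (z, x) ∈ Gam φ)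
    (hw : (w, x) ∈ Gam φ) : (z, w) ∈ Rays φ := by
  by_contra h
  exact hx.2 (Or.inr ⟨hx.1, z, w, hz, hw, h⟩)

/-- The two cases of mixed orientation are where `q` must not be a branching point. -/
theorem rays_trans (hφ : LipschitzWith 1 φ) {x q y : X} (hq : q ∈ transportSet φ)
    (h : (x, q) ∈ Rays φ) (h' : (q, y) ∈ Rays φ) : (x, y) ∈ Rays φ := by
  rcases h with h | h <;> rcases h' with h' | h'
  · exact Or.inl (gam_trans hφ h h')
  · exact rays_of_gam_right hq h h'
  · exact rays_of_gam_left hq h h'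
  · exact Or.inr (gam_trans hφ h' h)

/-- A branching at `z` is inherited by an end point: a forward one by `x`, a backward one by `p`. -/
theorem mem_transportSet_of_between (hφ : LipschitzWith 1 φ) {x z p : X} (hx : x ∈ transportSet φ)
    (hp : p ∈ transportSet φ) (hxz : (x, z) ∈ Gam φ) (hzp : (z, p) ∈ Gam φ) :
    z ∈ transportSet φ := by
  rcases eq_or_ne p z with rfl | hne
  · exact hp
  refine ⟨⟨p, hne, Or.inl hzp⟩, ?_⟩
  rintro (⟨-, u, w, hu, hw, h⟩ | ⟨-, u, w, hu, hw, h⟩)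
  · exact h (rays_of_gam_left hx (gam_trans hφ hxz hu) (gam_trans hφ hxz hw))
  · exact h (rays_of_gam_right hp (gam_trans hφ hu hzp) (gam_trans hφ hw hzp))

/-- Cut the segment from `w` to `z` at the point `w'` with `dist w' z = dist u z`. Then `u` and `w'`
both prolong the geodesic from `y` to `z` by the same length, so they coincide, and `u` lies between
`w` and `z`. -/
theorem backward_branch_aux (hgeo : IsGeodesicSpace X) (hnb : IsNonBranching X)
    (hφ : LipschitzWith 1 φ) {u w z y : X} (hzy : (z, y) ∈ Gam φ) (hne : z ≠ y)
    (hu : (u, z) ∈ Gam φ) (hw : (w, z) ∈ Gam φ) (hle : dist u z ≤ dist w z) :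
    (w, u) ∈ Gam φ := by
  obtain ⟨w', h1, h2⟩ := hgeo.exists_between z w (r := dist u z) dist_nonneg
    (by rwa [dist_comm z w])
  have hb := gam_between hφ hw (z := w') (by
    rw [dist_comm w w', dist_comm w' z, h1, h2, dist_comm z w]; ring)
  have e1 := mem_gam.1 (gam_trans hφ hu hzy)
  have e2 := mem_gam.1 (gam_trans hφ hb.2 hzy)
  have e3 := mem_gam.1 hu
  have e4 := mem_gam.1 hb.2
  have e5 := mem_gam.1 hzy
  have : u = w' := by
    refine hnb.eq_of_dist_add hgeo (a := y) (z := z) hne.symm ?_ ?_ ?_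
    · rw [dist_comm y u, dist_comm y z, dist_comm z u]; linarith
    · rw [dist_comm y w', dist_comm y z, dist_comm z w']; linarith
    · rw [h1, dist_comm]
  rw [this]
  exact hb.1

/-- Points in the interior of a ray are not branching points. -/
theorem mem_transportSet_of_interior (hgeo : IsGeodesicSpace X) (hnb : IsNonBranching X)
    (hφ : LipschitzWith 1 φ) {x z y : X} (hx : x ∈ transportSet φ) (hxz : (x, z) ∈ Gam φ)
    (hzy : (z, y) ∈ Gam φ) (hne : z ≠ y) : z ∈ transportSet φ := by
  refine ⟨⟨y, hne.symm, Or.inl hzy⟩, ?_⟩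
  rintro (⟨-, u, w, hu, hw, h⟩ | ⟨-, u, w, hu, hw, h⟩)
  · exact h (rays_of_gam_left hx (gam_trans hφ hxz hu) (gam_trans hφ hxz hw))
  · rcases le_total (dist u z) (dist w z) with hle | hle
    · exact h (Or.inr (backward_branch_aux hgeo hnb hφ hzy hne hu hw hle))
    · exact h (Or.inl (backward_branch_aux hgeo hnb hφ hzy hne hw hu hle))

theorem exists_gam_midpoint (hgeo : IsGeodesicSpace X) (hφ : LipschitzWith 1 φ) {x y : X}
    (hxy : (x, y) ∈ Gam φ) {c : ℝ} (hc : c ∈ Icc (φ y) (φ x)) :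
    ∃ z, (x, z) ∈ Gam φ ∧ (z, y) ∈ Gam φ ∧ φ z = c := by
  have e := mem_gam.1 hxy
  obtain ⟨z, h1, h2⟩ := hgeo.exists_between x y (r := φ x - c) (by linarith [hc.2])
    (by linarith [hc.1])
  obtain ⟨h3, h4⟩ := gam_between hφ hxy (z := z) (by linarith)
  exact ⟨z, h3, h4, by have := mem_gam.1 h3; linarith⟩

/-- A ray that meets the transport set contains at least two of its points. -/
theorem exists_ne_mem_transportSet (hgeo : IsGeodesicSpace X) (hnb : IsNonBranching X)
    (hφ : LipschitzWith 1 φ) {x : X} (hx : x ∈ transportSet φ) :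
    ∃ z ∈ transportSet φ, (x, z) ∈ Rays φ ∧ φ z ≠ φ x := by
  have key : ∀ φ : X → ℝ, LipschitzWith 1 φ → x ∈ transportSet φ → ∀ y, y ≠ x → (x, y) ∈ Gam φ →
      ∃ z ∈ transportSet φ, (x, z) ∈ Rays φ ∧ φ z ≠ φ x := by
    intro φ hφ hx y hne hy
    have hd := dist_pos.2 hne.symm
    have e := mem_gam.1 hy
    -- The end point `y` may itself be a branching point; the midpoint is interior to the ray and
    -- cannot be one.
    obtain ⟨z, h1, h2, h3⟩ := exists_gam_midpoint hgeo hφ hy (c := (φ x + φ y) / 2)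
      ⟨by linarith, by linarith⟩
    refine ⟨z, mem_transportSet_of_interior hgeo hnb hφ hx h1 h2 ?_, Or.inl h1, by linarith⟩
    rintro rfl
    linarith
  obtain ⟨y, hne, hy | hy⟩ := hx.1
  · exact key φ hφ hx y hne hy
  · obtain ⟨z, h1, h2, h3⟩ := key (fun z => -φ z) hφ.neg (by rwa [transportSet_neg]) y hne
      (gam_neg.2 hy)
    rw [transportSet_neg] at h1
    rw [rays_neg] at h2
    exact ⟨z, h1, h2, fun h => h3 (by simp [h])⟩

/-- Points of one ray, in the transport set, at any level between those of two others. -/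
theorem exists_mem_transportSet_level (hgeo : IsGeodesicSpace X) (hφ : LipschitzWith 1 φ) {x y : X}
    (hx : x ∈ transportSet φ) (hy : y ∈ transportSet φ) (hxy : (x, y) ∈ Rays φ) {c : ℝ}
    (hc : c ∈ uIcc (φ x) (φ y)) : ∃ z ∈ transportSet φ, (x, z) ∈ Rays φ ∧ φ z = c := by
  rcases le_total (φ x) (φ y) with h | h
  · rw [uIcc_of_le h] at hc
    obtain ⟨z, h1, h2, h3⟩ := exists_gam_midpoint hgeo hφ (gam_of_rays (rays_symm hxy) h) hc
    exact ⟨z, mem_transportSet_of_between hφ hy hx h1 h2, Or.inr h2, h3⟩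
  · rw [uIcc_of_ge h] at hc
    obtain ⟨z, h1, h2, h3⟩ := exists_gam_midpoint hgeo hφ (gam_of_rays hxy h) hc
    exact ⟨z, mem_transportSet_of_between hφ hx hy h1 h2, Or.inl h1, h3⟩

/-- Countably many levels suffice to meet all rays, which makes a Borel selection possible. -/
theorem exists_rat_level (hgeo : IsGeodesicSpace X) (hnb : IsNonBranching X)
    (hφ : LipschitzWith 1 φ) {x : X} (hx : x ∈ transportSet φ) :
    ∃ c : ℚ, ∃ p ∈ transportSet φ, (x, p) ∈ Rays φ ∧ φ p = c := by
  obtain ⟨z, h1, h2, h3⟩ := exists_ne_mem_transportSet hgeo hnb hφ hx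
  obtain ⟨c, hc⟩ : ∃ c : ℚ, (c : ℝ) ∈ uIcc (φ x) (φ z) := by
    rcases lt_or_gt_of_ne h3 with h | h
    · obtain ⟨c, hc⟩ := exists_rat_btwn h
      exact ⟨c, by rw [uIcc_of_ge h.le]; exact ⟨hc.1.le, hc.2.le⟩⟩
    · obtain ⟨c, hc⟩ := exists_rat_btwn h
      exact ⟨c, by rw [uIcc_of_le h.le]; exact ⟨hc.1.le, hc.2.le⟩⟩
  exact ⟨c, exists_mem_transportSet_level hgeo hφ hx h1 h2 hc⟩

/-! ### Measurability -/

theorem isClosed_gam (hφ : LipschitzWith 1 φ) : IsClosed (Gam φ) := by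
  have := hφ.continuous
  exact isClosed_eq (by fun_prop) (by fun_prop)

theorem isClosed_rays (hφ : LipschitzWith 1 φ) : IsClosed (Rays φ) :=
  (isClosed_gam hφ).union ((isClosed_gam hφ).preimage continuous_swap)

theorem _root_.IsLocallyClosed.isSigmaCompact {Y : Type*} [TopologicalSpace Y]
    [LocallyCompactSpace Y] [SecondCountableTopology Y] {s : Set Y} (hs : IsLocallyClosed s) :
    IsSigmaCompact s := by
  have := hs.locallyCompactSpace
  exact isSigmaCompact_iff_sigmaCompactSpace.2 inferInstance

theorem _root_.IsSigmaCompact.measurableSet_of_t2 {Y : Type*} [TopologicalSpace Y] [T2Space Y]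
    [MeasurableSpace Y] [BorelSpace Y] {s : Set Y} (hs : IsSigmaCompact s) : MeasurableSet s := by
  obtain ⟨K, hK, rfl⟩ := hs
  exact MeasurableSet.iUnion fun n => (hK n).measurableSet

variable [ProperSpace X] [MeasurableSpace X] [BorelSpace X]

/-- Each existential condition is the projection of a locally closed set in a power of `X`. In a
proper space such sets are σ-compact, a property that survives continuous images, so the projections
are Borel and not merely analytic. -/
theorem measurableSet_transportSet (hφ : LipschitzWith 1 φ) : MeasurableSet (transportSet φ) := by
  have hG := isClosed_gam hφ
  have hR := isClosed_rays hφ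
  have hE : MeasurableSet (transportSetE φ) := by
    have : transportSetE φ = Prod.fst '' ({p : X × X | p.2 ≠ p.1} ∩ Rays φ) := by
      ext x
      simp [transportSetE]
    rw [this]
    refine IsSigmaCompact.measurableSet_of_t2 (IsSigmaCompact.image continuous_fst ?_)
    refine IsLocallyClosed.isSigmaCompact (IsLocallyClosed.inter (IsOpen.isLocallyClosed ?_)
      hR.isLocallyClosed)
    exact isOpen_ne_fun continuous_snd continuous_fst
  have hB : ∀ G : Set (X × X), IsClosed G → MeasurableSet
      {x | ∃ z w, (x, z) ∈ G ∧ (x, w) ∈ G ∧ (z, w) ∉ Rays φ} := by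
    intro G hG
    have : {x | ∃ z w, (x, z) ∈ G ∧ (x, w) ∈ G ∧ (z, w) ∉ Rays φ} = Prod.fst ''
        ({p : X × X × X | (p.1, p.2.1) ∈ G} ∩ {p | (p.1, p.2.2) ∈ G} ∩ {p | p.2 ∈ (Rays φ)ᶜ}) := by
      ext x
      simp [and_assoc]
    rw [this]
    refine IsSigmaCompact.measurableSet_of_t2 (IsSigmaCompact.image continuous_fst ?_)
    refine IsLocallyClosed.isSigmaCompact (IsLocallyClosed.inter (IsLocallyClosed.inter
      (IsClosed.isLocallyClosed ?_) (IsClosed.isLocallyClosed ?_)) (IsOpen.isLocallyClosed ?_))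
    · exact hG.preimage (by fun_prop)
    · exact hG.preimage (by fun_prop)
    · exact hR.isOpen_compl.preimage continuous_snd
  have h1 := hB _ hG
  have h2 := hB (Prod.swap ⁻¹' Gam φ) (hG.preimage continuous_swap)
  exact hE.diff ((hE.inter h1).union (hE.inter h2))

/-- A Borel quotient map exists. -/
theorem exists_isRayQuotient (hgeo : IsGeodesicSpace X) (hnb : IsNonBranching X)
    (hφ : LipschitzWith 1 φ) : ∃ 𝔔 : X → X, IsRayQuotient φ 𝔔 := by
  classical
  have hT := measurableSet_transportSet hφ
  obtain ⟨r, hr⟩ := exists_surjective_nat ℚ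
  -- `𝔔 x` will be the point of the ray of `x` at level `r n`, for the least `n` such that `P x n`.
  let P : X → ℕ → Prop := fun x n => ∃ p ∈ transportSet φ, (x, p) ∈ Rays φ ∧ φ p = r n
  have hP : ∀ x ∈ transportSet φ, ∃ n, P x n := fun x hx => by
    obtain ⟨c, hc⟩ := exists_rat_level hgeo hnb hφ hx
    obtain ⟨n, rfl⟩ := hr c
    exact ⟨n, hc⟩
  have hex : ∀ x, ∃ y, x ∈ transportSet φ →
      ∃ n, P x n ∧ (∀ k < n, ¬ P x k) ∧ y ∈ transportSet φ ∧ (x, y) ∈ Rays φ ∧ φ y = r n := by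
    intro x
    by_cases hx : x ∈ transportSet φ
    · obtain ⟨p, hp⟩ := Nat.find_spec (hP x hx)
      exact ⟨p, fun _ => ⟨_, Nat.find_spec (hP x hx), fun k hk => Nat.find_min (hP x hx) hk, hp⟩⟩
    · exact ⟨x, fun h => absurd h hx⟩
  choose 𝔔 h𝔔 using hex
  have huniq : ∀ x ∈ transportSet φ, ∀ p p', (x, p) ∈ Rays φ → (x, p') ∈ Rays φ → φ p = φ p' →
      p = p' := fun x hx p p' h h' e => eq_of_rays (rays_trans hφ hx (rays_symm h) h') e
  have hcongr : ∀ x ∈ transportSet φ, ∀ y ∈ transportSet φ, (x, y) ∈ Rays φ → ∀ n,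
      P x n → P y n := by
    rintro x hx y hy hxy n ⟨p, hp, h1, h2⟩
    exact ⟨p, hp, rays_trans hφ hx (rays_symm hxy) h1, h2⟩
  -- The projection is injective here, since a ray has only one point at level `r n`; hence `S n B`
  -- is Borel by the Lusin–Souslin theorem.
  let S : ℕ → Set X → Set X := fun n B =>
    Prod.fst '' {p : X × X | p.1 ∈ transportSet φ ∧ p.2 ∈ transportSet φ ∧ p ∈ Rays φ ∧
      φ p.2 = r n ∧ p.2 ∈ B}
  have hS : ∀ n B, MeasurableSet B → MeasurableSet (S n B) := by
    intro n B hB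
    refine MeasurableSet.image_of_measurable_injOn ?_ measurable_fst ?_
    · have h1 : MeasurableSet {p : X × X | φ p.2 = r n} :=
        measurableSet_eq_fun (hφ.continuous.measurable.comp measurable_snd) measurable_const
      exact (measurable_fst hT).inter ((measurable_snd hT).inter
        ((isClosed_rays hφ).measurableSet.inter (h1.inter (measurable_snd hB))))
    · rintro ⟨x, p⟩ ⟨hx, -, h1, h2, -⟩ ⟨x', p'⟩ ⟨-, -, h1', h2', -⟩ e
      obtain rfl : x = x' := e
      rw [huniq x hx p p' h1 h1' (h2.trans h2'.symm)]
  refine ⟨𝔔, ⟨?_, ?_, ?_⟩⟩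
  · intro B hB
    have : (fun x : transportSet φ => 𝔔 x) ⁻¹' B =
        Subtype.val ⁻¹' (⋃ n, S n B \ ⋃ k, ⋃ (_ : k < n), S k univ) := by
      ext ⟨x, hx⟩
      obtain ⟨n, h1, h2, h3, h4, h5⟩ := h𝔔 x hx
      simp only [mem_preimage, mem_iUnion, Set.mem_sdiff, not_exists]
      constructor
      · intro hB
        refine ⟨n, ⟨(x, 𝔔 x), ⟨hx, h3, h4, h5, hB⟩, rfl⟩, ?_⟩
        rintro k hk ⟨⟨x', p⟩, ⟨-, hp, h6, h7, -⟩, e⟩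
        obtain rfl : x' = x := e
        exact h2 k hk ⟨p, hp, h6, h7⟩
      · rintro ⟨k, ⟨⟨x', p⟩, ⟨-, hp, h6, h7, hB⟩, e⟩, hk⟩
        obtain rfl : x' = x := e
        obtain rfl : k = n := by
          rcases lt_trichotomy k n with h | h | h
          · exact absurd ⟨p, hp, h6, h7⟩ (h2 k h)
          · exact h
          · exact absurd ⟨(x', 𝔔 x'), ⟨hx, h3, h4, h5, mem_univ _⟩, rfl⟩ (hk n h)
        rwa [huniq x' hx _ _ h4 h6 (h5.trans h7.symm)]
    rw [this]
    exact measurable_subtype_coe (MeasurableSet.iUnion fun n => (hS n B hB).diff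
      (MeasurableSet.iUnion fun k => MeasurableSet.iUnion fun _ => hS k univ MeasurableSet.univ))
  · intro x hx
    obtain ⟨n, h1, h2, h3, h4, h5⟩ := h𝔔 x hx
    exact ⟨h3, h4⟩
  · intro x hx y hy hxy
    obtain ⟨n, h1, h2, h3, h4, h5⟩ := h𝔔 x hx
    obtain ⟨n', h1', h2', h3', h4', h5'⟩ := h𝔔 y hy
    obtain rfl : n = n' := by
      rcases lt_trichotomy n n' with h | h | h
      · exact absurd (hcongr x hx y hy hxy n h1) (h2' n h)
      · exact h
      · exact absurd (hcongr y hy x hx (rays_symm hxy) n' h1') (h2 n' h)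
    exact huniq x hx _ _ h4 (rays_trans hφ hy hxy h4') (h5.trans h5'.symm)

end RayStructure

/-! ### Coordinates on the rays given by a quotient map. -/

section Quotient

variable {X : Type*} [MetricSpace X] [MeasurableSpace X] {φ : X → ℝ} {𝔔 : X → X}

theorem IsRayQuotient.neg (hQ : IsRayQuotient φ 𝔔) : IsRayQuotient (fun z => -φ z) 𝔔 := by
  obtain ⟨h1, h2, h3⟩ := hQ
  have e : transportSet (fun z => -φ z) = transportSet φ := transportSet_neg
  refine ⟨?_, ?_, ?_⟩
  · rw [e]; exact h1
  · rw [e, rays_neg]; exact h2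
  · rw [e, rays_neg]; exact h3

theorem IsRayQuotient.rays_of_eq (hφ : LipschitzWith 1 φ) (hQ : IsRayQuotient φ 𝔔) {x y : X}
    (hx : x ∈ transportSet φ) (hy : y ∈ transportSet φ) (h : 𝔔 x = 𝔔 y) : (x, y) ∈ Rays φ :=
  rays_trans hφ (hQ.mem x hx).1 (hQ.mem x hx).2 (by rw [h]; exact rays_symm (hQ.mem y hy).2)

theorem IsRayQuotient.eq_of_eq (hφ : LipschitzWith 1 φ) (hQ : IsRayQuotient φ 𝔔) {x y : X}
    (hx : x ∈ transportSet φ) (hy : y ∈ transportSet φ) (h : 𝔔 x = 𝔔 y) (h' : φ x = φ y) : x = y :=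
  eq_of_rays (hQ.rays_of_eq hφ hx hy h) h'

theorem IsRayQuotient.idem (hQ : IsRayQuotient φ 𝔔) {x : X} (hx : x ∈ transportSet φ) :
    𝔔 (𝔔 x) = 𝔔 x :=
  (hQ.const x hx _ (hQ.mem x hx).1 (hQ.mem x hx).2).symm

theorem IsRayQuotient.mem_quotientSet_iff (hQ : IsRayQuotient φ 𝔔) {q : X} :
    q ∈ quotientSet φ 𝔔 ↔ q ∈ transportSet φ ∧ 𝔔 q = q := by
  constructor
  · rintro ⟨x, hx, rfl⟩
    exact ⟨(hQ.mem x hx).1, hQ.idem hx⟩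
  · rintro ⟨h, h'⟩
    exact ⟨q, h, h'⟩

theorem IsRayQuotient.isRayPoint_iff (hφ : LipschitzWith 1 φ) (hQ : IsRayQuotient φ 𝔔) {q x : X}
    {t : ℝ} (hq : q ∈ quotientSet φ 𝔔) :
    IsRayPoint φ q t x ↔ x ∈ transportSet φ ∧ 𝔔 x = q ∧ φ x = φ q - t := by
  obtain ⟨hqT, hqq⟩ := hQ.mem_quotientSet_iff.1 hq
  constructor
  · rintro ⟨hx, ⟨h0, h1, h2⟩ | ⟨h0, h1, h2⟩⟩
    · refine ⟨hx, ?_, ?_⟩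
      · rw [← hQ.const q hqT x hx (Or.inl h1), hqq]
      · have := mem_gam.1 h1; linarith
    · refine ⟨hx, ?_, ?_⟩
      · rw [hQ.const x hx q hqT (Or.inl h1), hqq]
      · have := mem_gam.1 h1; linarith
  · rintro ⟨hx, h1, h2⟩
    have hr := hQ.rays_of_eq hφ hqT hx (by rw [hqq, h1])
    refine ⟨hx, ?_⟩
    rcases le_total 0 t with h | h
    · have := gam_of_rays hr (by linarith)
      exact Or.inl ⟨h, this, by have := mem_gam.1 this; linarith⟩
    · have := gam_of_rays (rays_symm hr) (by linarith)
      exact Or.inr ⟨h, this, by have := mem_gam.1 this; linarith⟩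

/-- The levels of `φ` along the ray of `q`. -/
def rayLevels (φ : X → ℝ) (𝔔 : X → X) (q : X) : Set ℝ :=
  {a | ∃ x ∈ transportSet φ, 𝔔 x = q ∧ φ x = a}

theorem IsRayQuotient.mem_rayDom_iff (hφ : LipschitzWith 1 φ) (hQ : IsRayQuotient φ 𝔔) {q : X}
    {t : ℝ} : t ∈ rayDom φ 𝔔 q ↔ φ q - t ∈ rayLevels φ 𝔔 q := by
  constructor
  · rintro ⟨hq, x, hx⟩
    exact ⟨x, (hQ.isRayPoint_iff hφ hq).1 hx⟩
  · rintro ⟨x, hx, rfl, h⟩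
    have hq : 𝔔 x ∈ quotientSet φ 𝔔 := ⟨x, hx, rfl⟩
    exact ⟨hq, x, (hQ.isRayPoint_iff hφ hq).2 ⟨hx, rfl, h⟩⟩

theorem IsRayQuotient.rayMap_spec (hφ : LipschitzWith 1 φ) (hQ : IsRayQuotient φ 𝔔) {q : X}
    {t : ℝ} (h : t ∈ rayDom φ 𝔔 q) : rayMap φ 𝔔 q t ∈ transportSet φ ∧ 𝔔 (rayMap φ 𝔔 q t) = q ∧
      φ (rayMap φ 𝔔 q t) = φ q - t := by
  have h' : q ∈ quotientSet φ 𝔔 ∧ ∃ x, IsRayPoint φ q t x := h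
  rw [rayMap, dif_pos h']
  exact (hQ.isRayPoint_iff hφ h'.1).1 h'.2.choose_spec

theorem IsRayQuotient.rayMap_eq (hφ : LipschitzWith 1 φ) (hQ : IsRayQuotient φ 𝔔) {x : X}
    (hx : x ∈ transportSet φ) : rayMap φ 𝔔 (𝔔 x) (φ (𝔔 x) - φ x) = x := by
  have h : φ (𝔔 x) - φ x ∈ rayDom φ 𝔔 (𝔔 x) :=
    (hQ.mem_rayDom_iff hφ).2 ⟨x, hx, rfl, by ring⟩
  obtain ⟨h1, h2, h3⟩ := hQ.rayMap_spec hφ h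
  exact hQ.eq_of_eq hφ h1 hx h2 (by rw [h3]; ring)

theorem convex_rayLevels (hgeo : IsGeodesicSpace X) (hφ : LipschitzWith 1 φ)
    (hQ : IsRayQuotient φ 𝔔) (q : X) : Convex ℝ (rayLevels φ 𝔔 q) := by
  refine OrdConnected.convex ⟨?_⟩
  rintro _ ⟨x, hx, rfl, rfl⟩ _ ⟨y, hy, hxy, rfl⟩ c hc
  obtain ⟨z, h1, h2, h3⟩ := exists_mem_transportSet_level hgeo hφ hx hy
    (hQ.rays_of_eq hφ hx hy hxy.symm) (Icc_subset_uIcc hc)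
  exact ⟨z, h1, (hQ.const x hx z h1 h2).symm, h3⟩

theorem exists_ne_mem_rayLevels (hgeo : IsGeodesicSpace X) (hnb : IsNonBranching X)
    (hφ : LipschitzWith 1 φ) (hQ : IsRayQuotient φ 𝔔) {q : X} {a : ℝ}
    (ha : a ∈ rayLevels φ 𝔔 q) : ∃ b ∈ rayLevels φ 𝔔 q, b ≠ a := by
  obtain ⟨x, hx, rfl, rfl⟩ := ha
  obtain ⟨z, h1, h2, h3⟩ := exists_ne_mem_transportSet hgeo hnb hφ hx
  exact ⟨φ z, ⟨z, h1, (hQ.const x hx z h1 h2).symm, rfl⟩, h3⟩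

end Quotient

/-! ### Contraction of sets towards a level of `φ` -/

section Contraction

variable {X : Type*} [MetricSpace X]

/-- The points that divide the geodesics from `y` to points of `A` in the ratio `t : 1 - t`. -/
def dividing (t : ℝ) (A : Set X) (y : X) : Set X :=
  {z | ∃ x ∈ A, dist y z = t * dist y x ∧ dist z x = (1 - t) * dist y x}

theorem isCompact_dividing [ProperSpace X] {t : ℝ} (ht1 : t ≤ 1) {A : Set X}
    (hA : IsCompact A) (y : X) : IsCompact (dividing t A y) := by
  obtain ⟨r, hr⟩ := hA.isBounded.subset_closedBall y
  have : dividing t A y = Prod.snd '' ((A ×ˢ Metric.closedBall y r) ∩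
      {p : X × X | dist y p.2 = t * dist y p.1 ∧ dist p.2 p.1 = (1 - t) * dist y p.1}) := by
    ext z
    constructor
    · rintro ⟨x, hx, h1, h2⟩
      refine ⟨(x, z), ⟨⟨hx, ?_⟩, h1, h2⟩, rfl⟩
      have := hr hx
      rw [Metric.mem_closedBall, dist_comm] at this ⊢
      rw [h1]
      exact (mul_le_of_le_one_left dist_nonneg ht1).trans this
    · rintro ⟨⟨x, z'⟩, ⟨⟨hx, -⟩, h1, h2⟩, rfl⟩
      exact ⟨x, hx, h1, h2⟩
  rw [this]
  refine ((hA.prod (isCompact_closedBall y r)).inter_right ?_).image continuous_snd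
  exact (isClosed_eq (by fun_prop) (by fun_prop)).inter (isClosed_eq (by fun_prop) (by fun_prop))

/-- The dividing points towards two different nearest points of a set are different. -/
theorem disjoint_dividing (hgeo : IsGeodesicSpace X) (hnb : IsNonBranching X) {t : ℝ}
    (ht1 : t < 1) {s A : Set X} (hA : ∀ x ∈ A, x ∉ s) {y₁ y₂ : X} (h₁ : y₁ ∈ s) (h₂ : y₂ ∈ s)
    (hne : y₁ ≠ y₂) :
    Disjoint (dividing t {x ∈ A | ∀ y ∈ s, dist y₁ x ≤ dist y x} y₁)
      (dividing t {x ∈ A | ∀ y ∈ s, dist y₂ x ≤ dist y x} y₂) := by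
  rw [Set.disjoint_left]
  rintro z ⟨x, ⟨hx, hx'⟩, a1, a2⟩ ⟨w, ⟨-, hw'⟩, b1, b2⟩
  apply hne
  have hpos : 0 < dist y₁ x := dist_pos.2 (fun h => hA x hx (h ▸ h₁))
  have c1 := hx' y₂ h₂
  have c2 := hw' y₁ h₁
  have c3 := dist_triangle y₁ z w
  have c4 := dist_triangle y₂ z x
  have e : dist y₁ z = dist y₂ z := by linarith
  have e' : dist y₁ x = dist y₂ x := by linarith
  refine hnb.eq_of_dist_add hgeo (a := x) (z := z) ?_ ?_ ?_ ?_
  · rw [ne_comm, ← dist_pos, a2]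
    exact mul_pos (sub_pos.2 ht1) hpos
  · rw [dist_comm x y₁, dist_comm x z, dist_comm z y₁]; linarith
  · rw [dist_comm x y₂, dist_comm x z, dist_comm z y₂]; linarith
  · rw [dist_comm z y₁, dist_comm z y₂, e]

variable [MeasurableSpace X] [BorelSpace X] {m : Measure X} {K N : ℝ}

/-- The plan given by `MCP` is concentrated on geodesics from `y` to `A`, whose points at time `t`
lie in `dividing t A y`. The mass carried there is at least `M * m A`, because `M` bounds the weight
from below on `A`. -/
theorem MCP.le_measure_dividing [ProperSpace X] (hMCP : MCP m K N) {A : Set X} (hA : IsCompact A)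
    (y : X) (t : unitInterval) {M : ℝ}
    (hM : ∀ x ∈ A, M ≤ (t : ℝ) * sigma (K / (N - 1)) t (dist y x) ^ (N - 1))
    (hball : 0 < K → ∀ x ∈ A, dist y x < Real.pi * Real.sqrt ((N - 1) / K)) :
    ENNReal.ofReal M * m A ≤ m (dividing t A y) := by
  rcases eq_or_ne (m A) 0 with h0 | h0
  · simp [h0]
  obtain ⟨P, hP, hP0, hP1, hPt⟩ := hMCP y A hA.measurableSet (pos_iff_ne_zero.2 h0)
    (fun hK x hx => by rw [Metric.mem_ball, dist_comm]; exact hball hK x hx)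
  have hI := (isCompact_dividing t.2.2 hA y).measurableSet
  have ae0 : ∀ᵐ γ ∂P, γ.eval 0 = y := by
    refine ae_of_ae_map (f := Geo.eval 0) (p := fun z => z = y)
      (Geo.measurable_eval 0).aemeasurable ?_
    rw [hP0, ae_dirac_eq]
    exact rfl
  have ae1 : ∀ᵐ γ ∂P, γ.eval 1 ∈ A := by
    refine ae_of_ae_map (f := Geo.eval 1) (p := fun z => z ∈ A)
      (Geo.measurable_eval 1).aemeasurable ?_
    rw [hP1]
    exact Measure.ae_smul_measure (ae_restrict_mem hA.measurableSet) _
  have aeI : ∀ᵐ γ ∂P, γ.eval t ∈ dividing t A y := by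
    filter_upwards [ae0, ae1] with γ h0 h1
    refine ⟨_, h1, ?_, ?_⟩
    · rw [← h0, γ.dist_zero_eval]
    · rw [← h0, γ.dist_eval_one]
  calc ENNReal.ofReal M * m A = ∫⁻ _, m A * ENNReal.ofReal M ∂P := by
        rw [lintegral_const, measure_univ, mul_one, mul_comm]
    _ ≤ ∫⁻ γ, m A * ENNReal.ofReal ((t : ℝ) *
          sigma (K / (N - 1)) t (dist (γ.eval 0) (γ.eval 1)) ^ (N - 1)) ∂P := by
        refine lintegral_mono_ae ?_
        filter_upwards [ae0, ae1] with γ h0 h1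
        rw [h0]
        gcongr
        exact hM _ h1
    _ = ∫⁻ γ in Geo.eval t ⁻¹' dividing t A y, m A * ENNReal.ofReal ((t : ℝ) *
          sigma (K / (N - 1)) t (dist (γ.eval 0) (γ.eval 1)) ^ (N - 1)) ∂P := by
        rw [Measure.restrict_eq_self_of_ae_mem (s := Geo.eval t ⁻¹' dividing t A y) aeI]
    _ = _ := by
        rw [← withDensity_apply _ (Geo.measurable_eval t hI),
          ← Measure.map_apply (Geo.measurable_eval t) hI]
    _ ≤ _ := hPt t _

/-- The cells of points with a common nearest point of `s` cover `A`. They may overlap, but their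
contracted images are disjoint, so the estimates for the single points of `s` can be summed. -/
theorem MCP.le_measure_biUnion_dividing [ProperSpace X] (hgeo : IsGeodesicSpace X)
    (hnb : IsNonBranching X) (hMCP : MCP m K N) {A : Set X} (hA : IsCompact A)
    {s : Finset X} (hs : s.Nonempty) {t : unitInterval} (ht1 : t < 1) {M : ℝ}
    (h : ∀ x ∈ A, ∀ y ∈ s, (∀ y' ∈ s, dist y x ≤ dist y' x) → 0 < dist y x ∧
      M ≤ (t : ℝ) * sigma (K / (N - 1)) t (dist y x) ^ (N - 1) ∧
      (0 < K → dist y x < Real.pi * Real.sqrt ((N - 1) / K))) :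
    ENNReal.ofReal M * m A ≤
      m (⋃ y ∈ s, dividing t {x ∈ A | ∀ y' ∈ s, dist y x ≤ dist y' x} y) := by
  have hmin : ∀ x, ∃ y ∈ s, ∀ y' ∈ s, dist y x ≤ dist y' x := fun x =>
    s.exists_min_image (fun y => dist y x) hs
  have hAs : ∀ x ∈ A, x ∉ (s : Set X) := by
    intro x hx hxs
    have := (h x hx x hxs (fun y' _ => by rw [dist_self]; exact dist_nonneg)).1
    simp at this
  have hB : ∀ y, IsCompact {x ∈ A | ∀ y' ∈ s, dist y x ≤ dist y' x} := by
    intro y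
    have : {x ∈ A | ∀ y' ∈ s, dist y x ≤ dist y' x} =
        A ∩ ⋂ y' ∈ s, {x | dist y x ≤ dist y' x} := by
      ext x; simp
    rw [this]
    exact hA.inter_right (isClosed_biInter fun y' _ => isClosed_le (by fun_prop) (by fun_prop))
  rw [measure_biUnion_finset]
  · calc ENNReal.ofReal M * m A
        ≤ ENNReal.ofReal M * ∑ y ∈ s, m {x ∈ A | ∀ y' ∈ s, dist y x ≤ dist y' x} := by
          gcongr
          refine (measure_mono ?_).trans (measure_biUnion_finset_le s _)
          intro x hx
          obtain ⟨y, hy, hy'⟩ := hmin x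
          exact mem_biUnion hy ⟨hx, hy'⟩
      _ ≤ _ := by
          rw [Finset.mul_sum]
          refine Finset.sum_le_sum fun y hy => hMCP.le_measure_dividing (hB y) y t ?_ ?_
          · rintro x ⟨hx, hx'⟩
            exact (h x hx y hy hx').2.1
          · rintro hK x ⟨hx, hx'⟩
            exact (h x hx y hy hx').2.2 hK
  · intro y₁ h₁ y₂ h₂ hne
    exact disjoint_dividing hgeo hnb ht1 hAs h₁ h₂ hne
  · intro y _
    exact (isCompact_dividing t.2.2 (hB y) y).measurableSet

/-- The level is approximated by finite nets. The slack `ε` keeps the distances to nearest net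
points, which exceed `φ x - c` by at most the mesh, inside the range `[α, β]` where `M` bounds the
weight. -/
theorem MCP.le_measure_contract [ProperSpace X] [IsFiniteMeasure m] (hgeo : IsGeodesicSpace X) (hnb : IsNonBranching X)
    (hMCP : MCP m K N) {φ : X → ℝ} (hφ : LipschitzWith 1 φ) {A : Set X} (hA : IsCompact A)
    {c t M α β ε : ℝ} (ht0 : 0 < t) (ht1 : t < 1) (hα : 0 < α) (hε : 0 < ε)
    (hβ : 0 < K → β < Real.pi * Real.sqrt ((N - 1) / K))
    (hM : ∀ θ ∈ Icc α β, M ≤ t * sigma (K / (N - 1)) t θ ^ (N - 1))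
    (hA' : ∀ x ∈ A, α ≤ φ x - c ∧ φ x - c + ε ≤ β ∧ ∃ y, (x, y) ∈ Gam φ ∧ φ y = c) :
    ENNReal.ofReal M * m A ≤ m {z | ∃ x ∈ A, ∃ y, (x, y) ∈ Gam φ ∧ φ y = c ∧ (x, z) ∈ Gam φ ∧
      (z, y) ∈ Gam φ ∧ φ z = c + t * (φ x - c)} := by
  rcases A.eq_empty_or_nonempty with rfl | ⟨x₀, hx₀⟩
  · simp
  have hcont := hφ.continuous
  let τ : unitInterval := ⟨t, ht0.le, ht1.le⟩
  obtain ⟨r, hr⟩ := hA.isBounded.subset_closedBall x₀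
  -- A point of the level reached from `x ∈ A` is at distance `φ x - c ≤ β` from `x`, hence within
  -- `r + β` of `x₀`; this truncates the level to a compact set.
  let L : Set X := {y | φ y = c} ∩ Metric.closedBall x₀ (r + β)
  have hL : IsCompact L :=
    (isCompact_closedBall x₀ (r + β)).inter_left (isClosed_eq hcont continuous_const)
  have hreach : ∀ x ∈ A, ∃ y ∈ L, dist y x = φ x - c := by
    intro x hx
    obtain ⟨h1, h2, y, h3, h4⟩ := hA' x hx
    have h5 := mem_gam.1 h3
    refine ⟨y, ⟨h4, ?_⟩, by rw [dist_comm, ← h5, h4]⟩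
    have h6 := hr hx
    rw [Metric.mem_closedBall] at h6 ⊢
    have := dist_triangle y x x₀
    rw [dist_comm y x] at this
    linarith
  -- For `δ = 0`, with `y` on the level, the first inequality says that `(x, y) ∈ Γ`. The shadows `W
  -- δ` are compact and shrink as `δ` decreases.
  let F : ℝ → Set ((X × X) × X) := fun δ => {p | dist p.1.2 p.1.1 ≤ φ p.1.1 - c + δ ∧
    dist p.1.2 p.2 = t * dist p.1.2 p.1.1 ∧ dist p.2 p.1.1 = (1 - t) * dist p.1.2 p.1.1}
  have hF : ∀ δ, IsClosed (F δ) := fun δ => by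
    refine IsClosed.inter (isClosed_le (f := fun p : (X × X) × X => dist p.1.2 p.1.1)
      (g := fun p => φ p.1.1 - c + δ) (by fun_prop) (by fun_prop))
      (IsClosed.inter (isClosed_eq (f := fun p : (X × X) × X => dist p.1.2 p.2)
        (g := fun p => t * dist p.1.2 p.1.1) (by fun_prop) (by fun_prop))
      (isClosed_eq (f := fun p : (X × X) × X => dist p.2 p.1.1)
        (g := fun p => (1 - t) * dist p.1.2 p.1.1) (by fun_prop) (by fun_prop)))
  -- The radius comes from `dist z x ≤ dist y x ≤ (r + β) + r` and `dist x x₀ ≤ r`.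
  let B : Set ((X × X) × X) := (A ×ˢ L) ×ˢ Metric.closedBall x₀ (r + (r + β + r))
  have hB : IsCompact B := (hA.prod hL).prod (isCompact_closedBall _ _)
  let W : ℝ → Set X := fun δ => Prod.snd '' (B ∩ F δ)
  have hW : ∀ δ, IsCompact (W δ) := fun δ => (hB.inter_right (hF δ)).image continuous_snd
  have hWm : ∀ x ∈ A, ∀ y ∈ L, ∀ z δ, ((x, y), z) ∈ F δ → z ∈ W δ := by
    intro x hx y hy z δ hz
    refine ⟨((x, y), z), ⟨⟨⟨hx, hy⟩, ?_⟩, hz⟩, rfl⟩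
    have h1 := hr hx
    have h2 := hy.2
    have h3 : dist z x = (1 - t) * dist y x := hz.2.2
    rw [Metric.mem_closedBall] at h1 h2 ⊢
    have h4 := dist_triangle z x x₀
    have h5 := dist_triangle_right y x x₀
    have h6 : (1 - t) * dist y x ≤ dist y x :=
      mul_le_of_le_one_left dist_nonneg (by linarith)
    show dist z x₀ ≤ _
    linarith
  have hle : ∀ δ, 0 < δ → δ ≤ ε → ENNReal.ofReal M * m A ≤ m (W δ) := by
    intro δ hδ hδε
    obtain ⟨s, hsL, hsf, hs⟩ := hL.finite_cover_balls hδ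
    have hnear : ∀ x ∈ A, ∃ y ∈ s, dist y x ≤ φ x - c + δ := by
      intro x hx
      obtain ⟨y, hy, hyx⟩ := hreach x hx
      obtain ⟨y', hy', h⟩ := mem_iUnion₂.1 (hs hy)
      refine ⟨y', hy', ?_⟩
      rw [Metric.mem_ball] at h
      have := dist_triangle_left y' x y
      linarith
    have hmem : ∀ x ∈ A, ∀ y ∈ hsf.toFinset, (∀ y' ∈ hsf.toFinset, dist y x ≤ dist y' x) →
        y ∈ L ∧ φ x - c ≤ dist y x ∧ dist y x ≤ φ x - c + δ := by
      intro x hx y hy hmin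
      have hyL := hsL (hsf.mem_toFinset.1 hy)
      obtain ⟨y', hy', h'⟩ := hnear x hx
      refine ⟨hyL, ?_, (hmin y' (hsf.mem_toFinset.2 hy')).trans h'⟩
      have := sub_le_dist hφ x y
      rw [dist_comm, hyL.1] at this
      exact this
    have hne : hsf.toFinset.Nonempty := by
      obtain ⟨y, hy, -⟩ := hnear x₀ hx₀
      exact ⟨y, hsf.mem_toFinset.2 hy⟩
    refine (hMCP.le_measure_biUnion_dividing hgeo hnb hA hne (t := τ) ht1 ?_).trans
      (measure_mono ?_)
    · intro x hx y hy hmin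
      obtain ⟨h1, h2, h3⟩ := hmem x hx y hy hmin
      obtain ⟨h4, h5, -⟩ := hA' x hx
      exact ⟨by linarith, hM _ ⟨by linarith, by linarith⟩, fun hK => by
        have := hβ hK; linarith⟩
    · refine iUnion₂_subset fun y hy => ?_
      rintro z ⟨x, ⟨hx, hmin⟩, h1, h2⟩
      obtain ⟨h3, h4, h5⟩ := hmem x hx y hy hmin
      exact hWm x hx y h3 z δ ⟨h5, h1, h2⟩
  have hanti : Antitone fun n : ℕ => W (ε / (n + 1)) := by
    intro n k hnk
    refine image_mono (inter_subset_inter_right _ ?_)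
    rintro p ⟨h1, h2⟩
    have h3 : ε / ((k : ℝ) + 1) ≤ ε / ((n : ℝ) + 1) := by gcongr
    exact ⟨h1.trans (by linarith), h2⟩
  have hlim := tendsto_measure_iInter_atTop (μ := m)
    (fun n : ℕ => (hW (ε / (n + 1))).measurableSet.nullMeasurableSet) hanti
    ⟨0, measure_ne_top _ _⟩
  refine (ge_of_tendsto' hlim fun n => hle _ (by positivity)
    (div_le_self hε.le (by linarith [n.cast_nonneg (α := ℝ)]))).trans (measure_mono ?_)
  intro z hz
  have hz' : ∀ n : ℕ, ∃ p : X × X, p ∈ A ×ˢ L ∧ (p, z) ∈ F (ε / (n + 1)) := by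
    intro n
    obtain ⟨⟨p, z'⟩, ⟨⟨hp, -⟩, hF⟩, rfl⟩ := mem_iInter.1 hz n
    exact ⟨p, hp, hF⟩
  choose p hp hpF using hz'
  -- A point in all the `W (ε / (n + 1))` has witnesses for each `n`; a limit of them is a witness
  -- for `δ = 0`.
  obtain ⟨⟨x, y⟩, ⟨hx, hy⟩, g, hg, hlim⟩ := (hA.prod hL).tendsto_subseq hp
  have hε' : Tendsto (fun n : ℕ => ε / ((g n : ℝ) + 1)) atTop (𝓝 0) :=
    Tendsto.comp (g := fun n : ℕ => ε / ((n : ℝ) + 1)) (by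
      simpa [div_eq_mul_inv] using tendsto_one_div_add_atTop_nhds_zero_nat.const_mul ε) hg.tendsto_atTop
  have l1 : Tendsto (fun n => (p (g n)).1) atTop (𝓝 x) := (continuous_fst.tendsto _).comp hlim
  have l2 : Tendsto (fun n => (p (g n)).2) atTop (𝓝 y) := (continuous_snd.tendsto _).comp hlim
  have e1 : dist y x ≤ φ x - c + 0 :=
    le_of_tendsto_of_tendsto' (l2.dist l1)
      ((((hcont.tendsto x).comp l1).sub_const c).add hε') fun n => (hpF (g n)).1
  have e2 : dist y z = t * dist y x :=
    tendsto_nhds_unique (l2.dist tendsto_const_nhds) (((l2.dist l1).const_mul t).congr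
      fun n => ((hpF (g n)).2.1).symm)
  have e3 : dist z x = (1 - t) * dist y x :=
    tendsto_nhds_unique (tendsto_const_nhds.dist l1) (((l2.dist l1).const_mul (1 - t)).congr
      fun n => ((hpF (g n)).2.2).symm)
  have hφy : φ y = c := hy.1
  have e4 : (x, y) ∈ Gam φ := by
    have := sub_le_dist hφ x y
    rw [dist_comm] at e1
    rw [mem_gam]
    linarith
  obtain ⟨e5, e6⟩ := gam_between hφ e4 (z := z) (by
    rw [dist_comm x z, dist_comm z y, e2, e3, dist_comm x y]; ring)
  refine ⟨x, hx, y, e4, hφy, e5, e6, ?_⟩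
  have h7 := mem_gam.1 e6
  have h8 := mem_gam.1 e4
  rw [dist_comm, e2, dist_comm, ← h8, hφy] at h7
  linarith

end Contraction

/-! ### Contraction of subsets of the transport set along their rays. -/

section RayContraction

variable {X : Type*} [MetricSpace X] [MeasurableSpace X] [BorelSpace X] [ProperSpace X]
  {m : Measure X} [IsFiniteMeasure m] {K N : ℝ} {φ : X → ℝ} {𝔔 : X → X}

theorem IsRayQuotient.measurableSet_preimage (hφ : LipschitzWith 1 φ) (hQ : IsRayQuotient φ 𝔔)
    {Y : Type*} [MeasurableSpace Y] {f : X × X → Y} (hf : Measurable f) {B : Set Y}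
    (hB : MeasurableSet B) : MeasurableSet {x ∈ transportSet φ | f (𝔔 x, x) ∈ B} := by
  have h : Measurable fun x : transportSet φ => f (𝔔 x, x) :=
    hf.comp (hQ.measurable.prodMk measurable_subtype_coe)
  have := (measurableSet_transportSet hφ).subtype_image (h hB)
  convert this using 1
  ext x
  simp [and_comm]

/-- The measure of a set of points of the transport set does not decrease by more than the factor
`M` when the set is contracted along the rays towards the level `c` of `φ`. -/
theorem MCP.le_measure_contract_rays (hgeo : IsGeodesicSpace X) (hnb : IsNonBranching X)
    (hMCP : MCP m K N) (hφ : LipschitzWith 1 φ) (hQ : IsRayQuotient φ 𝔔) {B : Set (X × ℝ)}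
    (hB : MeasurableSet B) {c t M α β ε : ℝ} (ht0 : 0 < t) (ht1 : t < 1) (hα : 0 < α) (hε : 0 < ε)
    (hβ : 0 < K → β < Real.pi * Real.sqrt ((N - 1) / K))
    (hM : ∀ θ ∈ Icc α β, M ≤ t * sigma (K / (N - 1)) t θ ^ (N - 1))
    (hB' : ∀ p ∈ B, α ≤ p.2 - c ∧ p.2 - c + ε ≤ β ∧ c ∈ rayLevels φ 𝔔 p.1) :
    ENNReal.ofReal M * m {x ∈ transportSet φ | (𝔔 x, φ x) ∈ B} ≤
      m {x ∈ transportSet φ | (𝔔 x, c + (φ x - c) / t) ∈ B} := by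
  have hA : MeasurableSet {x ∈ transportSet φ | (𝔔 x, φ x) ∈ B} :=
    hQ.measurableSet_preimage hφ (f := fun p => (p.1, φ p.2))
      (measurable_fst.prodMk (hφ.continuous.measurable.comp measurable_snd)) hB
  -- Inner regularity reduces the claim to compact subsets.
  rw [hA.measure_eq_iSup_isCompact_of_ne_top (measure_ne_top _ _)]
  simp only [ENNReal.mul_iSup]
  refine iSup_le fun A => iSup_le fun hAs => iSup_le fun hAc => ?_
  have hlev : ∀ x ∈ A, ∃ p ∈ transportSet φ, 𝔔 p = 𝔔 x ∧ φ p = c ∧ (x, p) ∈ Gam φ := by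
    intro x hx
    obtain ⟨hxT, hxB⟩ := hAs hx
    obtain ⟨h1, h2, p, hp, hpq, hpc⟩ := hB' _ hxB
    exact ⟨p, hp, hpq, hpc, gam_of_rays (hQ.rays_of_eq hφ hxT hp hpq.symm)
      (by rw [hpc]; simp only at h1; linarith)⟩
  refine (hMCP.le_measure_contract hgeo hnb hφ hAc (c := c) ht0 ht1 hα hε hβ hM ?_).trans
    (measure_mono ?_)
  · intro x hx
    obtain ⟨h1, h2, -⟩ := hB' _ (hAs hx).2
    obtain ⟨p, -, -, hpc, hg⟩ := hlev x hx
    exact ⟨h1, h2, p, hg, hpc⟩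
  · rintro z ⟨x, hx, y, hxy, hyc, hxz, hzy, hz⟩
    obtain ⟨hxT, hxB⟩ := hAs hx
    obtain ⟨p, hp, hpq, hpc, hg⟩ := hlev x hx
    -- As `x` is not a forward branching point, the point of the level reached from `x` is unique,
    -- so the segment runs along the ray of `x`.
    obtain rfl : y = p := eq_of_rays (rays_of_gam_left hxT hxy hg) (hyc.trans hpc.symm)
    have hzT := mem_transportSet_of_between hφ hxT hp hxz hzy
    refine ⟨hzT, ?_⟩
    rw [← hQ.const x hxT z hzT (Or.inl hxz), hz]
    convert hxB using 2
    field_simp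
    ring

/-- Changing `φ` to `-φ` reverses the rays but preserves the transport set and `𝔔`. -/
theorem MCP.le_measure_contract_rays_neg (hgeo : IsGeodesicSpace X) (hnb : IsNonBranching X)
    (hMCP : MCP m K N) (hφ : LipschitzWith 1 φ) (hQ : IsRayQuotient φ 𝔔) {B : Set (X × ℝ)}
    (hB : MeasurableSet B) {c t M α β ε : ℝ} (ht0 : 0 < t) (ht1 : t < 1) (hα : 0 < α) (hε : 0 < ε)
    (hβ : 0 < K → β < Real.pi * Real.sqrt ((N - 1) / K))
    (hM : ∀ θ ∈ Icc α β, M ≤ t * sigma (K / (N - 1)) t θ ^ (N - 1))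
    (hB' : ∀ p ∈ B, α ≤ c - p.2 ∧ c - p.2 + ε ≤ β ∧ c ∈ rayLevels φ 𝔔 p.1) :
    ENNReal.ofReal M * m {x ∈ transportSet φ | (𝔔 x, φ x) ∈ B} ≤
      m {x ∈ transportSet φ | (𝔔 x, c + (φ x - c) / t) ∈ B} := by
  have h := hMCP.le_measure_contract_rays hgeo hnb (φ := fun z => -φ z) hφ.neg hQ.neg (c := -c)
    (B := {p | (p.1, -p.2) ∈ B}) (hB.preimage (by fun_prop)) ht0 ht1 hα hε hβ hM ?_
  · simp only [transportSet_neg, mem_ofPred_eq, neg_neg] at h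
    convert h using 6
    ring_nf
  · intro p hp
    obtain ⟨h1, h2, x, hx, hxq, hxc⟩ := hB' _ hp
    simp only at h1 h2 hxq
    refine ⟨by linarith, by linarith, x, ?_, hxq, by simp [hxc]⟩
    rwa [transportSet_neg]

end RayContraction

/-! ### Contraction on an interval -/

section OneDim

/-- The measure contraction property of a measure on an interval `J` of the line, towards
points of `J`, for intervals and rational parameters. -/
def ContractsRat (κ n : ℝ) (ν : Measure ℝ) (J : Set ℝ) : Prop :=
  ∀ c t u v α β M : ℚ, (c : ℝ) ∈ J → 0 < t → t < 1 → 0 < α →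
    (0 < κ → (β : ℝ) < Real.pi / Real.sqrt κ) →
    (∀ θ ∈ Icc (α : ℝ) β, (M : ℝ) ≤ t * sigma κ t θ ^ n) →
    ((α ≤ u - c ∧ v - c < β) ∨ (α ≤ c - v ∧ c - u < β)) →
    ENNReal.ofReal M * ν (Icc (u : ℝ) v) ≤ ν (Icc (c + t * (u - c) : ℝ) (c + t * (v - c)))

variable {κ n : ℝ} {ν : Measure ℝ} {J : Set ℝ}

theorem continuousAt_sigma_weight (hn : 0 < n) {t θ : ℝ} (hθ : 0 < θ)
    (hθ' : 0 < κ → θ < Real.pi / Real.sqrt κ) :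
    ContinuousAt (fun p : ℝ × ℝ => p.1 * sigma κ p.1 p.2 ^ n) (t, θ) := by
  have h : ContinuousAt (fun p : ℝ × ℝ => p.1 * (sn κ (p.1 * p.2) / sn κ p.2) ^ n) (t, θ) := by
    refine continuousAt_fst.mul (ContinuousAt.rpow_const (ContinuousAt.div ?_ ?_ ?_) (Or.inr hn.le))
    · exact ((continuous_sn κ).comp (by fun_prop : Continuous fun p : ℝ × ℝ => p.1 * p.2)).continuousAt
    · exact ((continuous_sn κ).comp continuous_snd).continuousAt
    · exact (sn_pos hθ hθ').ne'
  refine h.congr ?_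
  have : ∀ᶠ p : ℝ × ℝ in 𝓝 (t, θ), p.2 ≠ 0 := continuousAt_snd.eventually_ne hθ.ne'
  filter_upwards [this] with p hp
  rw [sigma_of_ne hp]

theorem le_measure_Icc_of_forall [IsFiniteMeasure ν] {a b : ℝ} {x : ℝ≥0∞}
    (h : ∀ δ > 0, x ≤ ν (Icc (a - δ) (b + δ))) : x ≤ ν (Icc a b) := by
  have hanti : Antitone fun k : ℕ => Icc (a - 1 / ((k : ℝ) + 1)) (b + 1 / ((k : ℝ) + 1)) := by
    intro k l hkl
    have : 1 / ((l : ℝ) + 1) ≤ 1 / ((k : ℝ) + 1) := by gcongr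
    exact Icc_subset_Icc (by linarith) (by linarith)
  have hlim := tendsto_measure_iInter_atTop (μ := ν)
    (fun k => measurableSet_Icc.nullMeasurableSet) hanti ⟨0, measure_ne_top _ _⟩
  have e : ⋂ k : ℕ, Icc (a - 1 / ((k : ℝ) + 1)) (b + 1 / ((k : ℝ) + 1)) = Icc a b := by
    have h0 := tendsto_one_div_add_atTop_nhds_zero_nat (𝕜 := ℝ)
    refine Subset.antisymm (fun y hy => ?_) (subset_iInter fun k => ?_)
    · rw [mem_iInter] at hy
      constructor
      · refine le_of_tendsto' (f := fun k : ℕ => a - 1 / ((k : ℝ) + 1)) (x := atTop) ?_ fun k => (hy k).1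
        simpa using h0.const_sub a
      · refine ge_of_tendsto' (f := fun k : ℕ => b + 1 / ((k : ℝ) + 1)) (x := atTop) ?_ fun k => (hy k).2
        simpa using h0.const_add b
    · have : 0 < 1 / ((k : ℝ) + 1) := by positivity
      exact Icc_subset_Icc (by linarith) (by linarith)
  rw [e] at hlim
  exact ge_of_tendsto' hlim fun k => h _ (by positivity)

/-- The contraction property for real parameters and small intervals. -/
theorem ContractsRat.eventually_le [IsFiniteMeasure ν] (hP : ContractsRat κ n ν J) (hn : 0 < n)
    {c s t M : ℝ} (hc : c ∈ interior J) (hne : s ≠ c)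
    (hD : 0 < κ → |s - c| < Real.pi / Real.sqrt κ) (ht0 : 0 < t) (ht1 : t < 1)
    (hM : M < t * sigma κ t |s - c| ^ n) :
    ∀ᶠ r in 𝓝[>] (0 : ℝ), ENNReal.ofReal M * ν (Icc s (s + r)) ≤
      ν (Icc (c + t * (s - c)) (c + t * (s - c) + t * r)) := by
  have hθ : 0 < |s - c| := abs_pos.2 (sub_ne_zero.2 hne)
  obtain ⟨M', hM', hM''⟩ := exists_rat_btwn hM
  have hw : ∀ᶠ p : ℝ × ℝ in 𝓝 (t, |s - c|), (M' : ℝ) < p.1 * sigma κ p.1 p.2 ^ n :=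
    (continuousAt_sigma_weight hn hθ hD).eventually (lt_mem_nhds hM'')
  obtain ⟨δ, hδ, hw⟩ := Metric.eventually_nhds_iff.1 hw
  obtain ⟨α, hα, hα'⟩ := exists_rat_btwn (max_lt hθ (show |s - c| - δ < |s - c| by linarith))
  obtain ⟨β, hβ, hβ'⟩ : ∃ β : ℚ, |s - c| < β ∧
      ((β : ℝ) < |s - c| + δ ∧ (0 < κ → (β : ℝ) < Real.pi / Real.sqrt κ)) := by
    by_cases hκ : 0 < κ
    · obtain ⟨β, h1, h2⟩ := exists_rat_btwn
        (lt_min (show |s - c| < |s - c| + δ by linarith) (hD hκ))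
      exact ⟨β, h1, h2.trans_le (min_le_left _ _), fun _ => h2.trans_le (min_le_right _ _)⟩
    · obtain ⟨β, h1, h2⟩ := exists_rat_btwn (show |s - c| < |s - c| + δ by linarith)
      exact ⟨β, h1, h2, fun h => absurd h hκ⟩
  have hα0 : (0 : ℝ) < α := (le_max_left _ _).trans_lt hα
  have hαδ : |s - c| - δ < α := (le_max_right _ _).trans_lt hα
  have hr : ∀ᶠ r in 𝓝[>] (0 : ℝ), 0 < r ∧ (α : ℝ) < |s + r - c| ∧ |s + r - c| < β ∧
      r < |s - c| := by
    have h1 : ContinuousAt (fun r : ℝ => |s + r - c|) 0 := by fun_prop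
    have h2 := h1.eventually (lt_mem_nhds (show (α : ℝ) < |s + 0 - c| by simpa using hα'))
    have h3 := h1.eventually (gt_mem_nhds (show |s + 0 - c| < β by simpa using hβ))
    filter_upwards [self_mem_nhdsWithin, nhdsWithin_le_nhds h2, nhdsWithin_le_nhds h3,
      nhdsWithin_le_nhds (gt_mem_nhds hθ)] with r a1 a2 a3 a4
    exact ⟨a1, a2, a3, a4⟩
  filter_upwards [hr] with r ⟨hr0, hr1, hr2, hr3⟩
  -- The target is enlarged by `η`, to be sent to `0`, which leaves room for replacing real
  -- parameters by rational ones.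
  refine le_measure_Icc_of_forall fun η hη => ?_
  obtain ⟨cs, -, -, hcs⟩ := Real.exists_seq_rat_strictMono_tendsto c
  obtain ⟨ts, -, -, hts⟩ := Real.exists_seq_rat_strictMono_tendsto t
  -- The end points are approximated from outside, so that the rational interval contains `Icc s (s
  -- + r)`.
  obtain ⟨us, -, hus', hus⟩ := Real.exists_seq_rat_strictMono_tendsto s
  obtain ⟨vs, -, hvs', hvs⟩ := Real.exists_seq_rat_strictAnti_tendsto (s + r)
  have hside : ∀ᶠ k in atTop, (α ≤ us k - cs k ∧ vs k - cs k < β) ∨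
      (α ≤ cs k - vs k ∧ cs k - us k < β) := by
    rcases lt_or_gt_of_ne hne with h | h
    · have e1 : |s - c| = c - s := by rw [abs_sub_comm]; exact abs_of_pos (by linarith)
      have e2 : |s + r - c| = c - (s + r) := by
        rw [abs_sub_comm]; exact abs_of_pos (by linarith)
      filter_upwards [(hcs.sub hvs).eventually (lt_mem_nhds (e2 ▸ hr1)),
        (hcs.sub hus).eventually (gt_mem_nhds (e1 ▸ hβ))] with k h1 h2
      exact Or.inr ⟨by exact_mod_cast h1.le, by exact_mod_cast h2⟩
    · have e1 : |s - c| = s - c := abs_of_pos (by linarith)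
      have e2 : |s + r - c| = s + r - c := abs_of_pos (by linarith)
      filter_upwards [(hus.sub hcs).eventually (lt_mem_nhds (e1 ▸ hα')),
        (hvs.sub hcs).eventually (gt_mem_nhds (e2 ▸ hr2))] with k h1 h2
      exact Or.inl ⟨by exact_mod_cast h1.le, by exact_mod_cast h2⟩
  have hcJ : ∀ᶠ k in atTop, (cs k : ℝ) ∈ J :=
    hcs.eventually (mem_interior_iff_mem_nhds.1 hc)
  have htd : ∀ᶠ k in atTop, dist (ts k : ℝ) t < δ := hts.eventually (Metric.ball_mem_nhds t hδ)
  have hend : ∀ᶠ k in atTop, c + t * (s - c) - η < cs k + ts k * (us k - cs k) :=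
    (hcs.add (hts.mul (hus.sub hcs))).eventually (lt_mem_nhds (by linarith))
  have hend' : ∀ᶠ k in atTop, (cs k + ts k * (vs k - cs k) : ℝ) <
      c + t * (s - c) + t * r + η :=
    (hcs.add (hts.mul (hvs.sub hcs))).eventually (gt_mem_nhds (by linarith))
  obtain ⟨k, k1, k2, k3, k4, k5, k6, k7⟩ := (hside.and (hcJ.and (htd.and (hend.and (hend'.and
    ((hts.eventually (lt_mem_nhds ht0)).and (hts.eventually (gt_mem_nhds ht1)))))))).exists
  have := hP (cs k) (ts k) (us k) (vs k) α β M' k2 (by exact_mod_cast k6) (by exact_mod_cast k7)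
    (by exact_mod_cast hα0) hβ'.2 (fun θ hθ => (@hw (ts k, θ) (by
      rw [Prod.dist_eq, max_lt_iff]
      refine ⟨k3, ?_⟩
      rw [Real.dist_eq, abs_lt]
      constructor <;> linarith [hθ.1, hθ.2])).le) k1
  calc ENNReal.ofReal M * ν (Icc s (s + r)) ≤ ENNReal.ofReal M' * ν (Icc (us k : ℝ) (vs k)) := by
        gcongr
        · exact (hus' k).le
        · exact (hvs' k).le
    _ ≤ _ := this
    _ ≤ _ := measure_mono (Icc_subset_Icc k4.le k5.le)

/-- The upper right density of a measure on the line with respect to Lebesgue measure. -/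
noncomputable def upperDensity (ν : Measure ℝ) (s : ℝ) : ℝ≥0∞ :=
  limsup (fun r => ν (Icc s (s + r)) / ENNReal.ofReal r) (𝓝[>] (0 : ℝ))

/-- The contraction of ratio `t = (τ - c) / (s - c)` sends `[s, s + r]` to `[τ, τ + t r]`. The
factor `t` in the weight cancels against the shrinking of lengths, leaving the power of the `sn`
ratio. -/
theorem ContractsRat.mul_upperDensity_le [IsFiniteMeasure ν] (hP : ContractsRat κ n ν J)
    (hn : 0 < n) {c s τ M : ℝ} (hc : c ∈ interior J) (hτ : c < τ ∧ τ < s ∨ s < τ ∧ τ < c)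
    (hD : 0 < κ → |s - c| < Real.pi / Real.sqrt κ)
    (hM : M < (sn κ |τ - c| / sn κ |s - c|) ^ n) :
    ENNReal.ofReal M * upperDensity ν s ≤ upperDensity ν τ := by
  have hne : s - c ≠ 0 := by rcases hτ with h | h <;> [apply ne_of_gt; apply ne_of_lt] <;> linarith
  obtain ⟨t, ht⟩ : ∃ t, t = (τ - c) / (s - c) := ⟨_, rfl⟩
  have hτ' : c + t * (s - c) = τ := by rw [ht, div_mul_cancel₀ _ hne]; ring
  have ht01 : 0 < t ∧ t < 1 := by
    rw [ht]
    rcases hτ with h | h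
    · have : 0 < s - c := by linarith
      exact ⟨div_pos (by linarith) this, (div_lt_one this).2 (by linarith)⟩
    · have : s - c < 0 := by linarith
      exact ⟨div_pos_of_neg_of_neg (by linarith) this, (div_lt_one_of_neg this).2 (by linarith)⟩
  obtain ⟨ht0, ht1⟩ := ht01
  have habs : t * |s - c| = |τ - c| := by
    rw [← hτ', add_sub_cancel_left, abs_mul, abs_of_pos ht0]
  have hev := hP.eventually_le hn (M := t * M) hc (sub_ne_zero.1 hne) hD ht0 ht1 (by
    rw [sigma_of_ne (abs_pos.2 hne).ne', habs]
    exact mul_lt_mul_of_pos_left hM ht0)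
  rw [hτ'] at hev
  have hmap : Tendsto (fun r : ℝ => t * r) (𝓝[>] 0) (𝓝[>] 0) := by
    refine tendsto_nhdsWithin_iff.2 ⟨?_, ?_⟩
    · have : Tendsto (fun r : ℝ => t * r) (𝓝 0) (𝓝 (t * 0)) := tendsto_id.const_mul t
      rw [mul_zero] at this
      exact this.mono_left nhdsWithin_le_nhds
    · filter_upwards [self_mem_nhdsWithin] with r hr
      exact mul_pos ht0 hr
  calc ENNReal.ofReal M * upperDensity ν s
      = limsup (fun r => ENNReal.ofReal M * (ν (Icc s (s + r)) / ENNReal.ofReal r))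
          (𝓝[>] (0 : ℝ)) := (ENNReal.limsup_const_mul_of_ne_top ENNReal.ofReal_ne_top).symm
    _ ≤ limsup (fun r => ν (Icc τ (τ + t * r)) / ENNReal.ofReal (t * r)) (𝓝[>] (0 : ℝ)) := by
        refine limsup_le_limsup ?_
        filter_upwards [hev, self_mem_nhdsWithin] with r hr hr0
        have hr0 : 0 < r := hr0
        rw [ENNReal.le_div_iff_mul_le (Or.inl (by simp [ht0, hr0])) (Or.inl ENNReal.ofReal_ne_top)]
        refine le_trans (le_of_eq ?_) hr
        rw [ENNReal.ofReal_mul ht0.le, ENNReal.ofReal_mul ht0.le]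
        have h1 : ENNReal.ofReal r ≠ 0 := by simp [hr0]
        calc _ = ENNReal.ofReal t * ENNReal.ofReal M *
              (ν (Icc s (s + r)) / ENNReal.ofReal r * ENNReal.ofReal r) := by ring
          _ = _ := by rw [ENNReal.div_mul_cancel h1 ENNReal.ofReal_ne_top]
    _ = limsup (fun r => ν (Icc τ (τ + r)) / ENNReal.ofReal r) (map (fun r => t * r) (𝓝[>] (0 : ℝ))) :=
        rfl
    _ ≤ _ := limsup_le_limsup_of_le hmap

end OneDim

/-! ### Regularity of the density of a contracting measure. -/

section Density

/-- A finite nonzero absolutely continuous measure, concentrated on an interval `J`, that is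
contracted towards the points of `J`. -/
structure IsContracting (κ n : ℝ) (ν : Measure ℝ) (J : Set ℝ) : Prop where
  pos : 0 < n
  convex : Convex ℝ J
  null : ν Jᶜ = 0
  ne_zero : ν ≠ 0
  ac : ν ≪ volume
  rat : ContractsRat κ n ν J

variable {κ n : ℝ} {ν : Measure ℝ} {J : Set ℝ}

theorem IsContracting.null_interior (h : IsContracting κ n ν J) : ν (interior J)ᶜ = 0 := by
  have h1 : ν (frontier J) = 0 := h.ac (h.convex.addHaar_frontier volume)
  refine measure_mono_null (fun x hx => ?_) (measure_union_null h.null h1)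
  by_cases hxJ : x ∈ J
  · exact Or.inr ⟨subset_closure hxJ, hx⟩
  · exact Or.inl hxJ

/-- A comparison of the density at `x` with that at `y` needs a centre strictly beyond `x`, still at
distance less than `π/√κ` from `y`. -/
theorem exists_lt_mem_interior {x y : ℝ} (hx : x ∈ interior J)
    (hD : 0 < κ → y - x < Real.pi / Real.sqrt κ) :
    ∃ c ∈ interior J, c < x ∧ (0 < κ → y - c < Real.pi / Real.sqrt κ) := by
  have h1 : ∀ᶠ c in 𝓝[<] x, c ∈ interior J :=
    nhdsWithin_le_nhds (isOpen_interior.mem_nhds hx)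
  have h2 : ∀ᶠ c in 𝓝[<] x, 0 < κ → y - c < Real.pi / Real.sqrt κ := by
    by_cases hκ : 0 < κ
    · have : ContinuousAt (fun c : ℝ => y - c) x := by fun_prop
      filter_upwards [nhdsWithin_le_nhds (this.eventually (gt_mem_nhds (hD hκ)))] with c hc _ using hc
    · exact Eventually.of_forall fun c h => absurd h hκ
  obtain ⟨c, h1, h2, h3⟩ := (h1.and (h2.and self_mem_nhdsWithin)).exists
  exact ⟨c, h1, h3, h2⟩

theorem exists_gt_mem_interior {x y : ℝ} (hx : x ∈ interior J)
    (hD : 0 < κ → x - y < Real.pi / Real.sqrt κ) :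
    ∃ c ∈ interior J, x < c ∧ (0 < κ → c - y < Real.pi / Real.sqrt κ) := by
  have h1 : ∀ᶠ c in 𝓝[>] x, c ∈ interior J :=
    nhdsWithin_le_nhds (isOpen_interior.mem_nhds hx)
  have h2 : ∀ᶠ c in 𝓝[>] x, 0 < κ → c - y < Real.pi / Real.sqrt κ := by
    by_cases hκ : 0 < κ
    · have : ContinuousAt (fun c : ℝ => c - y) x := by fun_prop
      filter_upwards [nhdsWithin_le_nhds (this.eventually (gt_mem_nhds (hD hκ)))] with c hc _ using hc
    · exact Eventually.of_forall fun c h => absurd h hκ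
  obtain ⟨c, h1, h2, h3⟩ := (h1.and (h2.and self_mem_nhdsWithin)).exists
  exact ⟨c, h1, h3, h2⟩

variable [IsFiniteMeasure ν]

/-- Only the positivity of the constant matters: exchanging `s` and `τ` makes nearby densities
comparable, before finiteness or the length bound is known. -/
theorem IsContracting.exists_mul_upperDensity_le (h : IsContracting κ n ν J) {s τ : ℝ}
    (hτ : τ ∈ interior J)
    (hD : 0 < κ → |s - τ| < Real.pi / Real.sqrt κ) :
    ∃ M > 0, ENNReal.ofReal M * upperDensity ν s ≤ upperDensity ν τ := by
  have key : ∀ c ∈ interior J, (c < τ ∧ τ < s ∨ s < τ ∧ τ < c) →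
      (0 < κ → |s - c| < Real.pi / Real.sqrt κ) →
      ∃ M > 0, ENNReal.ofReal M * upperDensity ν s ≤ upperDensity ν τ := by
    intro c hc hcτ hcD
    have h1 : |τ - c| < |s - c| := by
      rcases hcτ with h | h
      · rw [abs_of_pos (by linarith), abs_of_pos (by linarith)]; linarith
      · rw [abs_of_neg (by linarith), abs_of_neg (by linarith)]; linarith
    have h2 : 0 < |τ - c| := abs_pos.2 (by
      rcases hcτ with h | h
      · exact (sub_pos.2 h.1).ne'
      · exact (sub_neg.2 h.2).ne)
    have h3 := sn_pos h2 fun hκ => h1.trans (hcD hκ)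
    have h4 := sn_pos (h2.trans h1) hcD
    have h5 : 0 < (sn κ |τ - c| / sn κ |s - c|) ^ n := Real.rpow_pos_of_pos (div_pos h3 h4) n
    exact ⟨_, half_pos h5, h.rat.mul_upperDensity_le h.pos hc hcτ hcD (half_lt_self h5)⟩
  rcases lt_trichotomy s τ with hlt | rfl | hlt
  · obtain ⟨c, h1, h2, h3⟩ := exists_gt_mem_interior (κ := κ) (y := s) hτ (fun hκ => by
      have := hD hκ
      rwa [abs_of_neg (by linarith), neg_sub] at this)
    refine key c h1 (Or.inr ⟨hlt, h2⟩) fun hκ => ?_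
    rw [abs_of_neg (by linarith), neg_sub]
    exact h3 hκ
  · exact ⟨1, one_pos, by simp⟩
  · obtain ⟨c, h1, h2, h3⟩ := exists_lt_mem_interior (κ := κ) (y := s) hτ (fun hκ => by
      have := hD hκ
      rwa [abs_of_pos (by linarith)] at this)
    refine key c h1 (Or.inl ⟨h2, hlt⟩) fun hκ => ?_
    rw [abs_of_pos (by linarith)]
    exact h3 hκ

theorem upperDensity_ae_eq (ν : Measure ℝ) [IsFiniteMeasure ν] :
    upperDensity ν =ᵐ[volume] ν.rnDeriv volume := by
  filter_upwards [VitaliFamily.ae_tendsto_rnDeriv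
    (IsUnifLocDoublingMeasure.vitaliFamily (volume : Measure ℝ) 1) ν] with x hx
  have h1 := hx.comp (Real.tendsto_Icc_vitaliFamily_right x)
  have h2 : Tendsto (fun r : ℝ => x + r) (𝓝[>] 0) (𝓝[>] x) := by
    refine tendsto_nhdsWithin_iff.2 ⟨?_, ?_⟩
    · have : Tendsto (fun r : ℝ => x + r) (𝓝 0) (𝓝 (x + 0)) := tendsto_id.const_add x
      rw [add_zero] at this
      exact this.mono_left nhdsWithin_le_nhds
    · filter_upwards [self_mem_nhdsWithin] with r hr
      exact lt_add_of_pos_right x hr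
  have h3 := h1.comp h2
  simp only [Function.comp_def, Real.volume_Icc, add_sub_cancel_left] at h3
  exact h3.limsup_eq

theorem IsContracting.withDensity_upperDensity (h : IsContracting κ n ν J) :
    volume.withDensity (upperDensity ν) = ν := by
  rw [withDensity_congr_ae (upperDensity_ae_eq ν), Measure.withDensity_rnDeriv_eq _ _ h.ac]

/-- Being zero, or infinite, passes between nearby points and hence spreads over the whole open
interval. Zero everywhere contradicts `ν ≠ 0`; infinite everywhere contradicts the almost everywhere
finiteness of the Radon–Nikodym derivative. -/
theorem IsContracting.upperDensity_ne (h : IsContracting κ n ν J) {s : ℝ} (hs : s ∈ interior J) :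
    upperDensity ν s ≠ 0 ∧ upperDensity ν s ≠ ∞ := by
  have hD : ∀ x ∈ interior J, ∀ᶠ y in 𝓝[interior J] x, 0 < κ → |x - y| < Real.pi / Real.sqrt κ := by
    intro x _
    by_cases hκ : 0 < κ
    · have h1 : ContinuousAt (fun y : ℝ => |x - y|) x := by fun_prop
      have h2 : |x - x| < Real.pi / Real.sqrt κ := by
        rw [sub_self, abs_zero]
        exact div_pos Real.pi_pos (Real.sqrt_pos.2 hκ)
      filter_upwards [nhdsWithin_le_nhds (h1.eventually (gt_mem_nhds h2))] with y hy _ using hy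
    · exact Eventually.of_forall fun y h => absurd h hκ
  have hconn : ∀ y ∈ interior J, (upperDensity ν s = 0 → upperDensity ν y = 0) ∧
      (upperDensity ν s = ∞ → upperDensity ν y = ∞) := by
    intro y hy
    refine h.convex.interior.isPreconnected.induction₂'
      (fun x y => (upperDensity ν x = 0 → upperDensity ν y = 0) ∧
        (upperDensity ν x = ∞ → upperDensity ν y = ∞)) ?_ ?_ hs hy
    · intro x hx
      filter_upwards [hD x hx, self_mem_nhdsWithin] with y hxy hy
      obtain ⟨M, hM, h1⟩ := h.exists_mul_upperDensity_le hy hxy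
      obtain ⟨M', hM', h2⟩ := h.exists_mul_upperDensity_le hx (by rwa [abs_sub_comm])
      have hM0 : ENNReal.ofReal M ≠ 0 := by simpa using hM
      have hM0' : ENNReal.ofReal M' ≠ 0 := by simpa using hM'
      refine ⟨⟨fun e => ?_, fun e => ?_⟩, fun e => ?_, fun e => ?_⟩
      · rw [e, nonpos_iff_eq_zero, mul_eq_zero] at h2
        exact h2.resolve_left hM0'
      · rw [e, ENNReal.mul_top hM0] at h1
        exact top_le_iff.1 h1
      · rw [e, nonpos_iff_eq_zero, mul_eq_zero] at h1
        exact h1.resolve_left hM0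
      · rw [e, ENNReal.mul_top hM0'] at h2
        exact top_le_iff.1 h2
    · exact fun x y z _ _ _ h1 h2 => ⟨fun e => h2.1 (h1.1 e), fun e => h2.2 (h1.2 e)⟩
  constructor
  · intro e
    apply h.ne_zero
    rw [← Measure.measure_univ_eq_zero, ← union_compl_self (interior J)]
    refine measure_union_null ?_ h.null_interior
    rw [← h.withDensity_upperDensity, withDensity_apply _ isOpen_interior.measurableSet,
      setLIntegral_congr_fun isOpen_interior.measurableSet (fun y hy => (hconn y hy).1 e)]
    simp
  · intro e
    have h1 : (volume : Measure ℝ) (interior J) = 0 := by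
      have h2 : ∀ᵐ x, upperDensity ν x < ∞ := by
        filter_upwards [upperDensity_ae_eq ν, ν.rnDeriv_lt_top volume] with x h1 h2
        rwa [h1]
      refine measure_mono_null (fun y hy => ?_) h2
      simp [(hconn y hy).2 e]
    exact (isOpen_interior.measure_pos volume ⟨s, hs⟩).ne' h1

/-- The comparison is cleared of denominators so that it passes to limits in which `sn` vanishes. -/
theorem IsContracting.sn_mul_le_aux (h : IsContracting κ n ν J) {c s τ : ℝ}
    (hc : c ∈ interior J) (hs : s ∈ interior J) (hτJ : τ ∈ interior J)
    (hτ : c < τ ∧ τ < s ∨ s < τ ∧ τ < c) (hD : 0 < κ → |s - c| < Real.pi / Real.sqrt κ) :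
    sn κ |τ - c| ^ n * (upperDensity ν s).toReal ≤ sn κ |s - c| ^ n * (upperDensity ν τ).toReal := by
  have h1 : |τ - c| < |s - c| := by
    rcases hτ with h | h
    · rw [abs_of_pos (by linarith), abs_of_pos (by linarith)]; linarith
    · rw [abs_of_neg (by linarith), abs_of_neg (by linarith)]; linarith
  have h2 : 0 < |τ - c| := abs_pos.2 (by
    rcases hτ with h | h
    · exact (sub_pos.2 h.1).ne'
    · exact (sub_neg.2 h.2).ne)
  have h3 := sn_pos h2 fun hκ => h1.trans (hD hκ)
  have h4 := sn_pos (h2.trans h1) hD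
  have hpos := ENNReal.toReal_pos (h.upperDensity_ne hs).1 (h.upperDensity_ne hs).2
  have key : (sn κ |τ - c| / sn κ |s - c|) ^ n * (upperDensity ν s).toReal ≤
      (upperDensity ν τ).toReal := by
    rw [← le_div_iff₀ hpos]
    refine le_of_forall_lt fun M hM => ?_
    obtain ⟨M', hM', hM''⟩ := exists_between hM
    refine hM'.trans_le ?_
    rcases le_total M' 0 with h0 | h0
    · exact h0.trans (by positivity)
    have := ENNReal.toReal_mono (h.upperDensity_ne hτJ).2
      (h.rat.mul_upperDensity_le h.pos hc hτ hD hM'')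
    rw [ENNReal.toReal_mul, ENNReal.toReal_ofReal h0] at this
    rwa [le_div_iff₀ hpos]
  rw [Real.div_rpow h3.le h4.le, div_mul_eq_mul_div,
    div_le_iff₀ (Real.rpow_pos_of_pos h4 n)] at key
  linarith

/-- The bound on the length of the interval, of Bonnet-Myers type. -/
theorem IsContracting.length_lt (h : IsContracting κ n ν J) (hκ : 0 < κ) {a b : ℝ}
    (ha : a ∈ interior J) (hb : b ∈ interior J) : b - a < Real.pi / Real.sqrt κ := by
  by_contra! hab
  have hDpos : 0 < Real.pi / Real.sqrt κ := div_pos Real.pi_pos (Real.sqrt_pos.2 hκ)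
  obtain ⟨d, hd⟩ : ∃ d, d = Real.pi / Real.sqrt κ := ⟨_, rfl⟩
  rw [← hd] at hab hDpos
  have hoc := h.convex.interior.ordConnected
  have hs : a + d ∈ interior J := hoc.out ha hb ⟨by linarith, by linarith⟩
  have hτ : a + d / 2 ∈ interior J := hoc.out ha hb ⟨by linarith, by linarith⟩
  -- Let the centre `c` decrease to `a`: the distance to `a + d` tends to `d = π/√κ` from below,
  -- where `sn κ d = 0`. The limit would force the density at `a + d` to vanish.
  have h1 : ∀ᶠ c in 𝓝[>] a, sn κ (a + d / 2 - c) ^ n * (upperDensity ν (a + d)).toReal ≤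
      sn κ (a + d - c) ^ n * (upperDensity ν (a + d / 2)).toReal := by
    have e1 : ∀ᶠ c in 𝓝[>] a, c < a + d / 2 :=
      nhdsWithin_le_nhds (gt_mem_nhds (by linarith))
    filter_upwards [self_mem_nhdsWithin, e1] with c hc hc'
    have hc : a < c := hc
    have := h.sn_mul_le_aux (c := c) (hoc.out ha hb ⟨hc.le, by linarith⟩) hs hτ
      (Or.inl ⟨hc', by linarith⟩) (fun _ => by rw [← hd, abs_of_pos (by linarith)]; linarith)
    rwa [abs_of_pos (by linarith), abs_of_pos (by linarith)] at this
  have h2 : ∀ x H : ℝ, Tendsto (fun c => sn κ (x - c) ^ n * H) (𝓝[>] a) (𝓝 (sn κ (x - a) ^ n * H)) := by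
    intro x H
    have : Continuous fun c : ℝ => sn κ (x - c) ^ n * H :=
      (((continuous_sn κ).comp (continuous_const.sub continuous_id)).rpow_const
        fun _ => Or.inr h.pos.le).mul continuous_const
    exact (this.tendsto a).mono_left nhdsWithin_le_nhds
  have h3 := le_of_tendsto_of_tendsto (h2 _ _) (h2 _ _) h1
  rw [add_sub_cancel_left, add_sub_cancel_left, hd, sn_pi_div_sqrt hκ, Real.zero_rpow h.pos.ne',
    zero_mul, ← hd] at h3
  have h4 := ENNReal.toReal_pos (h.upperDensity_ne hs).1 (h.upperDensity_ne hs).2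
  have h5 : 0 < sn κ (d / 2) := sn_pos (by linarith) fun _ => by rw [← hd]; linarith
  have := mul_pos (Real.rpow_pos_of_pos h5 n) h4
  linarith

theorem IsContracting.sn_mul_le_left (h : IsContracting κ n ν J) {c s τ : ℝ}
    (hc : c ∈ interior J) (hs : s ∈ interior J) (hcτ : c < τ) (hτs : τ ≤ s) :
    sn κ (τ - c) ^ n * (upperDensity ν s).toReal ≤ sn κ (s - c) ^ n * (upperDensity ν τ).toReal := by
  rcases hτs.eq_or_lt with rfl | hτs
  · exact le_rfl
  have := h.sn_mul_le_aux hc hs (h.convex.interior.ordConnected.out hc hs ⟨hcτ.le, hτs.le⟩)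
    (Or.inl ⟨hcτ, hτs⟩) (fun hκ => by
      rw [abs_of_pos (by linarith)]; exact h.length_lt hκ hc hs)
  rwa [abs_of_pos (by linarith), abs_of_pos (by linarith)] at this

theorem IsContracting.sn_mul_le_right (h : IsContracting κ n ν J) {c s τ : ℝ}
    (hc : c ∈ interior J) (hs : s ∈ interior J) (hsτ : s ≤ τ) (hτc : τ < c) :
    sn κ (c - τ) ^ n * (upperDensity ν s).toReal ≤ sn κ (c - s) ^ n * (upperDensity ν τ).toReal := by
  rcases hsτ.eq_or_lt with rfl | hsτ
  · exact le_rfl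
  have := h.sn_mul_le_aux hc hs (h.convex.interior.ordConnected.out hs hc ⟨hsτ.le, hτc.le⟩)
    (Or.inr ⟨hsτ, hτc⟩) (fun hκ => by
      rw [abs_of_neg (by linarith), neg_sub]; exact h.length_lt hκ hs hc)
  rwa [abs_of_neg (by linarith), abs_of_neg (by linarith), neg_sub, neg_sub] at this

theorem locallyLipschitz_near {g : ℝ → ℝ} {x : ℝ} (hg : ContDiffAt ℝ 1 g x) (hx : 0 < g x) :
    ∃ L > 0, ∃ b > 0, ∀ᶠ p : ℝ × ℝ in 𝓝 x ×ˢ 𝓝 x,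
      |g p.1 - g p.2| ≤ L * |p.1 - p.2| ∧ b ≤ g p.1 ∧ b ≤ g p.2 := by
  obtain ⟨L, u, hu, hL⟩ := hg.exists_lipschitzOnWith
  have h1 : ∀ᶠ y in 𝓝 x, g x / 2 < g y :=
    hg.continuousAt.eventually (lt_mem_nhds (half_lt_self hx))
  refine ⟨L + 1, by positivity, g x / 2, by positivity, ?_⟩
  filter_upwards [(h1.and hu).prod_mk (h1.and hu)] with p ⟨⟨a1, a2⟩, a3, a4⟩
  refine ⟨?_, a1.le, a3.le⟩
  have := hL.dist_le_mul _ a2 _ a4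
  rw [Real.dist_eq, Real.dist_eq] at this
  nlinarith [abs_nonneg (p.1 - p.2)]

/-- Fix centres `c₁ < x < c₂`. The comparison towards `c₁` bounds the increase of the density from
left to right, that towards `c₂` its decrease; the powers of `sn` involved are `C¹` and bounded away
from zero near `x`. A local bound on the density turns this into a Lipschitz estimate. -/
theorem IsContracting.locallyLipschitzOn (h : IsContracting κ n ν J) :
    LocallyLipschitzOn (interior J) fun s => (upperDensity ν s).toReal := by
  intro x hx
  obtain ⟨c₁, hc₁, hc₁x, -⟩ := exists_lt_mem_interior (κ := κ) (y := x) hx (fun hκ => by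
    rw [sub_self]; exact div_pos Real.pi_pos (Real.sqrt_pos.2 hκ))
  obtain ⟨c₂, hc₂, hc₂x, -⟩ := exists_gt_mem_interior (κ := κ) (y := x) hx (fun hκ => by
    rw [sub_self]; exact div_pos Real.pi_pos (Real.sqrt_pos.2 hκ))
  have p1 : 0 < sn κ (x - c₁) := sn_pos (by linarith) fun hκ => h.length_lt hκ hc₁ hx
  have p2 : 0 < sn κ (c₂ - x) := sn_pos (by linarith) fun hκ => h.length_lt hκ hx hc₂
  have d1 : ContDiffAt ℝ 1 (fun y => sn κ (y - c₁) ^ n) x :=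
    ((contDiff_sn κ).comp (contDiff_id.sub contDiff_const)).contDiffAt.rpow_const_of_ne p1.ne'
  have d2 : ContDiffAt ℝ 1 (fun y => sn κ (c₂ - y) ^ n) x :=
    ((contDiff_sn κ).comp (contDiff_const.sub contDiff_id)).contDiffAt.rpow_const_of_ne p2.ne'
  obtain ⟨L₁, hL₁, b₁, hb₁, e1⟩ := locallyLipschitz_near d1 (Real.rpow_pos_of_pos p1 n)
  obtain ⟨L₂, hL₂, b₂, hb₂, e2⟩ := locallyLipschitz_near d2 (Real.rpow_pos_of_pos p2 n)
  obtain ⟨H, hH⟩ : ∃ H : ℝ → ℝ, H = fun s => (upperDensity ν s).toReal := ⟨_, rfl⟩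
  have hH0 : ∀ s, 0 ≤ H s := fun s => by rw [hH]; exact ENNReal.toReal_nonneg
  have l1 : ∀ s ∈ interior J, ∀ τ, c₁ < τ → τ ≤ s →
      sn κ (τ - c₁) ^ n * H s ≤ sn κ (s - c₁) ^ n * H τ := fun s hs τ h1 h2 => by
    rw [hH]; exact h.sn_mul_le_left hc₁ hs h1 h2
  have l2 : ∀ s ∈ interior J, ∀ τ, s ≤ τ → τ < c₂ →
      sn κ (c₂ - τ) ^ n * H s ≤ sn κ (c₂ - s) ^ n * H τ := fun s hs τ h1 h2 => by
    rw [hH]; exact h.sn_mul_le_right hc₂ hs h1 h2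
  -- Contraction towards `c₁` bounds the density near `x` by its value at one point `a` between `c₁`
  -- and `x`.
  obtain ⟨B, hB, e3⟩ : ∃ B > 0, ∀ᶠ y in 𝓝 x, H y ≤ B := by
    obtain ⟨a, ha1, ha2⟩ := exists_between hc₁x
    have haJ := h.convex.interior.ordConnected.out hc₁ hx ⟨ha1.le, ha2.le⟩
    have pa : 0 < sn κ (a - c₁) ^ n :=
      Real.rpow_pos_of_pos (sn_pos (by linarith) fun hκ => h.length_lt hκ hc₁ haJ) n
    have q1 : ∀ᶠ y in 𝓝 x, sn κ (y - c₁) ^ n < sn κ (x - c₁) ^ n + 1 :=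
      d1.continuousAt.eventually (gt_mem_nhds (by linarith))
    have hx0 : 0 < sn κ (x - c₁) ^ n := Real.rpow_pos_of_pos p1 n
    refine ⟨(sn κ (x - c₁) ^ n + 1) * (H a + 1) / sn κ (a - c₁) ^ n, ?_, ?_⟩
    · have := hH0 a
      positivity
    · filter_upwards [q1, isOpen_interior.mem_nhds hx, lt_mem_nhds ha2] with y y1 y2 y3
      rw [le_div_iff₀ pa, mul_comm]
      refine (l1 y y2 a ha1 y3.le).trans ?_
      have := hH0 a
      gcongr
      linarith
  obtain ⟨C, hC⟩ : ∃ C, C = L₁ * B / b₁ + L₂ * B / b₂ := ⟨_, rfl⟩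
  have hC1 : L₁ * B / b₁ ≤ C := by rw [hC]; have : 0 ≤ L₂ * B / b₂ := by positivity
                                   linarith
  have hC2 : L₂ * B / b₂ ≤ C := by rw [hC]; have : 0 ≤ L₁ * B / b₁ := by positivity
                                   linarith
  have e4 : ∀ᶠ y in 𝓝 x, c₁ < y ∧ y < c₂ ∧ y ∈ interior J ∧ H y ≤ B := by
    filter_upwards [lt_mem_nhds hc₁x, gt_mem_nhds hc₂x, isOpen_interior.mem_nhds hx, e3]
      with y y1 y2 y3 y4 using ⟨y1, y2, y3, y4⟩
  have e5 : ∀ᶠ p : ℝ × ℝ in 𝓝 x ×ˢ 𝓝 x, |H p.1 - H p.2| ≤ C * |p.1 - p.2| := by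
    have main : ∀ᶠ p : ℝ × ℝ in 𝓝 x ×ˢ 𝓝 x, p.1 ≤ p.2 → |H p.1 - H p.2| ≤ C * |p.1 - p.2| := by
      filter_upwards [e1, e2, e4.prod_mk e4] with ⟨s, τ⟩ ⟨a1, a2, a3⟩ ⟨b1, b2, b3⟩
        ⟨⟨s1, s2, s3, s4⟩, t1, t2, t3, t4⟩ hsτ
      simp only at *
      have m1 := l1 τ t3 s s1 hsτ
      have m2 := l2 s s3 τ hsτ t2
      have hsn := hH0 s
      have htn := hH0 τ
      have hd := abs_nonneg (s - τ)
      have k1 := abs_le.1 a1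
      have k2 := abs_le.1 b1
      have u1 : L₁ * |s - τ| * H s ≤ L₁ * |s - τ| * B := by gcongr
      have u2 : L₂ * |s - τ| * H s ≤ L₂ * |s - τ| * B := by gcongr
      rw [abs_le]
      constructor
      · -- `H τ - H s` is bounded above by the contraction towards `c₁`
        have w1 : b₁ * (H τ - H s) ≤ L₁ * B * |s - τ| := by
          rcases le_total (H τ) (H s) with hle | hle
          · have : b₁ * (H τ - H s) ≤ 0 := mul_nonpos_of_nonneg_of_nonpos hb₁.le (by linarith)
            have : 0 ≤ L₁ * B * |s - τ| := by positivity
            linarith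
          · nlinarith
        have w2 : H τ - H s ≤ L₁ * B / b₁ * |s - τ| := by
          rw [div_mul_eq_mul_div, le_div_iff₀ hb₁]; linarith
        have := mul_le_mul_of_nonneg_right hC1 hd
        linarith
      · have w1 : b₂ * (H s - H τ) ≤ L₂ * B * |s - τ| := by
          rcases le_total (H s) (H τ) with hle | hle
          · have : b₂ * (H s - H τ) ≤ 0 := mul_nonpos_of_nonneg_of_nonpos hb₂.le (by linarith)
            have : 0 ≤ L₂ * B * |s - τ| := by positivity
            linarith
          · nlinarith
        have w2 : H s - H τ ≤ L₂ * B / b₂ * |s - τ| := by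
          rw [div_mul_eq_mul_div, le_div_iff₀ hb₂]; linarith
        have := mul_le_mul_of_nonneg_right hC2 hd
        linarith
    have main' : ∀ᶠ p : ℝ × ℝ in 𝓝 x ×ˢ 𝓝 x, p.2 ≤ p.1 → |H p.2 - H p.1| ≤ C * |p.2 - p.1| :=
      (tendsto_snd.prodMk tendsto_fst).eventually main
    filter_upwards [main, main'] with p h1 h2
    rcases le_total p.1 p.2 with h | h
    · exact h1 h
    · rw [abs_sub_comm, abs_sub_comm p.1]
      exact h2 h
  obtain ⟨u, hu, hu'⟩ := (eventually_prod_self_iff (r := fun a b => |H a - H b| ≤ C * |a - b|)).1 e5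
  have hC0 : 0 ≤ C := by rw [hC]; positivity
  refine ⟨⟨C, hC0⟩, u, mem_nhdsWithin_of_mem_nhds hu, LipschitzOnWith.of_dist_le_mul ?_⟩
  intro s hs τ hτ
  have := hu' s hs τ hτ
  rw [hH] at this
  exact this

end Density

/-! ### A pointwise version of the density that is measurable in parameters. -/

section RightDensity

/-- The right density of a measure on the line along the sequence `1 / (k + 1)`, replaced by `1`
where it is zero or infinite. -/
noncomputable def rightDensity (ν : Measure ℝ) (s : ℝ) : ℝ :=
  let L := limsup (fun k : ℕ => ν (Icc s (s + 1 / ((k : ℝ) + 1))) /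
    ENNReal.ofReal (1 / ((k : ℝ) + 1))) atTop
  -- The default `1` gives positivity everywhere, in particular at end points of the ray, which the
  -- comparison does not control.
  if L = 0 ∨ L = ∞ then 1 else L.toReal

theorem rightDensity_pos (ν : Measure ℝ) (s : ℝ) : 0 < rightDensity ν s := by
  simp only [rightDensity]
  split_ifs with h
  · exact one_pos
  · rw [not_or] at h
    exact ENNReal.toReal_pos h.1 h.2

variable {κ n : ℝ} {ν : Measure ℝ} {J : Set ℝ} [IsFiniteMeasure ν]

theorem IsContracting.continuousAt_upperDensity (h : IsContracting κ n ν J) {s : ℝ}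
    (hs : s ∈ interior J) : ContinuousAt (upperDensity ν) s := by
  have h1 : ContinuousAt (fun s => (upperDensity ν s).toReal) s :=
    h.locallyLipschitzOn.continuousOn.continuousAt (isOpen_interior.mem_nhds hs)
  refine (ENNReal.continuous_ofReal.continuousAt.comp h1).congr ?_
  filter_upwards [isOpen_interior.mem_nhds hs] with y hy
  exact ENNReal.ofReal_toReal (h.upperDensity_ne hy).2

/-- Averages of a continuous density converge; hence the limsup along a sequence in `rightDensity`
loses nothing. -/
theorem IsContracting.tendsto_upperDensity (h : IsContracting κ n ν J) {s : ℝ}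
    (hs : s ∈ interior J) :
    Tendsto (fun r => ν (Icc s (s + r)) / ENNReal.ofReal r) (𝓝[>] (0 : ℝ))
      (𝓝 (upperDensity ν s)) := by
  have hc := h.continuousAt_upperDensity hs
  have hnear : ∀ p : ℝ → Prop, (∀ᶠ y in 𝓝 s, p y) →
      ∀ᶠ r in 𝓝[>] (0 : ℝ), 0 < r ∧ ∀ y ∈ Icc s (s + r), p y := by
    intro p hp
    obtain ⟨ε, hε, hp⟩ := Metric.eventually_nhds_iff.1 hp
    filter_upwards [self_mem_nhdsWithin, nhdsWithin_le_nhds (gt_mem_nhds hε)] with r h0 h1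
    refine ⟨h0, fun y hy => hp ?_⟩
    rw [Real.dist_eq, abs_of_nonneg (by linarith [hy.1])]
    linarith [hy.2]
  have hν : ∀ a b : ℝ, ν (Icc a b) = ∫⁻ y in Icc a b, upperDensity ν y := fun a b => by
    rw [← withDensity_apply _ measurableSet_Icc, h.withDensity_upperDensity]
  have hconst : ∀ r (M : ℝ≥0∞), ∫⁻ _ in Icc s (s + r), M = M * ENNReal.ofReal r := fun r M => by
    simp
  refine tendsto_order.2 ⟨fun lo hlo => ?_, fun hi hhi => ?_⟩
  · obtain ⟨lo', h1, h2⟩ := exists_between hlo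
    filter_upwards [hnear _ (hc.eventually (lt_mem_nhds h2))] with r ⟨h0, hr⟩
    refine h1.trans_le ?_
    rw [ENNReal.le_div_iff_mul_le (Or.inl (by simpa using h0)) (Or.inl ENNReal.ofReal_ne_top),
      hν, ← hconst]
    exact setLIntegral_mono' measurableSet_Icc fun y hy => (hr y hy).le
  · obtain ⟨hi', h1, h2⟩ := exists_between hhi
    filter_upwards [hnear _ (hc.eventually (gt_mem_nhds h1))] with r ⟨h0, hr⟩
    refine lt_of_le_of_lt ?_ h2
    rw [ENNReal.div_le_iff_le_mul (Or.inl (by simpa using h0)) (Or.inl ENNReal.ofReal_ne_top),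
      hν, ← hconst]
    exact setLIntegral_mono' measurableSet_Icc fun y hy => (hr y hy).le

theorem IsContracting.rightDensity_eq (h : IsContracting κ n ν J) {s : ℝ} (hs : s ∈ interior J) :
    rightDensity ν s = (upperDensity ν s).toReal := by
  have h1 : Tendsto (fun k : ℕ => 1 / ((k : ℝ) + 1)) atTop (𝓝[>] 0) :=
    tendsto_nhdsWithin_iff.2 ⟨tendsto_one_div_add_atTop_nhds_zero_nat,
      Eventually.of_forall fun k => by
        show 0 < 1 / ((k : ℝ) + 1)
        positivity⟩
  have h2 := ((h.tendsto_upperDensity hs).comp h1).limsup_eq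
  simp only [Function.comp_def] at h2
  have h3 := h.upperDensity_ne hs
  simp only [rightDensity, h2]
  rw [if_neg (by tauto)]

theorem IsContracting.eq_withDensity (h : IsContracting κ n ν J) :
    ν = (volume.restrict J).withDensity fun s => ENNReal.ofReal (rightDensity ν s) := by
  have hJ : MeasurableSet J := h.convex.ordConnected.measurableSet
  have h1 : ∀ᵐ x ∂(volume.restrict J), x ∈ interior J := by
    rw [ae_restrict_iff' hJ]
    refine measure_mono_null (fun x hx => ?_) (h.convex.addHaar_frontier volume)
    simp only [mem_compl_iff, mem_ofPred_eq, Classical.not_imp] at hx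
    exact ⟨subset_closure hx.1, hx.2⟩
  have h2 : (fun s => ENNReal.ofReal (rightDensity ν s)) =ᵐ[volume.restrict J]
      upperDensity ν := by
    filter_upwards [h1] with s hs
    rw [h.rightDensity_eq hs, ENNReal.ofReal_toReal (h.upperDensity_ne hs).2]
  rw [withDensity_congr_ae h2, ← restrict_withDensity hJ, h.withDensity_upperDensity,
    Measure.restrict_eq_self_of_ae_mem (s := J) (measure_mono_null (fun x hx => hx) h.null)]

theorem IsContracting.locallyLipschitzOn_rightDensity (h : IsContracting κ n ν J) :
    LocallyLipschitzOn (interior J) (rightDensity ν) := by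
  intro x hx
  obtain ⟨L, u, hu, hL⟩ := h.locallyLipschitzOn hx
  refine ⟨L, u ∩ interior J, inter_mem hu self_mem_nhdsWithin, ?_⟩
  intro y hy z hz
  rw [h.rightDensity_eq hy.2, h.rightDensity_eq hz.2]
  exact hL hy.1 hz.1

theorem mem_interior_of_between {J : Set ℝ} (hJ : Convex ℝ J) {a b x : ℝ} (ha : a ∈ J)
    (hb : b ∈ J) (h1 : a < x) (h2 : x < b) : x ∈ interior J :=
  interior_maximal (Ioo_subset_Icc_self.trans (hJ.ordConnected.out ha hb)) isOpen_Ioo ⟨h1, h2⟩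

theorem IsContracting.length_le (h : IsContracting κ n ν J) (hκ : 0 < κ) {a b : ℝ}
    (ha : a ∈ J) (hb : b ∈ J) : b - a ≤ Real.pi / Real.sqrt κ := by
  by_contra! hab
  have hD : 0 < Real.pi / Real.sqrt κ := div_pos Real.pi_pos (Real.sqrt_pos.2 hκ)
  obtain ⟨ε, hε⟩ : ∃ ε, ε = (b - a - Real.pi / Real.sqrt κ) / 2 := ⟨_, rfl⟩
  have h1 := mem_interior_of_between h.convex ha hb (x := a + ε) (by linarith) (by linarith)
  have h2 := mem_interior_of_between h.convex ha hb (x := b - ε) (by linarith) (by linarith)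
  have := h.length_lt hκ h1 h2
  linarith

/-- The centre `c` may be an end point of `J`, so the comparison is taken for interior centres that
tend to `c`. The strict inequality `s < d` keeps both densities at interior points. -/
theorem IsContracting.le_rightDensity_div_left (h : IsContracting κ n ν J) {c τ s d : ℝ}
    (hc : c ∈ J) (hd : d ∈ J) (hcτ : c < τ) (hτs : τ ≤ s) (hsd : s < d) :
    (sn κ (τ - c) / sn κ (s - c)) ^ n ≤ rightDensity ν τ / rightDensity ν s := by
  have hs := mem_interior_of_between h.convex hc hd (hcτ.trans_le hτs) hsd
  have hτ := mem_interior_of_between h.convex hc hd hcτ (hτs.trans_lt hsd)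
  have p1 : 0 < sn κ (τ - c) :=
    sn_pos (by linarith) fun hκ => by have := h.length_le hκ hc hd; linarith
  have p2 : 0 < sn κ (s - c) :=
    sn_pos (by linarith) fun hκ => by have := h.length_le hκ hc hd; linarith
  rw [Real.div_rpow p1.le p2.le, div_le_div_iff₀ (Real.rpow_pos_of_pos p2 n)
    (rightDensity_pos ν s), h.rightDensity_eq hs, h.rightDensity_eq hτ]
  have h2 : ∀ x H : ℝ, Tendsto (fun c => sn κ (x - c) ^ n * H) (𝓝[>] c)
      (𝓝 (sn κ (x - c) ^ n * H)) := by
    intro x H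
    have : Continuous fun c : ℝ => sn κ (x - c) ^ n * H :=
      (((continuous_sn κ).comp (continuous_const.sub continuous_id)).rpow_const
        fun _ => Or.inr h.pos.le).mul continuous_const
    exact (this.tendsto c).mono_left nhdsWithin_le_nhds
  rw [mul_comm (upperDensity ν τ).toReal]
  refine le_of_tendsto_of_tendsto (h2 _ _) (h2 _ _) ?_
  filter_upwards [self_mem_nhdsWithin, nhdsWithin_le_nhds (gt_mem_nhds hcτ)] with c' h3 h4
  have h3 : c < c' := h3
  exact h.sn_mul_le_left (mem_interior_of_between h.convex hc hd h3 (by linarith)) hs h4 hτs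

theorem IsContracting.le_rightDensity_div_right (h : IsContracting κ n ν J) {c τ s d : ℝ}
    (hc : c ∈ J) (hd : d ∈ J) (hτc : τ < c) (hsτ : s ≤ τ) (hds : d < s) :
    (sn κ (c - τ) / sn κ (c - s)) ^ n ≤ rightDensity ν τ / rightDensity ν s := by
  have hs := mem_interior_of_between h.convex hd hc hds (hsτ.trans_lt hτc)
  have hτ := mem_interior_of_between h.convex hd hc (hds.trans_le hsτ) hτc
  have p1 : 0 < sn κ (c - τ) :=
    sn_pos (by linarith) fun hκ => by have := h.length_le hκ hd hc; linarith
  have p2 : 0 < sn κ (c - s) :=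
    sn_pos (by linarith) fun hκ => by have := h.length_le hκ hd hc; linarith
  rw [Real.div_rpow p1.le p2.le, div_le_div_iff₀ (Real.rpow_pos_of_pos p2 n)
    (rightDensity_pos ν s), h.rightDensity_eq hs, h.rightDensity_eq hτ]
  have h2 : ∀ x H : ℝ, Tendsto (fun c => sn κ (c - x) ^ n * H) (𝓝[<] c)
      (𝓝 (sn κ (c - x) ^ n * H)) := by
    intro x H
    have : Continuous fun c : ℝ => sn κ (c - x) ^ n * H :=
      (((continuous_sn κ).comp (continuous_id.sub continuous_const)).rpow_const
        fun _ => Or.inr h.pos.le).mul continuous_const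
    exact (this.tendsto c).mono_left nhdsWithin_le_nhds
  rw [mul_comm (upperDensity ν τ).toReal]
  refine le_of_tendsto_of_tendsto (h2 _ _) (h2 _ _) ?_
  filter_upwards [self_mem_nhdsWithin, nhdsWithin_le_nhds (lt_mem_nhds hτc)] with c' h3 h4
  have h3 : c' < c := h3
  exact h.sn_mul_le_right (mem_interior_of_between h.convex hd hc (by linarith) h3) hs hsτ h4

end RightDensity

open ProbabilityTheory

/-! ### The law of the ray coordinates -/

theorem measurable_shear {X : Type*} [MetricSpace X] [MeasurableSpace X] [BorelSpace X] {φ : X → ℝ}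
    (hφ : LipschitzWith 1 φ) :
    Measurable fun p : X × ℝ => (p.1, φ p.1 - p.2) :=
  measurable_fst.prodMk ((hφ.continuous.measurable.comp measurable_fst).sub measurable_snd)

section RayLaw

variable {X : Type*} [MetricSpace X] [MeasurableSpace X] [BorelSpace X] [ProperSpace X]
  {m : Measure X} {K N : ℝ} {φ : X → ℝ} {𝔔 : X → X}

/-- The law of the ray and of the level of `φ` of a point of the transport set. -/
noncomputable def rayLaw (m : Measure X) (φ : X → ℝ) (𝔔 : X → X) : Measure (X × ℝ) :=
  (m.restrict (transportSet φ)).map fun x => (𝔔 x, φ x)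

instance [IsFiniteMeasure m] : IsFiniteMeasure (rayLaw m φ 𝔔) := by unfold rayLaw; infer_instance

instance [IsFiniteMeasure m] : IsFiniteMeasure (quotientMeasure m φ 𝔔) := by
  unfold quotientMeasure; infer_instance

theorem rayLaw_apply (hφ : LipschitzWith 1 φ) (hQ : IsRayQuotient φ 𝔔) {B : Set (X × ℝ)}
    (hB : MeasurableSet B) : rayLaw m φ 𝔔 B = m {x ∈ transportSet φ | (𝔔 x, φ x) ∈ B} := by
  have hT := measurableSet_transportSet hφ
  have h1 : AEMeasurable 𝔔 (m.restrict (transportSet φ)) :=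
    aemeasurable_restrict_of_measurable_subtype hT hQ.measurable
  rw [rayLaw, Measure.map_apply_of_aemeasurable
    (h1.prodMk hφ.continuous.measurable.aemeasurable) hB, Measure.restrict_apply' hT, inter_comm]
  rfl

theorem quotientMeasure_apply (hφ : LipschitzWith 1 φ) (hQ : IsRayQuotient φ 𝔔) {C : Set X}
    (hC : MeasurableSet C) : quotientMeasure m φ 𝔔 C = m {x ∈ transportSet φ | 𝔔 x ∈ C} := by
  have hT := measurableSet_transportSet hφ
  rw [quotientMeasure, Measure.map_apply_of_aemeasurable
    (aemeasurable_restrict_of_measurable_subtype hT hQ.measurable) hC, Measure.restrict_apply' hT,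
    inter_comm]
  rfl

theorem rayLaw_fst (hφ : LipschitzWith 1 φ) (hQ : IsRayQuotient φ 𝔔) :
    (rayLaw m φ 𝔔).fst = quotientMeasure m φ 𝔔 := by
  ext C hC
  rw [Measure.fst_apply hC, rayLaw_apply hφ hQ (measurable_fst hC), quotientMeasure_apply hφ hQ hC]
  rfl

/-- The coordinates are injective on the transport set, so the Lusin–Souslin theorem applies. All
measurability in ray coordinates rests on this. -/
theorem measurableSet_image_coord (hφ : LipschitzWith 1 φ) (hQ : IsRayQuotient φ 𝔔) {B : Set X}
    (hB : MeasurableSet B) :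
    MeasurableSet {p : X × ℝ | ∃ x ∈ transportSet φ, x ∈ B ∧ 𝔔 x = p.1 ∧ φ x = p.2} := by
  have hT := measurableSet_transportSet hφ
  have := hT.standardBorel
  have h : Measurable fun x : transportSet φ => (𝔔 x, φ x) :=
    hQ.measurable.prodMk (hφ.continuous.measurable.comp measurable_subtype_coe)
  have h1 := MeasurableSet.image_of_measurable_injOn (measurable_subtype_coe hB) h (by
    rintro ⟨x, hx⟩ - ⟨y, hy⟩ - e
    simp only [Prod.mk.injEq] at e
    exact Subtype.ext (hQ.eq_of_eq hφ hx hy e.1 e.2))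
  convert h1 using 1
  ext ⟨q, a⟩
  simp [and_left_comm]

theorem measurableSet_rayLevels (hφ : LipschitzWith 1 φ) (hQ : IsRayQuotient φ 𝔔) :
    MeasurableSet {p : X × ℝ | p.2 ∈ rayLevels φ 𝔔 p.1} := by
  convert measurableSet_image_coord hφ hQ MeasurableSet.univ using 1
  ext p
  simp [rayLevels]

theorem measurableSet_mem_rayLevels (hφ : LipschitzWith 1 φ) (hQ : IsRayQuotient φ 𝔔) (c : ℝ) :
    MeasurableSet {q | c ∈ rayLevels φ 𝔔 q} :=
  (measurable_id.prodMk measurable_const : Measurable fun q : X => (q, c))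
    (measurableSet_rayLevels hφ hQ)

theorem measurableSet_rayDom (hφ : LipschitzWith 1 φ) (hQ : IsRayQuotient φ 𝔔) :
    MeasurableSet {p : X × ℝ | p.2 ∈ rayDom φ 𝔔 p.1} := by
  simp only [hQ.mem_rayDom_iff hφ]
  exact measurable_shear hφ (measurableSet_rayLevels hφ hQ)

theorem measurable_rayMap (hφ : LipschitzWith 1 φ) (hQ : IsRayQuotient φ 𝔔) :
    Measurable fun p : X × ℝ => rayMap φ 𝔔 p.1 p.2 := by
  intro B hB
  have h1 := measurable_shear hφ (measurableSet_image_coord hφ hQ hB)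
  have h2 := (measurableSet_rayDom hφ hQ).compl.inter (measurable_fst hB)
  convert h1.union h2 using 1
  ext ⟨q, t⟩
  simp only [mem_preimage, mem_union, mem_ofPred_eq, mem_inter_iff, mem_compl_iff]
  by_cases h : t ∈ rayDom φ 𝔔 q
  · simp only [h, not_true_eq_false, false_and, or_false]
    obtain ⟨a1, a2, a3⟩ := hQ.rayMap_spec hφ h
    constructor
    · exact fun hB => ⟨_, a1, hB, a2, a3⟩
    · rintro ⟨x, hx, hxB, rfl, hx2⟩
      have := hQ.rayMap_eq hφ hx
      rw [hx2, sub_sub_cancel] at this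
      rwa [this]
  · have h' : rayMap φ 𝔔 q t = q := dif_neg h
    rw [h']
    simp only [h, not_false_eq_true, true_and]
    refine ⟨Or.inr, fun h1 => h1.resolve_left ?_⟩
    rintro ⟨x, hx, -, hxq, hx2⟩
    exact h ((hQ.mem_rayDom_iff hφ).2 ⟨x, hx, hxq, hx2⟩)

theorem rayLaw_compl_rayLevels (hφ : LipschitzWith 1 φ) (hQ : IsRayQuotient φ 𝔔) :
    ∀ᵐ p ∂(rayLaw m φ 𝔔), p.2 ∈ rayLevels φ 𝔔 p.1 := by
  rw [ae_iff, ← compl_ofPred, rayLaw_apply hφ hQ (measurableSet_rayLevels hφ hQ).compl]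
  convert measure_empty (μ := m)
  ext x
  simp only [mem_ofPred_eq, mem_compl_iff, mem_empty_iff_false, iff_false, not_and, not_not]
  exact fun hx => ⟨x, hx, rfl, rfl⟩

theorem ball_radius_eq (K N : ℝ) :
    Real.pi * Real.sqrt ((N - 1) / K) = Real.pi / Real.sqrt (K / (N - 1)) := by
  rw [← inv_div K, Real.sqrt_inv, ← div_eq_mul_inv]

variable [IsFiniteMeasure m]

/-- The contraction of the law of the ray coordinates towards a level. -/
theorem MCP.le_rayLaw (hgeo : IsGeodesicSpace X) (hnb : IsNonBranching X)
    (hMCP : MCP m K N) (hN : 1 < N) (hφ : LipschitzWith 1 φ) (hQ : IsRayQuotient φ 𝔔)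
    {B : Set (X × ℝ)} (hB : MeasurableSet B) {c t M α β ε : ℝ} (ht0 : 0 < t) (ht1 : t < 1)
    (hα : 0 < α) (hε : 0 < ε) (hβ : 0 < K / (N - 1) → β < Real.pi / Real.sqrt (K / (N - 1)))
    (hM : ∀ θ ∈ Icc α β, M ≤ t * sigma (K / (N - 1)) t θ ^ (N - 1))
    (hB' : (∀ p ∈ B, α ≤ p.2 - c ∧ p.2 - c + ε ≤ β ∧ c ∈ rayLevels φ 𝔔 p.1) ∨
      ∀ p ∈ B, α ≤ c - p.2 ∧ c - p.2 + ε ≤ β ∧ c ∈ rayLevels φ 𝔔 p.1) :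
    ENNReal.ofReal M * rayLaw m φ 𝔔 B ≤ rayLaw m φ 𝔔 {p | (p.1, c + (p.2 - c) / t) ∈ B} := by
  have hβ' : 0 < K → β < Real.pi * Real.sqrt ((N - 1) / K) := fun hK => by
    rw [ball_radius_eq]
    exact hβ (div_pos hK (by linarith))
  have hm : MeasurableSet {p : X × ℝ | (p.1, c + (p.2 - c) / t) ∈ B} :=
    hB.preimage (by fun_prop)
  rw [rayLaw_apply hφ hQ hB, rayLaw_apply hφ hQ hm]
  rcases hB' with h | h
  · exact hMCP.le_measure_contract_rays hgeo hnb hφ hQ hB ht0 ht1 hα hε hβ' hM h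
  · exact hMCP.le_measure_contract_rays_neg hgeo hnb hφ hQ hB ht0 ht1 hα hε hβ' hM h

/-- Of the images of a set `B`, null for `𝔮 ⊗ 𝓛¹`, under contractions towards a level, almost all
are null. -/
theorem exists_rayLaw_contract_eq_zero (hφ : LipschitzWith 1 φ) (hQ : IsRayQuotient φ 𝔔)
    {B : Set (X × ℝ)} (hB : MeasurableSet B) {c : ℝ} (hBc : ∀ p ∈ B, p.2 ≠ c)
    (h0 : (quotientMeasure m φ 𝔔).prod volume B = 0) :
    ∃ t : ℝ, 0 < t ∧ t < 1 ∧ rayLaw m φ 𝔔 {p | (p.1, c + (p.2 - c) / t) ∈ B} = 0 := by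
  have h1 : ∀ᵐ p ∂(rayLaw m φ 𝔔), volume (Prod.mk p.1 ⁻¹' B) = 0 := by
    have := Measure.measure_ae_null_of_prod_null h0
    rw [← rayLaw_fst hφ hQ] at this
    exact ae_of_ae_map measurable_fst.aemeasurable this
  let S : Set ((X × ℝ) × ℝ) := {z | z.2 ∈ Ioo (0 : ℝ) 1 ∧ (z.1.1, c + (z.1.2 - c) / z.2) ∈ B}
  have hS : MeasurableSet S := by
    have e1 : Measurable fun z : (X × ℝ) × ℝ => (z.1.1, c + (z.1.2 - c) / z.2) := by fun_prop
    exact (measurable_snd measurableSet_Ioo).inter (e1 hB)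
  have h2 : (rayLaw m φ 𝔔).prod volume S = 0 := by
    rw [Measure.measure_prod_null hS]
    filter_upwards [h1] with p hp
    -- Solve `b = c + (p.2 - c) / t` for `t`: the result is differentiable in `b ≠ c`, so it sends
    -- the null section of `B` to a null set of ratios `t`.
    have hsub : Prod.mk p ⁻¹' S ⊆ (fun b => (p.2 - c) / (b - c)) '' (Prod.mk p.1 ⁻¹' B) := by
      rintro t ⟨⟨ht0, -⟩, htB⟩
      refine ⟨_, htB, ?_⟩
      have hne := hBc _ htB
      simp only [ne_eq] at hne ht0
      have hpc : p.2 - c ≠ 0 := by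
        intro e
        apply hne
        rw [e]
        ring
      simp only [add_sub_cancel_left]
      field_simp
    refine measure_mono_null hsub
      (addHaar_image_eq_zero_of_differentiableOn_of_addHaar_eq_zero volume ?_ hp)
    intro b hb
    have hne : b - c ≠ 0 := sub_ne_zero.2 (hBc _ hb)
    exact ((differentiableAt_const _).div (differentiableAt_id.sub_const c) hne).differentiableWithinAt
  -- Fubini in the other order: for almost every ratio `t` the contracted set is null.
  rw [← Measure.prod_swap, Measure.map_apply measurable_swap hS,
    Measure.measure_prod_null (measurable_swap hS)] at h2
  have h3 : ∃ᵐ t : ℝ, t ∈ Ioo (0 : ℝ) 1 := by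
    rw [frequently_ae_mem_iff]
    simp
  obtain ⟨t, ht, ht'⟩ := (h3.and_eventually h2).exists
  refine ⟨t, ht.1, ht.2, ?_⟩
  rw [Pi.zero_apply] at ht'
  refine measure_mono_null (fun p hp => ?_) ht'
  exact ⟨ht, hp⟩

/-- The weight is continuous and positive on a compact range of distances below `π/√κ`. -/
theorem exists_pos_le_weight {κ n : ℝ} {t α β : ℝ} (ht0 : 0 < t) (ht1 : t < 1)
    (hα : 0 < α) (hβ : 0 < κ → β < Real.pi / Real.sqrt κ) (hn : 0 < n) :
    ∃ M > 0, ∀ θ ∈ Icc α β, M ≤ t * sigma κ t θ ^ n := by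
  rcases (Icc α β).eq_empty_or_nonempty with he | hne
  · exact ⟨1, one_pos, by simp [he]⟩
  have hpos : ∀ θ ∈ Icc α β, 0 < θ ∧ (0 < κ → θ < Real.pi / Real.sqrt κ) := fun θ hθ =>
    ⟨hα.trans_le hθ.1, fun hκ => hθ.2.trans_lt (hβ hκ)⟩
  have hc : ContinuousOn (fun θ => t * sigma κ t θ ^ n) (Icc α β) := fun θ hθ => by
    have h1 := continuousAt_sigma_weight (κ := κ) (t := t) hn (hpos θ hθ).1 (hpos θ hθ).2
    exact (h1.comp (f := fun θ => (t, θ)) (by fun_prop)).continuousWithinAt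
  obtain ⟨θ, hθ, hmin⟩ := isCompact_Icc.exists_isMinOn hne hc
  refine ⟨_, ?_, fun θ' hθ' => hmin hθ'⟩
  obtain ⟨h1, h2⟩ := hpos θ hθ
  simp only [sigma_of_ne h1.ne']
  have h3 : t * θ < θ := mul_lt_of_lt_one_left h1 ht1
  have h4 : 0 < sn κ (t * θ) := sn_pos (mul_pos ht0 h1) fun hκ => h3.trans (h2 hκ)
  exact mul_pos ht0 (Real.rpow_pos_of_pos (div_pos h4 (sn_pos h1 h2)) n)

/-- If `S` is null for the product, then so is each of its pieces, and some contraction sends the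
piece to a null set for the law; as contraction keeps a positive fraction of the mass, the piece is
null for the law. -/
theorem MCP.rayLaw_absolutelyContinuous (hgeo : IsGeodesicSpace X) (hnb : IsNonBranching X)
    (hMCP : MCP m K N) (hN : 1 < N) (hφ : LipschitzWith 1 φ) (hQ : IsRayQuotient φ 𝔔) :
    rayLaw m φ 𝔔 ≪ (quotientMeasure m φ 𝔔).prod volume := by
  refine Measure.AbsolutelyContinuous.mk fun S hS hS0 => ?_
  obtain ⟨κ, hκ⟩ : ∃ κ, κ = K / (N - 1) := ⟨_, rfl⟩
  -- The index consists of a centre, which must lie on the ray, and of bounds for the distance to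
  -- it. There are countably many pieces, and they cover because no ray reduces to one point.
  let P : ℚ × ℚ × ℚ → X × ℝ → Prop := fun i p =>
    (0 : ℝ) < i.2.1 ∧ (0 < κ → (i.2.2 : ℝ) < Real.pi / Real.sqrt κ) ∧ (i.1 : ℝ) ∈ rayLevels φ 𝔔 p.1 ∧
      (i.2.1 : ℝ) ≤ |p.2 - i.1| ∧ |p.2 - i.1| ≤ i.2.2
  have hcover : ∀ p : X × ℝ, p.2 ∈ rayLevels φ 𝔔 p.1 → ∃ i, P i p := by
    rintro ⟨q, a⟩ ha
    simp only at ha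
    obtain ⟨b, hb, hba⟩ := exists_ne_mem_rayLevels hgeo hnb hφ hQ ha
    have hd : ∃ d > 0, 0 < κ → d ≤ Real.pi / Real.sqrt κ := by
      by_cases hκ : 0 < κ
      · exact ⟨_, div_pos Real.pi_pos (Real.sqrt_pos.2 hκ), fun _ => le_rfl⟩
      · exact ⟨1, one_pos, fun h => absurd h hκ⟩
    obtain ⟨d, hd, hdκ⟩ := hd
    obtain ⟨c, hc, hca, hcd⟩ : ∃ c : ℚ, (c : ℝ) ∈ rayLevels φ 𝔔 q ∧ (c : ℝ) ≠ a ∧ |a - c| < d := by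
      have hoc := (convex_rayLevels hgeo hφ hQ q).ordConnected
      rcases lt_or_gt_of_ne hba with h | h
      · obtain ⟨c, h1, h2⟩ := exists_rat_btwn (max_lt h (sub_lt_self a hd))
        have h3 := (le_max_left _ _).trans_lt h1
        have h4 := (le_max_right _ _).trans_lt h1
        exact ⟨c, hoc.out hb ha ⟨h3.le, h2.le⟩, h2.ne, by rw [abs_lt]; constructor <;> linarith⟩
      · obtain ⟨c, h1, h2⟩ := exists_rat_btwn (lt_min h (lt_add_of_pos_right a hd))
        have h3 := h2.trans_le (min_le_left _ _)
        have h4 := h2.trans_le (min_le_right _ _)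
        exact ⟨c, hoc.out ha hb ⟨h1.le, h3.le⟩, h1.ne', by rw [abs_lt]; constructor <;> linarith⟩
    obtain ⟨α, h1, h2⟩ := exists_rat_btwn (abs_pos.2 (sub_ne_zero.2 hca.symm))
    obtain ⟨β, h3, h4⟩ := exists_rat_btwn hcd
    exact ⟨(c, α, β), h1, fun h => h4.trans_le (hdκ h), hc, h2.le, h3.le⟩
  have hPm : ∀ i, MeasurableSet {p | P i p} := by
    intro i
    have e1 : Measurable fun p : X × ℝ => |p.2 - i.1| := by fun_prop
    exact (MeasurableSet.const _).inter ((MeasurableSet.const _).inter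
      ((measurable_fst (measurableSet_mem_rayLevels hφ hQ i.1)).inter
        ((measurableSet_le measurable_const e1).inter (measurableSet_le e1 measurable_const))))
  have hnull : ∀ i : ℚ × ℚ × ℚ, ∀ B ⊆ S, MeasurableSet B →
      ((∀ p ∈ B, P i p ∧ (i.1 : ℝ) ≤ p.2) ∨ (∀ p ∈ B, P i p ∧ p.2 ≤ (i.1 : ℝ))) →
      rayLaw m φ 𝔔 B = 0 := by
    intro i B hBS hB hBP
    rcases B.eq_empty_or_nonempty with rfl | ⟨p₀, hp₀⟩
    · simp
    have hP : ∀ p ∈ B, P i p := fun p hp => by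
      rcases hBP with h | h
      · exact (h p hp).1
      · exact (h p hp).1
    obtain ⟨hα, hβ, -⟩ := hP p₀ hp₀
    obtain ⟨β, hβ1, hβ2⟩ : ∃ β : ℝ, (i.2.2 : ℝ) < β ∧ (0 < κ → β < Real.pi / Real.sqrt κ) := by
      by_cases hκ : 0 < κ
      · obtain ⟨β, h1, h2⟩ := exists_between (hβ hκ)
        exact ⟨β, h1, fun _ => h2⟩
      · exact ⟨i.2.2 + 1, by linarith, fun h => absurd h hκ⟩
    obtain ⟨t, ht0, ht1, ht⟩ := exists_rayLaw_contract_eq_zero hφ hQ hB (c := i.1) (fun p hp e => by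
      have := (hP p hp).2.2.2.1
      rw [e, sub_self, abs_zero] at this
      linarith) (measure_mono_null hBS hS0)
    obtain ⟨M, hM, hMw⟩ := exists_pos_le_weight (n := N - 1) ht0 ht1 hα hβ2 (by linarith)
    rw [hκ] at hβ2 hMw
    have := hMCP.le_rayLaw hgeo hnb hN hφ hQ hB (c := i.1) (ε := β - i.2.2) ht0 ht1 hα
      (by linarith) hβ2 hMw (by
        refine hBP.imp ?_ ?_
        · intro h p hp
          obtain ⟨⟨-, -, h1, h2, h3⟩, h4⟩ := h p hp
          rw [abs_of_nonneg (by linarith)] at h2 h3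
          exact ⟨h2, by linarith, h1⟩
        · intro h p hp
          obtain ⟨⟨-, -, h1, h2, h3⟩, h4⟩ := h p hp
          rw [abs_of_nonpos (by linarith)] at h2 h3
          exact ⟨by linarith, by linarith, h1⟩)
    rw [ht, nonpos_iff_eq_zero, mul_eq_zero] at this
    exact this.resolve_left (by simpa using hM)
  have hsub : S ⊆ {p : X × ℝ | p.2 ∈ rayLevels φ 𝔔 p.1}ᶜ ∪
      ⋃ i : ℚ × ℚ × ℚ, ((S ∩ {p | P i p}) ∩ {p | (i.1 : ℝ) ≤ p.2}) ∪
        ((S ∩ {p | P i p}) ∩ {p | p.2 ≤ (i.1 : ℝ)}) := by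
    intro p hp
    by_cases h : p.2 ∈ rayLevels φ 𝔔 p.1
    · obtain ⟨i, hi⟩ := hcover p h
      refine Or.inr (mem_iUnion.2 ⟨i, ?_⟩)
      rcases le_total (i.1 : ℝ) p.2 with h' | h'
      · exact Or.inl ⟨⟨hp, hi⟩, h'⟩
      · exact Or.inr ⟨⟨hp, hi⟩, h'⟩
    · exact Or.inl h
  refine measure_mono_null hsub (measure_union_null (rayLaw_compl_rayLevels hφ hQ)
    (measure_iUnion_null fun i => measure_union_null ?_ ?_))
  · exact hnull i _ (fun p hp => hp.1.1) ((hS.inter (hPm i)).inter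
      (measurableSet_le measurable_const measurable_snd)) (Or.inl fun p hp => ⟨hp.1.2, hp.2⟩)
  · exact hnull i _ (fun p hp => hp.1.1) ((hS.inter (hPm i)).inter
      (measurableSet_le measurable_snd measurable_const)) (Or.inr fun p hp => ⟨hp.1.2, hp.2⟩)

end RayLaw

/-! ### Conditional laws along the rays -/

section Conditional

variable {X : Type*} [MetricSpace X] [MeasurableSpace X] [BorelSpace X] [ProperSpace X]
  {m : Measure X} [IsFiniteMeasure m] {K N : ℝ} {φ : X → ℝ} {𝔔 : X → X}

/-- The conditional law of the level of `φ`, given the ray. -/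
noncomputable def levelKernel (m : Measure X) [IsFiniteMeasure m] (φ : X → ℝ) (𝔔 : X → X) :
    Kernel X ℝ := (rayLaw m φ 𝔔).condKernel

instance : IsMarkovKernel (levelKernel m φ 𝔔) := by unfold levelKernel; infer_instance

theorem compProd_levelKernel (hφ : LipschitzWith 1 φ) (hQ : IsRayQuotient φ 𝔔) :
    (quotientMeasure m φ 𝔔).compProd (levelKernel m φ 𝔔) = rayLaw m φ 𝔔 := by
  rw [← rayLaw_fst hφ hQ]
  exact (rayLaw m φ 𝔔).disintegrate (rayLaw m φ 𝔔).condKernel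

theorem ae_levelKernel_compl (hφ : LipschitzWith 1 φ) (hQ : IsRayQuotient φ 𝔔) :
    ∀ᵐ q ∂(quotientMeasure m φ 𝔔), ∀ᵐ a ∂(levelKernel m φ 𝔔 q), a ∈ rayLevels φ 𝔔 q := by
  have h := rayLaw_compl_rayLevels (m := m) hφ hQ
  rw [← compProd_levelKernel hφ hQ] at h
  exact Measure.ae_ae_of_ae_compProd h

theorem MCP.ae_levelKernel_absolutelyContinuous (hgeo : IsGeodesicSpace X)
    (hnb : IsNonBranching X) (hMCP : MCP m K N) (hN : 1 < N) (hφ : LipschitzWith 1 φ)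
    (hQ : IsRayQuotient φ 𝔔) :
    ∀ᵐ q ∂(quotientMeasure m φ 𝔔), levelKernel m φ 𝔔 q ≪ volume := by
  have h := hMCP.rayLaw_absolutelyContinuous hgeo hnb hN hφ hQ
  -- Lebesgue measure is replaced by an equivalent finite measure, which serves as a finite constant
  -- kernel.
  have h1 := h.trans (Measure.AbsolutelyContinuous.rfl.prod
    (absolutelyContinuous_toFinite (volume : Measure ℝ)))
  rw [← compProd_levelKernel hφ hQ, ← Measure.compProd_const] at h1
  filter_upwards [h1.kernel_of_compProd] with q hq
  exact hq.trans (toFinite_absolutelyContinuous _)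

/-- For fixed rational parameters, integrating the kernel inequality over any Borel set of rays
gives `MCP.le_rayLaw` for a product set. There are countably many parameters, so one exceptional
null set serves all. -/
theorem MCP.ae_contractsRat (hgeo : IsGeodesicSpace X) (hnb : IsNonBranching X)
    (hMCP : MCP m K N) (hN : 1 < N) (hφ : LipschitzWith 1 φ) (hQ : IsRayQuotient φ 𝔔) :
    ∀ᵐ q ∂(quotientMeasure m φ 𝔔),
      ContractsRat (K / (N - 1)) (N - 1) (levelKernel m φ 𝔔 q) (rayLevels φ 𝔔 q) := by
  unfold ContractsRat
  simp only [ae_all_iff]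
  intro c t u v α β M
  by_cases hcond : 0 < t ∧ t < 1 ∧ 0 < α ∧
      (0 < K / (N - 1) → (β : ℝ) < Real.pi / Real.sqrt (K / (N - 1))) ∧
      (∀ θ ∈ Icc (α : ℝ) β, (M : ℝ) ≤ t * sigma (K / (N - 1)) t θ ^ (N - 1)) ∧
      ((α ≤ u - c ∧ v - c < β) ∨ (α ≤ c - v ∧ c - u < β))
  swap
  · exact Eventually.of_forall fun q _ h1 h2 h3 h4 h5 h6 => absurd ⟨h1, h2, h3, h4, h5, h6⟩ hcond
  obtain ⟨h1, h2, h3, h4, h5, h6⟩ := hcond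
  have p1 : (0 : ℝ) < t := by exact_mod_cast h1
  have p2 : (t : ℝ) < 1 := by exact_mod_cast h2
  have p3 : (0 : ℝ) < α := by exact_mod_cast h3
  have hC := measurableSet_mem_rayLevels hφ hQ (c : ℝ)
  have key : ∀ᵐ q ∂((quotientMeasure m φ 𝔔).restrict {q | (c : ℝ) ∈ rayLevels φ 𝔔 q}),
      ENNReal.ofReal M * levelKernel m φ 𝔔 q (Icc (u : ℝ) v) ≤
        levelKernel m φ 𝔔 q (Icc (c + t * (u - c) : ℝ) (c + t * (v - c))) := by
    refine ae_le_of_forall_setLIntegral_le_of_sigmaFinite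
      (((levelKernel m φ 𝔔).measurable_coe measurableSet_Icc).const_mul _) fun C hCm _ => ?_
    rw [Measure.restrict_restrict hCm, lintegral_const_mul _
      ((levelKernel m φ 𝔔).measurable_coe measurableSet_Icc),
      ← Measure.compProd_apply_prod (hCm.inter hC) measurableSet_Icc,
      ← Measure.compProd_apply_prod (hCm.inter hC) measurableSet_Icc, compProd_levelKernel hφ hQ]
    -- The strict inequality with `β` in `ContractsRat` provides the slack `ε`.
    have hε : ∃ ε : ℝ, 0 < ε ∧ ((α : ℝ) ≤ u - c ∧ (v - c + ε : ℝ) ≤ β ∨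
        (α : ℝ) ≤ c - v ∧ (c - u + ε : ℝ) ≤ β) := by
      rcases h6 with ⟨h, h'⟩ | ⟨h, h'⟩
      · have e1 : (α : ℝ) ≤ u - c := by exact_mod_cast h
        have e2 : (v - c : ℝ) < β := by exact_mod_cast h'
        exact ⟨β - (v - c), by linarith, Or.inl ⟨e1, by linarith⟩⟩
      · have e1 : (α : ℝ) ≤ c - v := by exact_mod_cast h
        have e2 : (c - u : ℝ) < β := by exact_mod_cast h'
        exact ⟨β - (c - u), by linarith, Or.inr ⟨e1, by linarith⟩⟩
    obtain ⟨ε, hε, h6'⟩ := hε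
    refine (hMCP.le_rayLaw hgeo hnb hN hφ hQ ((hCm.inter hC).prod measurableSet_Icc) (c := c)
      p1 p2 p3 hε h4 h5 ?_).trans (measure_mono ?_)
    · refine h6'.imp ?_ ?_
      · rintro ⟨e1, e2⟩ p ⟨⟨-, hp1⟩, hp2, hp3⟩
        exact ⟨by linarith, by linarith, hp1⟩
      · rintro ⟨e1, e2⟩ p ⟨⟨-, hp1⟩, hp2, hp3⟩
        exact ⟨by linarith, by linarith, hp1⟩
    · rintro ⟨q, a⟩ ⟨hp1, hp2, hp3⟩
      simp only at hp2 hp3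
      have e1 : (u - c : ℝ) ≤ (a - c) / t := by linarith
      have e2 : (a - c) / t ≤ (v - c : ℝ) := by linarith
      rw [le_div_iff₀ p1] at e1
      rw [div_le_iff₀ p1] at e2
      exact ⟨hp1, by simp only; linarith, by simp only; linarith⟩
  rw [ae_restrict_iff' hC] at key
  filter_upwards [key] with q hq hc _ _ _ _ _ _ using hq hc

theorem MCP.ae_isContracting (hgeo : IsGeodesicSpace X) (hnb : IsNonBranching X)
    (hMCP : MCP m K N) (hN : 1 < N) (hφ : LipschitzWith 1 φ) (hQ : IsRayQuotient φ 𝔔) :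
    ∀ᵐ q ∂(quotientMeasure m φ 𝔔),
      IsContracting (K / (N - 1)) (N - 1) (levelKernel m φ 𝔔 q) (rayLevels φ 𝔔 q) := by
  filter_upwards [ae_levelKernel_compl hφ hQ, hMCP.ae_contractsRat hgeo hnb hN hφ hQ,
    hMCP.ae_levelKernel_absolutelyContinuous hgeo hnb hN hφ hQ] with q h1 h2 h3
  exact ⟨by linarith, convex_rayLevels hgeo hφ hQ q, h1, IsProbabilityMeasure.ne_zero _, h3, h2⟩

/-- The density of `m` in ray coordinates. -/
noncomputable def rayDensity (m : Measure X) [IsFiniteMeasure m] (φ : X → ℝ) (𝔔 : X → X) (q : X)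
    (t : ℝ) : ℝ :=
  rightDensity (levelKernel m φ 𝔔 q) (φ q - t)

/-- This is why `rightDensity` uses a sequence: a countable limsup of measurable functions is
measurable. -/
theorem measurable_rightDensity_kernel {Y : Type*} [MeasurableSpace Y] (κ : Kernel Y ℝ)
    [IsSFiniteKernel κ] : Measurable fun p : Y × ℝ => rightDensity (κ p.1) p.2 := by
  have h1 : ∀ r : ℝ, Measurable fun p : Y × ℝ => κ p.1 (Icc p.2 (p.2 + r)) := by
    intro r
    have hS : MeasurableSet ({z : (Y × ℝ) × ℝ | z.1.2 ≤ z.2} ∩ {z | z.2 ≤ z.1.2 + r}) :=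
      (measurableSet_le (by fun_prop) (by fun_prop)).inter
        (measurableSet_le (by fun_prop) (by fun_prop))
    exact Kernel.measurable_kernel_prodMk_left (κ := κ.comap Prod.fst measurable_fst) hS
  have h2 : Measurable fun p : Y × ℝ => limsup (fun k : ℕ =>
      κ p.1 (Icc p.2 (p.2 + 1 / ((k : ℝ) + 1))) / ENNReal.ofReal (1 / ((k : ℝ) + 1))) atTop :=
    Measurable.limsup fun k => (h1 _).div_const _
  unfold rightDensity
  refine Measurable.ite ?_ measurable_const h2.ennreal_toReal
  exact (h2 (measurableSet_singleton 0)).union (h2 (measurableSet_singleton ∞))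

theorem measurable_rayDensity {X : Type*} [MetricSpace X] [MeasurableSpace X] [BorelSpace X]
    {m : Measure X} [IsFiniteMeasure m] {φ : X → ℝ} {𝔔 : X → X} (hφ : LipschitzWith 1 φ) :
    Measurable (Function.uncurry (rayDensity m φ 𝔔)) := by
  have h := (measurable_rightDensity_kernel (levelKernel m φ 𝔔)).comp (measurable_shear hφ)
  convert h using 1
  funext p
  simp only [Function.uncurry_def, rayDensity, Function.comp_apply]

theorem measurable_rayMap_section (hφ : LipschitzWith 1 φ) (hQ : IsRayQuotient φ 𝔔) (q : X) :
    Measurable (rayMap φ 𝔔 q) :=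
  (measurable_rayMap hφ hQ).comp (measurable_const.prodMk measurable_id)

/-- The reflection `a ↦ φ q - a` exchanges levels and ray parameters and preserves Lebesgue measure.
-/
theorem rayMeasure_eq_map {κ n : ℝ} (hφ : LipschitzWith 1 φ) (hQ : IsRayQuotient φ 𝔔) {q : X}
    (hq : IsContracting κ n (levelKernel m φ 𝔔 q) (rayLevels φ 𝔔 q)) :
    rayMeasure φ 𝔔 q (rayDensity m φ 𝔔 q) =
      (levelKernel m φ 𝔔 q).map fun a => rayMap φ 𝔔 q (φ q - a) := by
  have hm : Measurable fun a : ℝ => φ q - a := by fun_prop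
  have hJ : MeasurableSet (rayLevels φ 𝔔 q) := hq.convex.ordConnected.measurableSet
  have hD : rayDom φ 𝔔 q = (fun a => φ q - a) ⁻¹' rayLevels φ 𝔔 q := by
    ext t; exact hQ.mem_rayDom_iff hφ
  have hr : Measurable fun a => ENNReal.ofReal (rightDensity (levelKernel m φ 𝔔 q) a) :=
    ((measurable_rightDensity_kernel (levelKernel m φ 𝔔)).comp
      (measurable_const.prodMk measurable_id : Measurable fun a : ℝ => (q, a))).ennreal_ofReal
  have key : (volume.restrict (rayDom φ 𝔔 q)).withDensity
      (fun t => ENNReal.ofReal (rayDensity m φ 𝔔 q t)) =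
        (levelKernel m φ 𝔔 q).map fun a => φ q - a := by
    ext B hB
    rw [Measure.map_apply hm hB, hq.eq_withDensity, withDensity_apply _ hB,
      withDensity_apply _ (hm hB), Measure.restrict_restrict hB, Measure.restrict_restrict (hm hB),
      hD]
    have hmp : MeasurePreserving (fun a : ℝ => φ q - a) volume volume :=
      Measure.measurePreserving_sub_left volume (φ q)
    have := hmp.setLIntegral_comp_preimage ((hm hB).inter hJ) hr
    rw [← this]
    congr 2
    ext a
    simp
  rw [rayMeasure, key, Measure.map_map (measurable_rayMap_section hφ hQ q) hm]
  rfl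

end Conditional

/-! ### Disintegration along the rays -/

section Disintegration

variable {X : Type*} [MetricSpace X] [MeasurableSpace X] [BorelSpace X] [ProperSpace X]
  {m : Measure X} [IsFiniteMeasure m] {K N : ℝ} {φ : X → ℝ} {𝔔 : X → X}

theorem measurableSet_rayMap_shear (hφ : LipschitzWith 1 φ) (hQ : IsRayQuotient φ 𝔔) {B : Set X}
    (hB : MeasurableSet B) : MeasurableSet {p : X × ℝ | rayMap φ 𝔔 p.1 (φ p.1 - p.2) ∈ B} :=
  ((measurable_rayMap hφ hQ).comp (measurable_shear hφ)) hB

theorem MCP.ae_rayMeasure_apply (hgeo : IsGeodesicSpace X) (hnb : IsNonBranching X)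
    (hMCP : MCP m K N) (hN : 1 < N) (hφ : LipschitzWith 1 φ) (hQ : IsRayQuotient φ 𝔔) {B : Set X}
    (hB : MeasurableSet B) :
    (fun q => rayMeasure φ 𝔔 q (rayDensity m φ 𝔔 q) B) =ᵐ[quotientMeasure m φ 𝔔]
      fun q => levelKernel m φ 𝔔 q {a | rayMap φ 𝔔 q (φ q - a) ∈ B} := by
  filter_upwards [hMCP.ae_isContracting hgeo hnb hN hφ hQ] with q hq
  rw [rayMeasure_eq_map hφ hQ hq, Measure.map_apply _ hB]
  · rfl
  · exact (measurable_rayMap_section hφ hQ q).comp (by fun_prop)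

theorem measurable_levelKernel_rayMap (hφ : LipschitzWith 1 φ) (hQ : IsRayQuotient φ 𝔔) {B : Set X}
    (hB : MeasurableSet B) :
    Measurable fun q => levelKernel m φ 𝔔 q {a | rayMap φ 𝔔 q (φ q - a) ∈ B} :=
  Kernel.measurable_kernel_prodMk_left (measurableSet_rayMap_shear hφ hQ hB)

theorem MCP.aemeasurable_rayMeasure (hgeo : IsGeodesicSpace X) (hnb : IsNonBranching X)
    (hMCP : MCP m K N) (hN : 1 < N) (hφ : LipschitzWith 1 φ) (hQ : IsRayQuotient φ 𝔔) {B : Set X}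
    (hB : MeasurableSet B) :
    AEMeasurable (fun q => rayMeasure φ 𝔔 q (rayDensity m φ 𝔔 q) B) (quotientMeasure m φ 𝔔) :=
  ⟨_, measurable_levelKernel_rayMap hφ hQ hB, hMCP.ae_rayMeasure_apply hgeo hnb hN hφ hQ hB⟩

theorem MCP.setLIntegral_rayMeasure (hgeo : IsGeodesicSpace X) (hnb : IsNonBranching X)
    (hMCP : MCP m K N) (hN : 1 < N) (hφ : LipschitzWith 1 φ) (hQ : IsRayQuotient φ 𝔔) {B C : Set X}
    (hB : MeasurableSet B) (hC : MeasurableSet C) :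
    ∫⁻ q in C, rayMeasure φ 𝔔 q (rayDensity m φ 𝔔 q) B ∂(quotientMeasure m φ 𝔔) =
      m (transportSet φ ∩ B ∩ 𝔔 ⁻¹' C) := by
  have hS := (measurable_fst hC).inter (measurableSet_rayMap_shear hφ hQ hB)
  rw [lintegral_congr_ae (ae_restrict_of_ae (hMCP.ae_rayMeasure_apply hgeo hnb hN hφ hQ hB)),
    ← lintegral_indicator hC]
  have h1 : ∀ q, C.indicator (fun q => levelKernel m φ 𝔔 q {a | rayMap φ 𝔔 q (φ q - a) ∈ B}) q =
      levelKernel m φ 𝔔 q (Prod.mk q ⁻¹'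
        (Prod.fst ⁻¹' C ∩ {p : X × ℝ | rayMap φ 𝔔 p.1 (φ p.1 - p.2) ∈ B})) := by
    intro q
    by_cases hq : q ∈ C
    · rw [indicator_of_mem hq]
      congr 1
      ext a
      simp [hq]
    · rw [indicator_of_notMem hq]
      symm
      convert measure_empty (μ := levelKernel m φ 𝔔 q)
      ext a
      simp [hq]
  simp_rw [h1]
  rw [← Measure.compProd_apply hS, compProd_levelKernel hφ hQ, rayLaw_apply hφ hQ hS]
  congr 1
  ext x
  simp only [mem_ofPred_eq, mem_inter_iff, mem_preimage]
  constructor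
  · rintro ⟨hx, hxC, hxB⟩
    rw [hQ.rayMap_eq hφ hx] at hxB
    exact ⟨⟨hx, hxB⟩, hxC⟩
  · rintro ⟨⟨hx, hxB⟩, hxC⟩
    refine ⟨hx, hxC, ?_⟩
    rwa [hQ.rayMap_eq hφ hx]

theorem totalRayMeasure_apply {X : Type*} [MetricSpace X] [MeasurableSpace X] [BorelSpace X]
    [ProperSpace X] {m : Measure X} {φ : X → ℝ} {𝔔 : X → X} (hφ : LipschitzWith 1 φ)
    (hQ : IsRayQuotient φ 𝔔) {h : X → ℝ → ℝ} (hh : Measurable (Function.uncurry h)) {B : Set X}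
    (hB : MeasurableSet B) :
    totalRayMeasure m φ 𝔔 h B = ∫⁻ q, rayMeasure φ 𝔔 q (h q) B ∂(quotientMeasure m φ 𝔔) := by
  have hg := measurable_rayMap hφ hQ
  have hD := measurableSet_rayDom hφ hQ
  have hS := (hg hB).inter hD
  have hh' : Measurable fun p : X × ℝ => ENNReal.ofReal (h p.1 p.2) := hh.ennreal_ofReal
  rw [totalRayMeasure, Measure.map_apply hg hB, withDensity_apply _ (hg hB),
    Measure.restrict_restrict (hg hB), ← lintegral_indicator hS,
    lintegral_prod _ (hh'.indicator hS).aemeasurable]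
  refine lintegral_congr fun q => ?_
  have hq := measurable_rayMap_section hφ hQ q
  have hSq : MeasurableSet (rayMap φ 𝔔 q ⁻¹' B ∩ rayDom φ 𝔔 q) :=
    (measurable_const.prodMk measurable_id : Measurable fun t : ℝ => (q, t)) hS
  rw [rayMeasure, Measure.map_apply hq hB, withDensity_apply _ (hq hB),
    Measure.restrict_restrict (hq hB), ← lintegral_indicator hSq]
  rfl

theorem MCP.restrict_eq_totalRayMeasure (hgeo : IsGeodesicSpace X) (hnb : IsNonBranching X)
    (hMCP : MCP m K N) (hN : 1 < N) (hφ : LipschitzWith 1 φ) (hQ : IsRayQuotient φ 𝔔) :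
    m.restrict (transportSet φ) = totalRayMeasure m φ 𝔔 (rayDensity m φ 𝔔) := by
  ext B hB
  have := hMCP.setLIntegral_rayMeasure hgeo hnb hN hφ hQ hB MeasurableSet.univ
  rw [setLIntegral_univ, preimage_univ, inter_univ] at this
  rw [totalRayMeasure_apply hφ hQ (measurable_rayDensity hφ) hB, this, Measure.restrict_apply hB,
    inter_comm]

theorem MCP.ae_isProbabilityMeasure_rayMeasure (hgeo : IsGeodesicSpace X)
    (hnb : IsNonBranching X) (hMCP : MCP m K N) (hN : 1 < N) (hφ : LipschitzWith 1 φ)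
    (hQ : IsRayQuotient φ 𝔔) : ∀ᵐ q ∂(quotientMeasure m φ 𝔔),
      IsProbabilityMeasure (rayMeasure φ 𝔔 q (rayDensity m φ 𝔔 q)) := by
  filter_upwards [hMCP.ae_isContracting hgeo hnb hN hφ hQ] with q hq
  rw [rayMeasure_eq_map hφ hQ hq]
  exact Measure.isProbabilityMeasure_map
    ((measurable_rayMap_section hφ hQ q).comp (by fun_prop)).aemeasurable

theorem MCP.ae_rayMeasure_ray (hgeo : IsGeodesicSpace X) (hnb : IsNonBranching X)
    (hMCP : MCP m K N) (hN : 1 < N) (hφ : LipschitzWith 1 φ) (hQ : IsRayQuotient φ 𝔔) :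
    ∀ᵐ q ∂(quotientMeasure m φ 𝔔),
      rayMeasure φ 𝔔 q (rayDensity m φ 𝔔 q) {x | x ∈ transportSet φ ∧ 𝔔 x = q} = 1 := by
  filter_upwards [hMCP.ae_isContracting hgeo hnb hN hφ hQ] with q hq
  have hB : MeasurableSet {x | x ∈ transportSet φ ∧ 𝔔 x = q} :=
    hQ.measurableSet_preimage hφ measurable_fst (measurableSet_singleton q)
  have hm : Measurable fun a => rayMap φ 𝔔 q (φ q - a) :=
    (measurable_rayMap_section hφ hQ q).comp (by fun_prop)
  have := Measure.isProbabilityMeasure_map (μ := levelKernel m φ 𝔔 q) hm.aemeasurable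
  rw [rayMeasure_eq_map hφ hQ hq, ← prob_compl_eq_zero_iff hB, Measure.map_apply hm hB.compl]
  refine measure_mono_null (t := (rayLevels φ 𝔔 q)ᶜ)
    (fun a ha (haJ : a ∈ rayLevels φ 𝔔 q) => ha ?_) hq.null
  obtain ⟨h1, h2, -⟩ := hQ.rayMap_spec hφ (q := q) (t := φ q - a)
    ((hQ.mem_rayDom_iff hφ).2 (by rwa [sub_sub_cancel]))
  exact ⟨h1, h2⟩

theorem MCP.exists_isDisintegration (hgeo : IsGeodesicSpace X) (hnb : IsNonBranching X)
    (hMCP : MCP m K N) (hN : 1 < N) (hφ : LipschitzWith 1 φ) (hQ : IsRayQuotient φ 𝔔) :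
    ∃ μ : X → Measure X, IsDisintegration m φ 𝔔 μ := by
  classical
  let ν : X → Measure X := fun q => rayMeasure φ 𝔔 q (rayDensity m φ 𝔔 q)
  -- `IsDisintegration` asks for a probability measure at every `q` of the quotient set, so a Dirac
  -- mass is put in on the exceptional null set.
  let μ : X → Measure X := fun q => if IsProbabilityMeasure (ν q) then ν q else Measure.dirac q
  have hμ : ∀ᵐ q ∂(quotientMeasure m φ 𝔔), μ q = ν q := by
    filter_upwards [hMCP.ae_isProbabilityMeasure_rayMeasure hgeo hnb hN hφ hQ] with q hq
    exact if_pos hq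
  refine ⟨μ, ⟨fun q _ => ?_, fun B hB => ?_, fun B C hB hC => ?_, ?_⟩⟩
  · by_cases h : IsProbabilityMeasure (ν q)
    · simpa only [μ, if_pos h] using h
    · simp only [μ, if_neg h]
      infer_instance
  · refine (hMCP.aemeasurable_rayMeasure hgeo hnb hN hφ hQ hB).congr ?_
    filter_upwards [hμ] with q hq
    rw [hq]
  · rw [← hMCP.setLIntegral_rayMeasure hgeo hnb hN hφ hQ hB hC]
    refine lintegral_congr_ae (ae_restrict_of_ae ?_)
    filter_upwards [hμ] with q hq
    rw [hq]
  · filter_upwards [hμ, hMCP.ae_rayMeasure_ray hgeo hnb hN hφ hQ] with q hq hq'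
    rw [hq]
    exact hq'

/-- Strongly consistent disintegrations are unique. -/
theorem MCP.ae_eq_rayMeasure (hgeo : IsGeodesicSpace X) (hnb : IsNonBranching X)
    (hMCP : MCP m K N) (hN : 1 < N) (hφ : LipschitzWith 1 φ) (hQ : IsRayQuotient φ 𝔔)
    {μ : X → Measure X} (hμ : IsDisintegration m φ 𝔔 μ) :
    ∀ᵐ q ∂(quotientMeasure m φ 𝔔), μ q = rayMeasure φ 𝔔 q (rayDensity m φ 𝔔 q) := by
  have key : ∀ B, MeasurableSet B → ∀ᵐ q ∂(quotientMeasure m φ 𝔔),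
      μ q B = rayMeasure φ 𝔔 q (rayDensity m φ 𝔔 q) B := fun B hB =>
    ae_eq_of_forall_setLIntegral_eq_of_sigmaFinite₀ (hμ.measurable B hB)
      (hMCP.aemeasurable_rayMeasure hgeo hnb hN hφ hQ hB) fun C hC _ => by
        rw [← hμ.consistent B C hB hC, hMCP.setLIntegral_rayMeasure hgeo hnb hN hφ hQ hB hC]
  -- Embedding `X` in the line leaves countably many test sets, the rational intervals, which
  -- determine a finite measure.
  have he := measurableEmbedding_embeddingReal X
  have h2 : ∀ᵐ q ∂(quotientMeasure m φ 𝔔), ∀ a b : ℚ,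
      μ q (embeddingReal X ⁻¹' Ioo (a : ℝ) b) =
        rayMeasure φ 𝔔 q (rayDensity m φ 𝔔 q) (embeddingReal X ⁻¹' Ioo (a : ℝ) b) := by
    simp only [ae_all_iff]
    exact fun a b => key _ (he.measurable measurableSet_Ioo)
  filter_upwards [key univ MeasurableSet.univ, h2,
    hMCP.ae_isProbabilityMeasure_rayMeasure hgeo hnb hN hφ hQ] with q h1 h2 h3
  have hfin : IsFiniteMeasure (μ q) := ⟨by rw [h1]; exact measure_lt_top _ _⟩
  have h4 : (μ q).map (embeddingReal X) =
      (rayMeasure φ 𝔔 q (rayDensity m φ 𝔔 q)).map (embeddingReal X) :=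
    Real.measure_ext_Ioo_rat fun a b => by rw [he.map_apply, he.map_apply, h2 a b]
  ext B hB
  have h5 := congrArg (fun ρ => ρ (embeddingReal X '' B)) h4
  simp only [he.map_apply] at h5
  rwa [preimage_image_eq _ he.injective] at h5

theorem rayMeasure_absolutelyContinuous (hφ : LipschitzWith 1 φ) (hQ : IsRayQuotient φ 𝔔) (q : X)
    (f : ℝ → ℝ) : rayMeasure φ 𝔔 q f ≪ rayMeasure φ 𝔔 q fun _ => 1 := by
  refine Measure.AbsolutelyContinuous.map ?_ (measurable_rayMap_section hφ hQ q)
  simp only [ENNReal.ofReal_one]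
  rw [show (fun _ : ℝ => (1 : ℝ≥0∞)) = 1 from rfl, withDensity_one]
  exact withDensity_absolutelyContinuous _ _

end Disintegration

/-! ### Properties of the density along a ray -/

section RayDensity

variable {X : Type*} [MetricSpace X] [MeasurableSpace X] {m : Measure X} [IsFiniteMeasure m]
  {κ n : ℝ} {φ : X → ℝ} {𝔔 : X → X}

theorem convex_rayDom (hgeo : IsGeodesicSpace X) (hφ : LipschitzWith 1 φ)
    (hQ : IsRayQuotient φ 𝔔) (q : X) : Convex ℝ (rayDom φ 𝔔 q) := by
  refine OrdConnected.convex ⟨fun x hx y hy z hz => ?_⟩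
  rw [hQ.mem_rayDom_iff hφ] at *
  exact (convex_rayLevels hgeo hφ hQ q).ordConnected.out hy hx
    ⟨by linarith [hz.2], by linarith [hz.1]⟩

theorem rayDensity_bounds (hφ : LipschitzWith 1 φ) (hQ : IsRayQuotient φ 𝔔) {q : X}
    (hq : IsContracting κ n (levelKernel m φ 𝔔 q) (rayLevels φ 𝔔 q)) {σm s τ σp : ℝ}
    (h1 : σm < s) (h2 : s ≤ τ) (h3 : τ < σp) (hσm : σm ∈ rayDom φ 𝔔 q)
    (hσp : σp ∈ rayDom φ 𝔔 q) :
    (sn κ (σp - τ) / sn κ (σp - s)) ^ n ≤ rayDensity m φ 𝔔 q τ / rayDensity m φ 𝔔 q s ∧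
      rayDensity m φ 𝔔 q τ / rayDensity m φ 𝔔 q s ≤ (sn κ (τ - σm) / sn κ (s - σm)) ^ n := by
  rw [hQ.mem_rayDom_iff hφ] at hσm hσp
  constructor
  · have := hq.le_rightDensity_div_left hσp hσm (τ := φ q - τ) (s := φ q - s) (by linarith)
      (by linarith) (by linarith)
    rwa [sub_sub_sub_cancel_left, sub_sub_sub_cancel_left] at this
  · have := hq.le_rightDensity_div_right hσm hσp (τ := φ q - s) (s := φ q - τ) (by linarith)
      (by linarith) (by linarith)
    -- The contraction towards `σm` bounds `h s / h τ` from below; inverting gives the upper bound.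
    rw [sub_sub_sub_cancel_left, sub_sub_sub_cancel_left] at this
    have hlen := fun hκ => hq.length_le hκ hσp hσm
    have p1 : 0 < sn κ (s - σm) := sn_pos (by linarith) fun hκ => by linarith [hlen hκ]
    have p2 : 0 < sn κ (τ - σm) := sn_pos (by linarith) fun hκ => by linarith [hlen hκ]
    have p3 := Real.rpow_pos_of_pos (div_pos p1 p2) n
    have := inv_anti₀ p3 this
    rwa [inv_div, ← Real.inv_rpow (div_pos p1 p2).le, inv_div] at this

theorem locallyLipschitzOn_rayDensity (hφ : LipschitzWith 1 φ) (hQ : IsRayQuotient φ 𝔔) {q : X}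
    (hq : IsContracting κ n (levelKernel m φ 𝔔 q) (rayLevels φ 𝔔 q)) :
    LocallyLipschitzOn (interior (rayDom φ 𝔔 q)) (rayDensity m φ 𝔔 q) := by
  intro x hx
  have hD : rayDom φ 𝔔 q = Homeomorph.subLeft (φ q) ⁻¹' rayLevels φ 𝔔 q := by
    ext t; exact hQ.mem_rayDom_iff hφ
  rw [hD, ← Homeomorph.preimage_interior] at hx ⊢
  obtain ⟨L, u, hu, hL⟩ := hq.locallyLipschitzOn_rightDensity hx
  rw [isOpen_interior.nhdsWithin_eq hx] at hu
  refine ⟨L, Homeomorph.subLeft (φ q) ⁻¹' u, mem_nhdsWithin_of_mem_nhds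
    ((Homeomorph.subLeft (φ q)).continuous.continuousAt hu), ?_⟩
  refine LipschitzOnWith.of_dist_le_mul fun a ha b hb => ?_
  have := hL.dist_le_mul _ ha _ hb
  rwa [Homeomorph.coe_subLeft, dist_sub_left] at this

end RayDensity

end RayLocalization

/-! ### Assembly of the theorem. -/

theorem theorem5p8 {X : Type*} [MetricSpace X] [ProperSpace X] [MeasurableSpace X] [BorelSpace X]
    (hgeo : IsGeodesicSpace X) (hnb : IsNonBranching X)
    (m : Measure X) [IsProbabilityMeasure m] (K N : ℝ) (hN : 1 < N) (hMCP : MCP m K N)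
    (φ : X → ℝ) (hφ : LipschitzWith 1 φ) :
    (∃ (𝔔 : X → X) (μ : X → Measure X), IsRayQuotient φ 𝔔 ∧ IsDisintegration m φ 𝔔 μ) ∧
    ∀ 𝔔 : X → X, IsRayQuotient φ 𝔔 →
      ∃ h : X → ℝ → ℝ, Measurable (Function.uncurry h) ∧ (∀ q t, 0 ≤ h q t) ∧
        m.restrict (transportSet φ) = totalRayMeasure m φ 𝔔 h ∧
        (∀ μ : X → Measure X, IsDisintegration m φ 𝔔 μ →
          ∀ᵐ q ∂(quotientMeasure m φ 𝔔),
            μ q ≪ rayMeasure φ 𝔔 q (fun _ => 1) ∧ μ q = rayMeasure φ 𝔔 q (h q)) ∧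
        ∀ᵐ q ∂(quotientMeasure m φ 𝔔),
          (∀ σm s τ σp : ℝ, σm < s → s ≤ τ → τ < σp →
            σm ∈ rayDom φ 𝔔 q → s ∈ rayDom φ 𝔔 q → τ ∈ rayDom φ 𝔔 q → σp ∈ rayDom φ 𝔔 q →
            (sn (K / (N - 1)) (σp - τ) / sn (K / (N - 1)) (σp - s)) ^ (N - 1) ≤ h q τ / h q s ∧
            h q τ / h q s ≤
              (sn (K / (N - 1)) (τ - σm) / sn (K / (N - 1)) (s - σm)) ^ (N - 1)) ∧
          (∀ t ∈ rayDom φ 𝔔 q, 0 < h q t) ∧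
          Convex ℝ (rayDom φ 𝔔 q) ∧
          LocallyLipschitzOn (interior (rayDom φ 𝔔 q)) (h q) := by
  refine ⟨?_, fun 𝔔 hQ => ?_⟩
  · obtain ⟨𝔔, hQ⟩ := exists_isRayQuotient hgeo hnb hφ
    obtain ⟨μ, hμ⟩ := hMCP.exists_isDisintegration hgeo hnb hN hφ hQ
    exact ⟨𝔔, μ, hQ, hμ⟩
  · refine ⟨rayDensity m φ 𝔔, measurable_rayDensity hφ, fun q t => (rightDensity_pos _ _).le,
      hMCP.restrict_eq_totalRayMeasure hgeo hnb hN hφ hQ, fun μ hμ => ?_, ?_⟩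
    · filter_upwards [hMCP.ae_eq_rayMeasure hgeo hnb hN hφ hQ hμ] with q hq
      rw [hq]
      exact ⟨rayMeasure_absolutelyContinuous hφ hQ q _, rfl⟩
    · filter_upwards [hMCP.ae_isContracting hgeo hnb hN hφ hQ] with q hq
      exact ⟨fun σm s τ σp h1 h2 h3 hσm _ _ hσp => rayDensity_bounds hφ hQ hq h1 h2 h3 hσm hσp,
        fun t _ => rightDensity_pos _ _, convex_rayDom hgeo hφ hQ q,
        locallyLipschitzOn_rayDensity hφ hQ hq⟩
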